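/- Let $k$ be a field. All algebras are associative $k$-algebras with nondegenerate product, not necessarily unital, and $M(\cdot)$ denotes the multiplier algebra. Let $(Q,\Delta)$ be a regular multiplier Hopf algebra. A left $Q$-module algebra is an algebra $A$ with a left action $\rhd$ of $Q$ such that $Q\rhd A=A$ and $x\rhd(ab)=\sum(x_1\rhd a)(x_2\rhd b)$; a right $Q$-module algebra is an algebra $A$ with a right action $\lhd$ such that $A\lhd Q=A$ and $(ab)\lhd x=\sum(a\lhd x_1)(b\lhd x_2)$. A left $Q$-comodule algebra is an algebra $A$ with an injective homomorphism $\Gamma:A\to M(Q\otimes A)$, $\Gamma(a)=\sum a_{(-1)}\otimes a_0$, such that $\Gamma(a)(x\otimes 1),(x\otimes 1)\Gamma(a)\in Q\otimes A$ for all $a\in A$, $x\in Q$, and $(\iota\otimes\Gamma)\Gamma=(\Delta\otimes\iota)\Gamma$; right $Q$-comodule algebras, $\Upsilon:A\to M(A\otimes Q)$, $\Upsilon(a)=\sum a_0\otimes a_{(1)}$, are defined symmetrically. A left $Q$-module algebra that is also a left $Q$-comodule algebra lies in ${}^Q_Q\mathcal{LA}$ if $\Gamma(x\rhd a)(y\otimes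 1)=\sum a_{(-1)}y\otimes (x\rhd a_0)$ for all $x,y\in Q$, $a\in A$. A right $Q$-module algebra that is also a right $Q$-comodule algebra lies in $\mathcal{LA}^Q_Q$ if $\Upsilon(a\lhd x)(1\otimes y)=\sum (a_0\lhd x)\otimes a_{(1)}y$ for all $x,y\in Q$, $a\in A$. Finally, $A\in{}^Q_Q\mathcal{LA}^Q_Q$ means that $A$ is a $Q$-bimodule algebra (that is, a left and a right $Q$-module algebra with $(x\rhd a)\lhd y=x\rhd(a\lhd y)$) and a $Q$-bicomodule algebra (that is, a left and a right $Q$-comodule algebra with $(1\otimes1\otimes x)\,(\iota\otimes\Upsilon)(\Gamma(a)(y\otimes1))=(\Gamma\otimes\iota)((1\otimes x)\Upsilon(a))\,(y\otimes1\otimes 1)$), satisfying these two conditions and also $\Upsilon(x\rhd a)(1\otimes y)=\sum (x\rhd a_0)\otimes a_{(1)}y$ and $\Gamma(a\lhd x)(y\otimes 1)=\sum a_{(-1)}y\otimes (a_0\lhd x)$ for all $x,y\in Q$, $a\in A$. For $A\in{}^Q_Q\mathcal{LA}$ the left twisted product is $a\bullet b=\sum a_0(a_{(-1)}\rhd b)$;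 for $A\in\mathcal{LA}^Q_Q$ the right twisted product is $a\ast b=\sum(a\lhd b_{(1)})b_0$; for $A\in{}^Q_Q\mathcal{LA}^Q_Q$ the L-R-twisted product is $a\circledast b=\sum(a_0\lhd b_{(1)})(a_{(-1)}\rhd b_0)$. The infinite sums are covered through the actions: $a\bullet(y\rhd b)=\sum a_0(a_{(-1)}y\rhd b)$, $(a\lhd y)\ast b=\sum(a\lhd yb_{(1)})b_0$, and $(a\lhd y)\circledast(z\rhd b)=\sum(a_0\lhd yb_{(1)})(a_{(-1)}z\rhd b_0)$. **Proposition 4.4.** Let $A\in{}^Q_Q\mathcal{LA}^Q_Q$. Then $\bullet$, $\ast$ and $\circledast$ are well-defined bilinear products on $A$, and: 1. $(A,\bullet)$, with the given right action and right coaction of $Q$, lies in $\mathcal{LA}^Q_Q$, and its right twisted product is $\circledast$. 2. $(A,\ast)$, with the given left action and left coaction of $Q$, lies in ${}^Q_Q\mathcal{LA}$, and its left twisted product is $\circledast$. Here "the given coaction" means that $\Upsilon(a)(1\otimes x)$ and $(1\otimes x)\Upsilon(a)$ (respectively $\Gamma(a)(x\otimes1)$ and $(x\otimes1)\Gamma(a)$)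 are the same elements of $A\otimes Q$ (respectively $Q\otimes A$) for the new product as for the old one. -/

import Mathlib

open scoped TensorProduct

noncomputable section

namespace TwistedAlg

/-! ### Products and multipliers

Several products on one vector space occur side by side, so the notions below take the product as an
explicit bilinear map `μ : V →ₗ[k] V →ₗ[k] V`. -/

section Multipliers

variable {k V W : Type*} [Field k] [AddCommGroup V] [Module k V] [AddCommGroup W] [Module k W]

/-- `μ` is an associative product on `V` and it is nondegenerate. -/
structure IsAlg (μ : V →ₗ[k] V →ₗ[k] V) : Prop where
  assoc : ∀ a b c, μ (μ a b) c = μ a (μ b c)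
  nondeg_left : ∀ a, (∀ b, μ a b = 0) → a = 0
  nondeg_right : ∀ b, (∀ a, μ a b = 0) → b = 0

/-- The product of the tensor product algebra: `(a ⊗ b) (c ⊗ d) = a c ⊗ b d`. -/
def tensorProd (μ : V →ₗ[k] V →ₗ[k] V) (ν : W →ₗ[k] W →ₗ[k] W) :
    V ⊗[k] W →ₗ[k] V ⊗[k] W →ₗ[k] V ⊗[k] W :=
  TensorProduct.map₂ μ ν

/-- Pairs of linear maps `(m₁, m₂)`, multiplied by `(m₁, m₂) (n₁, n₂) = (m₁ ∘ n₁, n₂ ∘ m₂)`. -/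
abbrev LinPair (k V : Type*) [Field k] [AddCommGroup V] [Module k V] : Type _ :=
  Module.End k V × (Module.End k V)ᵐᵒᵖ

/-- The multiplier algebra `M(V)` of `(V, μ)`: the pairs `(m₁, m₂)` of linear maps with
`m₂(a) b = a m₁(b)`. One writes `m · a = m₁(a)` and `a · m = m₂(a)`. -/
def multiplierAlgebra (μ : V →ₗ[k] V →ₗ[k] V) : Subalgebra k (LinPair k V) where
  carrier := {m | ∀ a b, μ (m.2.unop a) b = μ a (m.1 b)}
  mul_mem' := by
    intro m n hm hn a b
    simp only [Set.mem_ofPred_eq] at hm hn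
    simp [hm, hn]
  add_mem' := by
    intro m n hm hn a b
    simp only [Set.mem_ofPred_eq] at hm hn
    simp [hm, hn]
  algebraMap_mem' := by
    intro r a b
    simp [Module.algebraMap_end_apply]

/-- The left operation `a ↦ m · a` of a multiplier. -/
def mulOn {μ : V →ₗ[k] V →ₗ[k] V} (m : multiplierAlgebra μ) : V →ₗ[k] V :=
  (m : LinPair k V).1

/-- The right operation `a ↦ a · m` of a multiplier. -/
def onMul {μ : V →ₗ[k] V →ₗ[k] V} (m : multiplierAlgebra μ) : V →ₗ[k] V :=
  (m : LinPair k V).2.unop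

/-- An element `v` of `V` as a pair `(v ·, · v)`; for an associative product this is the canonical
embedding of `V` in `M(V)`. -/
def ofElem (μ : V →ₗ[k] V →ₗ[k] V) (v : V) : LinPair k V :=
  (μ v, MulOpposite.op (μ.flip v))

/-- The multiplier `v ⊗ 1` of `V ⊗ W`. -/
def firstLeg (W : Type*) [AddCommGroup W] [Module k W] (μ : V →ₗ[k] V →ₗ[k] V) (v : V) :
    LinPair k (V ⊗[k] W) :=
  ((μ v).rTensor W, MulOpposite.op ((μ.flip v).rTensor W))

/-- The multiplier `1 ⊗ w` of `V ⊗ W`. -/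
def secondLeg (V : Type*) [AddCommGroup V] [Module k V] (ν : W →ₗ[k] W →ₗ[k] W) (w : W) :
    LinPair k (V ⊗[k] W) :=
  ((ν w).lTensor V, MulOpposite.op ((ν.flip w).lTensor V))

/-- The flip `τ` on multipliers of `V ⊗ V`. -/
def flipMultiplier {μ : V →ₗ[k] V →ₗ[k] V} (m : multiplierAlgebra (tensorProd μ μ)) :
    multiplierAlgebra (tensorProd μ μ) :=
  ⟨((TensorProduct.comm k V V).toLinearMap ∘ₗ mulOn m ∘ₗ (TensorProduct.comm k V V).toLinearMap,
    MulOpposite.op ((TensorProduct.comm k V V).toLinearMap ∘ₗ onMul m ∘ₗ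
      (TensorProduct.comm k V V).toLinearMap)), by
    have key : ∀ s t, tensorProd μ μ (TensorProduct.comm k V V s) t =
        TensorProduct.comm k V V (tensorProd μ μ s (TensorProduct.comm k V V t)) := by
      intro s t
      induction s with
      | zero => simp
      | add x y hx hy => simp [hx, hy]
      | tmul a b =>
        induction t with
        | zero => simp
        | add x y hx hy => simp only [map_add, hx, hy]
        | tmul c d => simp [tensorProd]
    intro s t
    have h := m.2 (TensorProduct.comm k V V s) (TensorProduct.comm k V V t)
    change tensorProd μ μ (onMul m (TensorProduct.comm k V V s)) _ =
      tensorProd μ μ _ (mulOn m (TensorProduct.comm k V V t)) at h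
    change tensorProd μ μ (TensorProduct.comm k V V (onMul m (TensorProduct.comm k V V s))) t =
      tensorProd μ μ s (TensorProduct.comm k V V (mulOn m (TensorProduct.comm k V V t)))
    have hc : ∀ r, TensorProduct.comm k V V (TensorProduct.comm k V V r) = r :=
      (TensorProduct.comm k V V).symm_apply_apply
    rw [key, h, key, hc]⟩

end Multipliers

/-! ### Multiplier Hopf algebras -/

section Hopf

variable (k Q : Type*) [Field k] [NonUnitalRing Q] [Module k Q] [IsScalarTower k Q Q]
  [SMulCommClass k Q Q]

/-- `M(Q ⊗ Q)`. -/
abbrev MTensor : Subalgebra k (LinPair k (Q ⊗[k] Q)) :=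
  multiplierAlgebra (tensorProd (LinearMap.mul k Q) (LinearMap.mul k Q))

variable {k Q}

/-- The algebra homomorphism `Δ : Q → M(Q ⊗ Q)` is a comultiplication with canonical maps
`T₁ (x ⊗ y) = Δ(x) (1 ⊗ y)` and `T₂ (x ⊗ y) = (x ⊗ 1) Δ(y)`, both taking values in `Q ⊗ Q`, and
`(T₂ ⊗ id) (id ⊗ T₁) = (id ⊗ T₁) (T₂ ⊗ id)`. -/
structure IsComultiplication (Δ : Q →ₙₐ[k] MTensor k Q)
    (T₁ T₂ : Q ⊗[k] Q →ₗ[k] Q ⊗[k] Q) : Prop where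
  cover₁ : ∀ x y, ofElem (tensorProd (LinearMap.mul k Q) (LinearMap.mul k Q)) (T₁ (x ⊗ₜ y)) =
    (Δ x : LinPair k (Q ⊗[k] Q)) * secondLeg Q (LinearMap.mul k Q) y
  cover₂ : ∀ x y, ofElem (tensorProd (LinearMap.mul k Q) (LinearMap.mul k Q)) (T₂ (x ⊗ₜ y)) =
    firstLeg Q (LinearMap.mul k Q) x * (Δ y : LinPair k (Q ⊗[k] Q))
  coassoc : ∀ x y z : Q,
    T₂.rTensor Q ((TensorProduct.assoc k Q Q Q).symm (x ⊗ₜ T₁ (y ⊗ₜ z))) =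
      (TensorProduct.assoc k Q Q Q).symm
        (T₁.lTensor Q (TensorProduct.assoc k Q Q Q (T₂ (x ⊗ₜ y) ⊗ₜ z)))

/-- `(Q, Δ)` is a multiplier Hopf algebra: the product of `Q` is nondegenerate and `Δ` is a
comultiplication whose canonical maps are bijective. -/
def IsMultiplierHopf (Δ : Q →ₙₐ[k] MTensor k Q) : Prop :=
  IsAlg (LinearMap.mul k Q) ∧ ∃ T₁ T₂ : Q ⊗[k] Q →ₗ[k] Q ⊗[k] Q,
    IsComultiplication Δ T₁ T₂ ∧ Function.Bijective T₁ ∧ Function.Bijective T₂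

/-- `(Q, Δ)` is a regular multiplier Hopf algebra: `(Q, τ Δ)` is a multiplier Hopf algebra too. -/
def IsRegularMultiplierHopf (Δ : Q →ₙₐ[k] MTensor k Q) : Prop :=
  IsMultiplierHopf Δ ∧ ∃ Δ' : Q →ₙₐ[k] MTensor k Q,
    (∀ x, Δ' x = flipMultiplier (Δ x)) ∧ IsMultiplierHopf Δ'

/-- `p ↦ Δ(p) t`, for `t ∈ Q ⊗ Q`. -/
def comulMul (Δ : Q →ₙₐ[k] MTensor k Q) (t : Q ⊗[k] Q) : Q →ₗ[k] Q ⊗[k] Q where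
  toFun p := mulOn (Δ p) t
  map_add' p q := by simp [mulOn]
  map_smul' c p := by simp [mulOn]

end Hopf

/-! ### Module algebras -/

section ModuleAlgebras

variable {k Q A : Type*} [Field k] [NonUnitalRing Q] [Module k Q] [IsScalarTower k Q Q]
  [SMulCommClass k Q Q] [AddCommGroup A] [Module k A]

/-- `(A, μ)` is a (unital) left `Q`-module algebra under `x ▷ a = act x a`. The law
`x ▷ (a b) = ∑ (x₁ ▷ a) (x₂ ▷ b)` is written with both factors covered through the action:
`x ▷ ((y ▷ a) (z ▷ b)) = ∑ (x₁ y ▷ a) (x₂ z ▷ b)`, where `∑ x₁ y ⊗ x₂ z = Δ(x) (y ⊗ z)`;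
as `Q ▷ A = A`, this is the law for all elements. -/
structure IsLeftModuleAlgebra (Δ : Q →ₙₐ[k] MTensor k Q) (μ : A →ₗ[k] A →ₗ[k] A)
    (act : Q →ₗ[k] A →ₗ[k] A) : Prop where
  mul_act : ∀ x y a, act (x * y) a = act x (act y a)
  unital : Submodule.span k {b | ∃ x a, b = act x a} = ⊤
  act_mul : ∀ x y z a b, act x (μ (act y a) (act z b)) =
    TensorProduct.lift μ
      (TensorProduct.map (act.flip a) (act.flip b) (mulOn (Δ x) (y ⊗ₜ z)))

/-- `(A, μ)` is a (unital) right `Q`-module algebra under `a ◁ x = ract a x`. The law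
`(a b) ◁ x = ∑ (a ◁ x₁) (b ◁ x₂)` is written in covered form:
`((a ◁ y) (b ◁ z)) ◁ x = ∑ (a ◁ y x₁) (b ◁ z x₂)`, where `∑ y x₁ ⊗ z x₂ = (y ⊗ z) Δ(x)`. -/
structure IsRightModuleAlgebra (Δ : Q →ₙₐ[k] MTensor k Q) (μ : A →ₗ[k] A →ₗ[k] A)
    (ract : A →ₗ[k] Q →ₗ[k] A) : Prop where
  act_mul : ∀ a x y, ract a (x * y) = ract (ract a x) y
  unital : Submodule.span k {b | ∃ a x, b = ract a x} = ⊤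
  mul_act : ∀ x y z a b, ract (μ (ract a y) (ract b z)) x =
    TensorProduct.lift μ
      (TensorProduct.map (ract a) (ract b) (onMul (Δ x) (y ⊗ₜ z)))

end ModuleAlgebras

/-! ### Comodule algebras -/

/-- The covered values of a left coaction `Γ : A → M(Q ⊗ A)`. They do not involve the product
of `A`. -/
structure LeftCoaction (k Q A : Type*) [Field k] [NonUnitalRing Q] [Module k Q]
    [AddCommGroup A] [Module k A] where
  /-- `a, x ↦ Γ(a) (x ⊗ 1) = ∑ a₍₋₁₎ x ⊗ a₍₀₎` -/
  coverRight : A →ₗ[k] Q →ₗ[k] Q ⊗[k] A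
  /-- `a, x ↦ (x ⊗ 1) Γ(a) = ∑ x a₍₋₁₎ ⊗ a₍₀₎` -/
  coverLeft : A →ₗ[k] Q →ₗ[k] Q ⊗[k] A

/-- The covered values of a right coaction `Υ : A → M(A ⊗ Q)`. -/
structure RightCoaction (k Q A : Type*) [Field k] [NonUnitalRing Q] [Module k Q]
    [AddCommGroup A] [Module k A] where
  /-- `a, x ↦ Υ(a) (1 ⊗ x) = ∑ a₍₀₎ ⊗ a₍₁₎ x` -/
  coverRight : A →ₗ[k] Q →ₗ[k] A ⊗[k] Q
  /-- `a, x ↦ (1 ⊗ x) Υ(a) = ∑ a₍₀₎ ⊗ x a₍₁₎` -/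
  coverLeft : A →ₗ[k] Q →ₗ[k] A ⊗[k] Q

section ComoduleAlgebras

variable {k Q A : Type*} [Field k] [NonUnitalRing Q] [Module k Q] [IsScalarTower k Q Q]
  [SMulCommClass k Q Q] [AddCommGroup A] [Module k A]

/-- `u ⊗ v ↦ (id ⊗ Γ)Γ(a) (u ⊗ v ⊗ 1) = (id ⊗ Γ)(Γ(a) (u ⊗ 1)) (1 ⊗ v ⊗ 1)`. -/
def LeftCoaction.iterate (γ : LeftCoaction k Q A) (a : A) :
    Q ⊗[k] Q →ₗ[k] Q ⊗[k] (Q ⊗[k] A) :=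
  TensorProduct.lift
    ((LinearMap.lTensorHom Q ∘ₗ γ.coverRight.flip).flip ∘ₗ γ.coverRight a)

/-- `u ⊗ v ↦ (Υ ⊗ id)Υ(a) (1 ⊗ u ⊗ v) = (Υ ⊗ id)(Υ(a) (1 ⊗ v)) (1 ⊗ u ⊗ 1)`. -/
def RightCoaction.iterate (ρ : RightCoaction k Q A) (a : A) :
    Q ⊗[k] Q →ₗ[k] (A ⊗[k] Q) ⊗[k] Q :=
  TensorProduct.lift
    ((LinearMap.rTensorHom Q ∘ₗ ρ.coverRight.flip).compl₂ (ρ.coverRight a))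

/-- `(A, μ)` is a left `Q`-comodule algebra: there is an injective homomorphism
`Γ : A → M(Q ⊗ A)` with `Γ(a) (x ⊗ 1)` and `(x ⊗ 1) Γ(a)` in `Q ⊗ A`, given by `γ`, and
`(Δ ⊗ id)Γ = (id ⊗ Γ)Γ`. The last identity is evaluated on the elements `Δ(q) t ⊗ 1`, which span
`Q ⊗ Q ⊗ 1`, by `(Δ ⊗ id)Γ(a) (Δ(q) t ⊗ 1) = (Δ ⊗ id)(Γ(a) (q ⊗ 1)) (t ⊗ 1)`. -/
structure IsLeftComoduleAlgebra (Δ : Q →ₙₐ[k] MTensor k Q) (μ : A →ₗ[k] A →ₗ[k] A)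
    (γ : LeftCoaction k Q A) : Prop where
  exists_hom : ∃ Γ : A →ₗ[k] multiplierAlgebra (tensorProd (LinearMap.mul k Q) μ),
    Function.Injective Γ ∧ (∀ a b, Γ (μ a b) = Γ a * Γ b) ∧
    (∀ a x, (Γ a : LinPair k (Q ⊗[k] A)) * firstLeg A (LinearMap.mul k Q) x =
      ofElem (tensorProd (LinearMap.mul k Q) μ) (γ.coverRight a x)) ∧
    (∀ a x, firstLeg A (LinearMap.mul k Q) x * (Γ a : LinPair k (Q ⊗[k] A)) =
      ofElem (tensorProd (LinearMap.mul k Q) μ) (γ.coverLeft a x))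
  coassoc : ∀ a q t,
    TensorProduct.assoc k Q Q A ((comulMul Δ t).rTensor A (γ.coverRight a q)) =
      γ.iterate a (comulMul Δ t q)

/-- `(A, μ)` is a right `Q`-comodule algebra: there is an injective homomorphism
`Υ : A → M(A ⊗ Q)` with `Υ(a) (1 ⊗ x)` and `(1 ⊗ x) Υ(a)` in `A ⊗ Q`, given by `ρ`, and
`(id ⊗ Δ)Υ = (Υ ⊗ id)Υ`, evaluated on the elements `1 ⊗ Δ(q) t`. -/
structure IsRightComoduleAlgebra (Δ : Q →ₙₐ[k] MTensor k Q) (μ : A →ₗ[k] A →ₗ[k] A)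
    (ρ : RightCoaction k Q A) : Prop where
  exists_hom : ∃ Υ : A →ₗ[k] multiplierAlgebra (tensorProd μ (LinearMap.mul k Q)),
    Function.Injective Υ ∧ (∀ a b, Υ (μ a b) = Υ a * Υ b) ∧
    (∀ a x, (Υ a : LinPair k (A ⊗[k] Q)) * secondLeg A (LinearMap.mul k Q) x =
      ofElem (tensorProd μ (LinearMap.mul k Q)) (ρ.coverRight a x)) ∧
    (∀ a x, secondLeg A (LinearMap.mul k Q) x * (Υ a : LinPair k (A ⊗[k] Q)) =
      ofElem (tensorProd μ (LinearMap.mul k Q)) (ρ.coverLeft a x))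
  coassoc : ∀ a q t,
    (comulMul Δ t).lTensor A (ρ.coverRight a q) =
      TensorProduct.assoc k A Q Q (ρ.iterate a (comulMul Δ t q))

end ComoduleAlgebras

/-! ### Long module algebras and twisted products -/

section Long

variable {k Q A : Type*} [Field k] [NonUnitalRing Q] [Module k Q] [IsScalarTower k Q Q]
  [SMulCommClass k Q Q] [AddCommGroup A] [Module k A]

/-- `(A, μ)` is a left-left `Q`-Long module algebra:
`Γ(x ▷ a) (y ⊗ 1) = ∑ a₍₋₁₎ y ⊗ (x ▷ a₍₀₎)`. -/
structure IsLeftLeftLong (Δ : Q →ₙₐ[k] MTensor k Q) (μ : A →ₗ[k] A →ₗ[k] A)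
    (act : Q →ₗ[k] A →ₗ[k] A) (γ : LeftCoaction k Q A) : Prop where
  alg : IsAlg μ
  moduleAlgebra : IsLeftModuleAlgebra Δ μ act
  comoduleAlgebra : IsLeftComoduleAlgebra Δ μ γ
  long : ∀ x a y, γ.coverRight (act x a) y = (act x).lTensor Q (γ.coverRight a y)

/-- `(A, μ)` is a left-right `Q`-Long module algebra:
`Υ(x ▷ a) (1 ⊗ y) = ∑ (x ▷ a₍₀₎) ⊗ a₍₁₎ y`. -/
structure IsLeftRightLong (Δ : Q →ₙₐ[k] MTensor k Q) (μ : A →ₗ[k] A →ₗ[k] A)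
    (act : Q →ₗ[k] A →ₗ[k] A) (ρ : RightCoaction k Q A) : Prop where
  alg : IsAlg μ
  moduleAlgebra : IsLeftModuleAlgebra Δ μ act
  comoduleAlgebra : IsRightComoduleAlgebra Δ μ ρ
  long : ∀ x a y, ρ.coverRight (act x a) y = (act x).rTensor Q (ρ.coverRight a y)

/-- `(A, μ)` is a right-right `Q`-Long module algebra:
`Υ(a ◁ x) (1 ⊗ y) = ∑ (a₍₀₎ ◁ x) ⊗ a₍₁₎ y`. -/
structure IsRightRightLong (Δ : Q →ₙₐ[k] MTensor k Q) (μ : A →ₗ[k] A →ₗ[k] A)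
    (ract : A →ₗ[k] Q →ₗ[k] A) (ρ : RightCoaction k Q A) : Prop where
  alg : IsAlg μ
  moduleAlgebra : IsRightModuleAlgebra Δ μ ract
  comoduleAlgebra : IsRightComoduleAlgebra Δ μ ρ
  long : ∀ x a y, ρ.coverRight (ract a x) y = (ract.flip x).rTensor Q (ρ.coverRight a y)

/-- `(A, μ)` is a right-left `Q`-Long module algebra:
`Γ(a ◁ x) (y ⊗ 1) = ∑ a₍₋₁₎ y ⊗ (a₍₀₎ ◁ x)`. -/
structure IsRightLeftLong (Δ : Q →ₙₐ[k] MTensor k Q) (μ : A →ₗ[k] A →ₗ[k] A)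
    (ract : A →ₗ[k] Q →ₗ[k] A) (γ : LeftCoaction k Q A) : Prop where
  alg : IsAlg μ
  moduleAlgebra : IsRightModuleAlgebra Δ μ ract
  comoduleAlgebra : IsLeftComoduleAlgebra Δ μ γ
  long : ∀ x a y, γ.coverRight (ract a x) y = (ract.flip x).lTensor Q (γ.coverRight a y)

/-- `(A, μ)` is a four-sided `Q`-Long module algebra: a `Q`-bimodule algebra and a
`Q`-bicomodule algebra that satisfies the four Long conditions. -/
structure IsFourSidedLong (Δ : Q →ₙₐ[k] MTensor k Q) (μ : A →ₗ[k] A →ₗ[k] A)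
    (act : Q →ₗ[k] A →ₗ[k] A) (ract : A →ₗ[k] Q →ₗ[k] A)
    (γ : LeftCoaction k Q A) (ρ : RightCoaction k Q A) : Prop where
  leftLeft : IsLeftLeftLong Δ μ act γ
  leftRight : IsLeftRightLong Δ μ act ρ
  rightRight : IsRightRightLong Δ μ ract ρ
  rightLeft : IsRightLeftLong Δ μ ract γ
  /-- `(x ▷ a) ◁ y = x ▷ (a ◁ y)` -/
  bimodule : ∀ x a y, ract (act x a) y = act x (ract a y)
  /-- `(1 ⊗ 1 ⊗ x) (id ⊗ Υ)(Γ(a) (y ⊗ 1)) = (Γ ⊗ id)((1 ⊗ x) Υ(a)) (y ⊗ 1 ⊗ 1)` -/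
  bicomodule : ∀ x a y,
    (ρ.coverLeft.flip x).lTensor Q (γ.coverRight a y) =
      TensorProduct.assoc k Q A Q ((γ.coverRight.flip y).rTensor Q (ρ.coverLeft a x))

/-- `ν` is the left twisted product `ν(a, b) = ∑ a₍₀₎ (a₍₋₁₎ ▷ b)` of `(A, μ)`. Here `a₍₋₁₎` is
covered through the action: `ν(a, y ▷ b) = ∑ a₍₀₎ (a₍₋₁₎ y ▷ b)`. -/
def IsLeftTwistedProduct (μ : A →ₗ[k] A →ₗ[k] A) (act : Q →ₗ[k] A →ₗ[k] A)
    (γ : LeftCoaction k Q A) (ν : A →ₗ[k] A →ₗ[k] A) : Prop :=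
  ∀ a y b, ν a (act y b) =
    TensorProduct.lift (μ.flip ∘ₗ act.flip b) (γ.coverRight a y)

/-- `ν` is the right twisted product `ν(a, b) = ∑ (a ◁ b₍₁₎) b₍₀₎` of `(A, μ)`. Here `b₍₁₎` is
covered through the action: `ν(a ◁ y, b) = ∑ (a ◁ y b₍₁₎) b₍₀₎`. -/
def IsRightTwistedProduct (μ : A →ₗ[k] A →ₗ[k] A) (ract : A →ₗ[k] Q →ₗ[k] A)
    (ρ : RightCoaction k Q A) (ν : A →ₗ[k] A →ₗ[k] A) : Prop :=
  ∀ a y b, ν (ract a y) b =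
    TensorProduct.lift (μ ∘ₗ ract a).flip (ρ.coverLeft b y)

/-- The map `(p ⊗ a) ⊗ (b ⊗ q) ↦ (a ◁ q) (p ▷ b)`. -/
def lrEval (μ : A →ₗ[k] A →ₗ[k] A) (act : Q →ₗ[k] A →ₗ[k] A) (ract : A →ₗ[k] Q →ₗ[k] A) :
    (Q ⊗[k] A) ⊗[k] (A ⊗[k] Q) →ₗ[k] A :=
  TensorProduct.lift μ.flip ∘ₗ
    TensorProduct.map (TensorProduct.lift act) (TensorProduct.lift ract) ∘ₗ
    (TensorProduct.tensorTensorTensorComm k Q A A Q).toLinearMap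

/-- `ν` is the L-R-twisted product `ν(a, b) = ∑ (a₍₀₎ ◁ b₍₁₎) (a₍₋₁₎ ▷ b₍₀₎)` of `(A, μ)`. Here
`b₍₁₎` and `a₍₋₁₎` are covered through the actions:
`ν(a ◁ y, z ▷ b) = ∑ (a₍₀₎ ◁ y b₍₁₎) (a₍₋₁₎ z ▷ b₍₀₎)`. -/
def IsLRTwistedProduct (μ : A →ₗ[k] A →ₗ[k] A) (act : Q →ₗ[k] A →ₗ[k] A)
    (ract : A →ₗ[k] Q →ₗ[k] A) (γ : LeftCoaction k Q A) (ρ : RightCoaction k Q A)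
    (ν : A →ₗ[k] A →ₗ[k] A) : Prop :=
  ∀ a y z b, ν (ract a y) (act z b) =
    lrEval μ act ract (γ.coverRight a z ⊗ₜ ρ.coverLeft b y)

end Long

end TwistedAlg

end

noncomputable section

namespace TwistedAlg

/-! ### Slicing tensors -/

section Slices

variable {k V W V' : Type*} [Field k] [AddCommGroup V] [Module k V] [AddCommGroup W] [Module k W]
  [AddCommGroup V'] [Module k V']

/-! Neither `Q` nor `A` has a unit, so every formal sum is handled through covered values such as
Δ(x)(1 ⊗ y) or Γ(a)(y ⊗ 1), and identities are checked by multiplying with arbitrary elements and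
cancelling, which nondegeneracy allows. `CoverData` records the four covers of Δ; its axioms are
stable under reversing the product (`op`) and the coproduct (`cop`). A right action or coaction is a
left one over `H.cop.op`, so a four-sided Long algebra has a mirror image
(`IsCoveredFourSided.mirror`) that trades • for the opposite of ∗, and only • needs an argument.

Well-definedness (`exists_isTwist`). If ∑ yᵢ ▷ bᵢ = 0, a local unit e (`exists_local_unit`) absorbs
into all a₍₋₁₎yᵢ, and ∑ a₀(a₍₋₁₎yᵢ ▷ bᵢ) = ∑ a₀(e a₍₋₁₎ ▷ ∑ yᵢ ▷ bᵢ) = 0.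

Associativity (`twist_assoc`). The Long condition lets Γ pass through the action, so both
bracketings of a, x ▷ b, y ▷ c give ∑ a₀(a₍₋₂₎x ▷ b₀)(a₍₋₁₎b₍₋₁₎y ▷ c).

Nondegeneracy is the hardest point. If a • A = 0, apply Γ to a • (x ▷ b): since Γ(A)(Q ⊗ 1) = Q ⊗ A
(`right_surjective`), this kills all ∑ a₍₋₁₎r ⊗ a₀(a₍₋₂₎x ▷ d). The antipode contracts the two legs
of a to a counit, leaving a(Q ▷ A) = 0. If A • b = 0, acting by Q on (w ▷ a) • b and using (Q ⊗
1)Γ(A) = Q ⊗ A gives A(Q ▷ b) = 0, so Q ▷ b = 0, and a local unit gives b = 0. The counit and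
antipode are constructed from the bijective canonical maps.

The right action and right coaction commute with the left ones, so the module algebra law and the
multiplicativity of Υ carry over from ab to a • b (`ract_twist`, `coactionMul_twist`). Substituting
the definition of • into ∑ (a ◁ b₍₁₎) • b₀ yields the L-R-twisted product (`isLRTwist_iff`), which
also gives its existence and uniqueness.

The passage between multipliers and covered values (`Realizes`, `IsLeftComoduleAlgebra.covered` and
its converse) rests on the fact that a multiplier is determined by its covered values. -/

open Classical in
theorem eq_zero_of_rTensor {ι : Type*} (f : ι → V →ₗ[k] V') (hf : ∀ x, (∀ i, f i x = 0) → x = 0)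
    (t : V ⊗[k] W) (ht : ∀ i, (f i).rTensor W t = 0) : t = 0 := by
  -- Coordinates along a basis of `W` lie in `V` and commute with every `f i`, so the hypothesis
  -- applies to each coordinate.
  let ℬ := Module.Basis.ofVectorSpace k W
  apply (TensorProduct.equivFinsuppOfBasisRight (M := V) ℬ).injective
  ext j
  rw [map_zero, Finsupp.zero_apply]
  apply hf
  intro i
  have key : ∀ s : V ⊗[k] W, TensorProduct.equivFinsuppOfBasisRight ℬ ((f i).rTensor W s) j =
      f i (TensorProduct.equivFinsuppOfBasisRight ℬ s j) := by
    intro s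
    induction s with
    | zero => simp
    | add x y hx hy => simp [hx, hy]
    | tmul x y => simp
  rw [← key, ht, map_zero, Finsupp.zero_apply]

theorem eq_zero_of_lTensor {ι : Type*} (f : ι → V →ₗ[k] V') (hf : ∀ x, (∀ i, f i x = 0) → x = 0)
    (t : W ⊗[k] V) (ht : ∀ i, (f i).lTensor W t = 0) : t = 0 := by
  apply (TensorProduct.comm k W V).injective
  rw [map_zero]
  apply eq_zero_of_rTensor f hf
  intro i
  rw [LinearMap.rTensor_comm, ht, map_zero]

end Slices

/-! ### Covered comultiplications -/

/-- A product together with the four covered comultiplications `Δ(x)(1 ⊗ y)`, `(y ⊗ 1)Δ(x)`,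
`Δ(x)(y ⊗ 1)` and `(1 ⊗ y)Δ(x)`. -/
structure CoverData (k Q : Type*) [Field k] [AddCommGroup Q] [Module k Q] where
  /-- the product -/
  mul : Q →ₗ[k] Q →ₗ[k] Q
  /-- `x, y ↦ Δ(x)(1 ⊗ y)` -/
  d1 : Q →ₗ[k] Q →ₗ[k] Q ⊗[k] Q
  /-- `x, y ↦ (y ⊗ 1)Δ(x)` -/
  d2 : Q →ₗ[k] Q →ₗ[k] Q ⊗[k] Q
  /-- `x, y ↦ Δ(x)(y ⊗ 1)` -/
  d3 : Q →ₗ[k] Q →ₗ[k] Q ⊗[k] Q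
  /-- `x, y ↦ (1 ⊗ y)Δ(x)` -/
  d4 : Q →ₗ[k] Q →ₗ[k] Q ⊗[k] Q

namespace CoverData

variable {k Q V W : Type*} [Field k] [AddCommGroup Q] [Module k Q] [AddCommGroup V] [Module k V]
  [AddCommGroup W] [Module k W]

/-- `t ↦ Δ(x) t` -/
def comulR (H : CoverData k Q) (x : Q) : Q ⊗[k] Q →ₗ[k] Q ⊗[k] Q :=
  TensorProduct.lift ((LinearMap.rTensorHom Q ∘ₗ H.mul.flip).compl₂ (H.d1 x))

/-- `t ↦ t Δ(x)` -/
def comulL (H : CoverData k Q) (x : Q) : Q ⊗[k] Q →ₗ[k] Q ⊗[k] Q :=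
  TensorProduct.lift ((LinearMap.rTensorHom Q ∘ₗ H.mul).compl₂ (H.d4 x))

@[simp] theorem comulR_tmul (H : CoverData k Q) (x p q : Q) :
    H.comulR x (p ⊗ₜ q) = (H.mul.flip p).rTensor Q (H.d1 x q) := rfl

@[simp] theorem comulL_tmul (H : CoverData k Q) (x p q : Q) :
    H.comulL x (p ⊗ₜ q) = (H.mul p).rTensor Q (H.d4 x q) := rfl

/-- The same comultiplication on the opposite algebra. -/
def op (H : CoverData k Q) : CoverData k Q :=
  ⟨H.mul.flip, H.d4, H.d3, H.d2, H.d1⟩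

/-- The opposite comultiplication on the same algebra. -/
def cop (H : CoverData k Q) : CoverData k Q :=
  ⟨H.mul, H.d3.compr₂ (TensorProduct.comm k Q Q).toLinearMap,
    H.d4.compr₂ (TensorProduct.comm k Q Q).toLinearMap,
    H.d1.compr₂ (TensorProduct.comm k Q Q).toLinearMap,
    H.d2.compr₂ (TensorProduct.comm k Q Q).toLinearMap⟩

/-- The laws of a regular multiplier Hopf algebra in terms of the covered comultiplications. -/
structure IsRegular (H : CoverData k Q) : Prop where
  alg : IsAlg H.mul
  d1_d3 : ∀ x y z, (H.mul.flip y).rTensor Q (H.d1 x z) = (H.mul.flip z).lTensor Q (H.d3 x y)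
  d4_d2 : ∀ x y z, (H.mul y).rTensor Q (H.d4 x z) = (H.mul z).lTensor Q (H.d2 x y)
  d1_d2 : ∀ x y z, (H.mul y).rTensor Q (H.d1 x z) = (H.mul.flip z).lTensor Q (H.d2 x y)
  d3_d4 : ∀ x y z, (H.mul y).lTensor Q (H.d3 x z) = (H.mul.flip z).rTensor Q (H.d4 x y)
  d1_mul : ∀ x y z, H.d1 (H.mul x y) z = H.comulR x (H.d1 y z)
  d2_mul : ∀ x y z, H.d2 (H.mul x y) z = H.comulL y (H.d2 x z)
  d3_mul : ∀ x y z, H.d3 (H.mul x y) z = H.comulR x (H.d3 y z)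
  d4_mul : ∀ x y z, H.d4 (H.mul x y) z = H.comulL y (H.d4 x z)
  bij1 : Function.Bijective (TensorProduct.lift H.d1)
  bij2 : Function.Bijective (TensorProduct.lift H.d2)
  bij3 : Function.Bijective (TensorProduct.lift H.d3)
  bij4 : Function.Bijective (TensorProduct.lift H.d4)
  coassoc12 : ∀ x y z, TensorProduct.assoc k Q Q Q ((H.d2.flip y).rTensor Q (H.d1 x z)) =
    (H.d1.flip z).lTensor Q (H.d2 x y)
  coassoc34 : ∀ x y z, TensorProduct.assoc k Q Q Q ((H.d3.flip y).rTensor Q (H.d4 x z)) =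
    (H.d4.flip z).lTensor Q (H.d3 x y)

theorem _root_.TwistedAlg.IsAlg.flip {μ : V →ₗ[k] V →ₗ[k] V} (h : IsAlg μ) : IsAlg μ.flip where
  assoc a b c := (h.assoc c b a).symm
  nondeg_left := h.nondeg_right
  nondeg_right := h.nondeg_left

/-- Reversing the product exchanges left and right covers, which only permutes the axioms. Together
with `IsRegular.cop` this lets one version of a statement serve for its mirror images. -/
theorem IsRegular.op {H : CoverData k Q} (h : H.IsRegular) : H.op.IsRegular where
  alg := h.alg.flip
  d1_d3 := h.d4_d2
  d4_d2 := h.d1_d3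
  d1_d2 x y z := (h.d3_d4 x z y).symm
  d3_d4 x y z := (h.d1_d2 x z y).symm
  d1_mul x y z := h.d4_mul y x z
  d2_mul x y z := h.d3_mul y x z
  d3_mul x y z := h.d2_mul y x z
  d4_mul x y z := h.d1_mul y x z
  bij1 := h.bij4
  bij2 := h.bij3
  bij3 := h.bij2
  bij4 := h.bij1
  coassoc12 := h.coassoc34
  coassoc34 := h.coassoc12

/-- `comulR` covers the second leg first. By `d1_d3` the other order gives the same result, so the
construction is compatible with flipping the legs. -/
theorem IsRegular.comulR_cop {H : CoverData k Q} (h : H.IsRegular) (x : Q) (t : Q ⊗[k] Q) :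
    H.cop.comulR x (TensorProduct.comm k Q Q t) = TensorProduct.comm k Q Q (H.comulR x t) := by
  induction t with
  | zero => simp
  | add x y hx hy => simp only [map_add, hx, hy]
  | tmul p q =>
    simp [cop, LinearMap.rTensor_comm, h.d1_d3]

theorem IsRegular.comulL_cop {H : CoverData k Q} (h : H.IsRegular) (x : Q) (t : Q ⊗[k] Q) :
    H.cop.comulL x (TensorProduct.comm k Q Q t) = TensorProduct.comm k Q Q (H.comulL x t) := by
  induction t with
  | zero => simp
  | add x y hx hy => simp only [map_add, hx, hy]
  | tmul p q =>
    simp [cop, LinearMap.rTensor_comm, h.d4_d2]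

theorem lift_compr₂_comm_bijective {f : Q →ₗ[k] Q →ₗ[k] Q ⊗[k] Q}
    (h : Function.Bijective (TensorProduct.lift f)) :
    Function.Bijective
      (TensorProduct.lift (f.compr₂ (TensorProduct.comm k Q Q).toLinearMap)) := by
  rw [TensorProduct.lift_compr₂]
  exact (TensorProduct.comm k Q Q).bijective.comp h

theorem lift_curry_flip_bijective {T : Q ⊗[k] Q →ₗ[k] Q ⊗[k] Q} (h : Function.Bijective T) :
    Function.Bijective (TensorProduct.lift (TensorProduct.curry T).flip) := by
  have : TensorProduct.lift (TensorProduct.curry T).flip =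
      T ∘ₗ (TensorProduct.comm k Q Q).toLinearMap := TensorProduct.ext' fun _ _ => rfl
  rw [this]
  exact h.comp (TensorProduct.comm k Q Q).bijective

theorem lift_curry_bijective {T : Q ⊗[k] Q →ₗ[k] Q ⊗[k] Q} (h : Function.Bijective T) :
    Function.Bijective (TensorProduct.lift (TensorProduct.curry T)) := by
  rwa [show TensorProduct.lift (TensorProduct.curry T) = T from TensorProduct.ext' fun _ _ => rfl]

/-- Reversal of the order of three factors. -/
def reverse (k U V W : Type*) [Field k] [AddCommGroup U] [Module k U] [AddCommGroup V] [Module k V]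
    [AddCommGroup W] [Module k W] : U ⊗[k] (V ⊗[k] W) ≃ₗ[k] W ⊗[k] (V ⊗[k] U) :=
  (TensorProduct.comm k U (V ⊗[k] W)).trans
    (((TensorProduct.comm k V W).rTensor U).trans (TensorProduct.assoc k W V U))

/-- Reversing three legs turns an operation on the left pair into one on the right pair. This is how
the coassociativity laws of Δ and of the opposite coproduct are exchanged. -/
theorem reverse_assoc {P U V W : Type*} [AddCommGroup P] [Module k P] [AddCommGroup U] [Module k U]
    [AddCommGroup V] [Module k V] [AddCommGroup W] [Module k W]
    (f : P →ₗ[k] U ⊗[k] V) (t : P ⊗[k] W) :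
    reverse k U V W (TensorProduct.assoc k U V W (f.rTensor W t)) =
      ((TensorProduct.comm k U V).toLinearMap ∘ₗ f).lTensor W (TensorProduct.comm k P W t) := by
  induction t with
  | zero => simp
  | add x y hx hy => simp only [map_add, hx, hy]
  | tmul p q =>
    simp only [LinearMap.rTensor_tmul, TensorProduct.comm_tmul, LinearMap.lTensor_tmul,
      LinearMap.comp_apply]
    induction f p with
    | zero => simp
    | add x y hx hy => simp only [map_add, hx, hy, TensorProduct.add_tmul, TensorProduct.tmul_add]
    | tmul r s => simp [reverse]

theorem reverse_lTensor {P U V W : Type*} [AddCommGroup P] [Module k P] [AddCommGroup U]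
    [Module k U] [AddCommGroup V] [Module k V] [AddCommGroup W] [Module k W]
    (f : P →ₗ[k] V ⊗[k] W) (t : U ⊗[k] P) :
    reverse k U V W (f.lTensor U t) = TensorProduct.assoc k W V U
      (((TensorProduct.comm k V W).toLinearMap ∘ₗ f).rTensor U (TensorProduct.comm k U P t)) := by
  induction t with
  | zero => simp
  | add x y hx hy => simp only [map_add, hx, hy]
  | tmul p q =>
    simp only [LinearMap.rTensor_tmul, TensorProduct.comm_tmul, LinearMap.lTensor_tmul,
      LinearMap.comp_apply]
    induction f q with
    | zero => simp
    | add x y hx hy => simp only [map_add, hx, hy, TensorProduct.add_tmul, TensorProduct.tmul_add]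
    | tmul r s => simp [reverse]

theorem IsRegular.cop {H : CoverData k Q} (h : H.IsRegular) : H.cop.IsRegular where
  alg := h.alg
  d1_d3 x y z := by simp [CoverData.cop, LinearMap.rTensor_comm, LinearMap.lTensor_comm, h.d1_d3]
  d4_d2 x y z := by simp [CoverData.cop, LinearMap.rTensor_comm, LinearMap.lTensor_comm, h.d4_d2]
  d1_d2 x y z := by simp [CoverData.cop, LinearMap.rTensor_comm, LinearMap.lTensor_comm, h.d3_d4]
  d3_d4 x y z := by simp [CoverData.cop, LinearMap.rTensor_comm, LinearMap.lTensor_comm, h.d1_d2]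
  d1_mul x y z := by
    refine (congrArg (TensorProduct.comm k Q Q) (h.d3_mul x y z)).trans ?_
    exact (h.comulR_cop x _).symm
  d2_mul x y z := by
    refine (congrArg (TensorProduct.comm k Q Q) (h.d4_mul x y z)).trans ?_
    exact (h.comulL_cop y _).symm
  d3_mul x y z := by
    refine (congrArg (TensorProduct.comm k Q Q) (h.d1_mul x y z)).trans ?_
    exact (h.comulR_cop x _).symm
  d4_mul x y z := by
    refine (congrArg (TensorProduct.comm k Q Q) (h.d2_mul x y z)).trans ?_
    exact (h.comulL_cop y _).symm
  bij1 := lift_compr₂_comm_bijective h.bij3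
  bij2 := lift_compr₂_comm_bijective h.bij4
  bij3 := lift_compr₂_comm_bijective h.bij1
  bij4 := lift_compr₂_comm_bijective h.bij2
  coassoc12 x y z := by
    have := congrArg (reverse k Q Q Q) (h.coassoc34 x z y)
    rw [reverse_assoc, reverse_lTensor] at this
    exact this.symm
  coassoc34 x y z := by
    have := congrArg (reverse k Q Q Q) (h.coassoc12 x z y)
    rw [reverse_assoc, reverse_lTensor] at this
    exact this.symm

end CoverData

/-! ### Applying a functional to one tensor leg -/

section Slices
variable {k Q V : Type*} [Field k] [AddCommGroup Q] [Module k Q] [AddCommGroup V] [Module k V]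

/-- `p ⊗ v ↦ ε(p) v` -/
def sliceLeft (ε : Q →ₗ[k] k) (V : Type*) [AddCommGroup V] [Module k V] : Q ⊗[k] V →ₗ[k] V :=
  TensorProduct.lift (LinearMap.lsmul k V ∘ₗ ε)

/-- `v ⊗ p ↦ ε(p) v` -/
def sliceRight (ε : Q →ₗ[k] k) (V : Type*) [AddCommGroup V] [Module k V] : V ⊗[k] Q →ₗ[k] V :=
  TensorProduct.lift (LinearMap.lsmul k V ∘ₗ ε).flip

@[simp] theorem sliceLeft_tmul (ε : Q →ₗ[k] k) (p : Q) (v : V) :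
    sliceLeft ε V (p ⊗ₜ v) = ε p • v := rfl

@[simp] theorem sliceRight_tmul (ε : Q →ₗ[k] k) (p : Q) (v : V) :
    sliceRight ε V (v ⊗ₜ p) = ε p • v := rfl

theorem sliceLeft_lTensor {W : Type*} [AddCommGroup W] [Module k W] (ε : Q →ₗ[k] k) (f : V →ₗ[k] W)
    (t : Q ⊗[k] V) :
    sliceLeft ε W (f.lTensor Q t) = f (sliceLeft ε V t) := by
  induction t with
  | zero => simp
  | add x y hx hy => simp only [map_add, hx, hy]
  | tmul p q => simp

theorem sliceRight_rTensor {W : Type*} [AddCommGroup W] [Module k W] (ε : Q →ₗ[k] k)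
    (f : V →ₗ[k] W) (t : V ⊗[k] Q) :
    sliceRight ε W (f.rTensor Q t) = f (sliceRight ε V t) := by
  induction t with
  | zero => simp
  | add x y hx hy => simp only [map_add, hx, hy]
  | tmul p q => simp

theorem sliceRight_comm (ε : Q →ₗ[k] k) (t : Q ⊗[k] V) :
    sliceRight ε V (TensorProduct.comm k Q V t) = sliceLeft ε V t := by
  induction t with
  | zero => simp
  | add x y hx hy => simp only [map_add, hx, hy]
  | tmul p q => simp

theorem sliceLeft_comm (ε : Q →ₗ[k] k) (t : V ⊗[k] Q) :
    sliceLeft ε V (TensorProduct.comm k V Q t) = sliceRight ε V t := by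
  induction t with
  | zero => simp
  | add x y hx hy => simp only [map_add, hx, hy]
  | tmul p q => simp

theorem eq_of_tmul_eq_tmul {x : Q} {v w : V} (hx : x ≠ 0) (h : x ⊗ₜ[k] v = x ⊗ₜ[k] w) : v = w := by
  obtain ⟨f, hf⟩ := Module.Projective.exists_dual_ne_zero k hx
  have := congrArg (sliceLeft f V) h
  exact smul_right_injective V hf this

theorem rTensor_lTensor {V' Q' : Type*} [AddCommGroup V'] [Module k V'] [AddCommGroup Q']
    [Module k Q'] (f : Q →ₗ[k] Q') (g : V →ₗ[k] V') (t : Q ⊗[k] V) :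
    f.rTensor V' (g.lTensor Q t) = g.lTensor Q' (f.rTensor V t) := by
  rw [← LinearMap.comp_apply, ← LinearMap.comp_apply, LinearMap.rTensor_comp_lTensor,
    LinearMap.lTensor_comp_rTensor]

end Slices

theorem IsAlg.mul_comp {k V : Type*} [Field k] [AddCommGroup V] [Module k V]
    {μ : V →ₗ[k] V →ₗ[k] V} (h : IsAlg μ) (a b : V) : μ (μ a b) = μ a ∘ₗ μ b :=
  LinearMap.ext fun c => h.assoc a b c

theorem IsAlg.flip_mul_comp {k V : Type*} [Field k] [AddCommGroup V] [Module k V]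
    {μ : V →ₗ[k] V →ₗ[k] V} (h : IsAlg μ) (a b : V) : μ.flip (μ a b) = μ.flip b ∘ₗ μ.flip a :=
  LinearMap.ext fun c => (h.assoc c a b).symm

theorem IsAlg.mul_comp_flip {k V : Type*} [Field k] [AddCommGroup V] [Module k V]
    {μ : V →ₗ[k] V →ₗ[k] V} (h : IsAlg μ) (a b : V) : μ a ∘ₗ μ.flip b = μ.flip b ∘ₗ μ a :=
  LinearMap.ext fun c => (h.assoc a c b).symm

namespace CoverData

variable {k Q V W : Type*} [Field k] [AddCommGroup Q] [Module k Q] [AddCommGroup V] [Module k V]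
  [AddCommGroup W] [Module k W] {H : CoverData k Q}

namespace IsRegular

/-- Nondegeneracy survives tensoring with a vector space. In the absence of a unit, this is the
standard way to prove identities in Q ⊗ V. -/
theorem cancel_mul (h : H.IsRegular) {s t : Q ⊗[k] V}
    (hst : ∀ w, (H.mul w).rTensor V s = (H.mul w).rTensor V t) : s = t := by
  rw [← sub_eq_zero]
  refine eq_zero_of_rTensor H.mul (fun x hx => h.alg.nondeg_right x hx) _ fun w => ?_
  rw [map_sub, hst, sub_self]

theorem cancel_flip (h : H.IsRegular) {s t : Q ⊗[k] V}
    (hst : ∀ w, (H.mul.flip w).rTensor V s = (H.mul.flip w).rTensor V t) : s = t :=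
  h.op.cancel_mul hst

/-! #### Linearity of the covered comultiplications -/

/-- After left multiplication of the first leg by w, the cover `d1` can be traded for `d2`, where
the claim is associativity in the second leg. -/
theorem d1_mul_right (h : H.IsRegular) (x y z : Q) :
    H.d1 x (H.mul y z) = (H.mul.flip z).lTensor Q (H.d1 x y) := by
  refine h.cancel_mul fun w => ?_
  rw [rTensor_lTensor, h.d1_d2, h.d1_d2, h.alg.flip_mul_comp, LinearMap.lTensor_comp_apply]

theorem d1_d4 (h : H.IsRegular) (x y z : Q) :
    (H.mul y).lTensor Q (H.d1 x z) = (H.mul.flip z).lTensor Q (H.d4 x y) := by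
  refine h.cancel_flip fun w => ?_
  rw [rTensor_lTensor, h.d1_d3, rTensor_lTensor, ← h.d3_d4, ← LinearMap.lTensor_comp_apply,
    ← LinearMap.lTensor_comp_apply, h.alg.mul_comp_flip]

theorem d3_d2 (h : H.IsRegular) (x y z : Q) :
    (H.mul y).rTensor Q (H.d3 x z) = (H.mul.flip z).rTensor Q (H.d2 x y) := by
  apply (TensorProduct.comm k Q Q).injective
  rw [← LinearMap.lTensor_comm, ← LinearMap.lTensor_comm]
  exact h.cop.d1_d4 x y z

/-! #### Local units -/

/-- `p ⊗ e ↦ p ⊗ (e ⊗ 1) t` -/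
def insertMul (H : CoverData k Q) (t : Q ⊗[k] V) : Q ⊗[k] Q →ₗ[k] Q ⊗[k] (Q ⊗[k] V) :=
  ((LinearMap.rTensorHom V ∘ₗ H.mul).flip t).lTensor Q

theorem insertMul_add (s t : Q ⊗[k] V) (u : Q ⊗[k] Q) :
    insertMul H (s + t) u = insertMul H s u + insertMul H t u := by
  simp [insertMul, LinearMap.lTensor_add]

theorem insertMul_tmul (y : Q) (v : V) (u : Q ⊗[k] Q) :
    insertMul H (y ⊗ₜ v) u =
      TensorProduct.assoc k Q Q V ((H.mul.flip y).lTensor Q u ⊗ₜ v) := by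
  induction u with
  | zero => simp
  | add a b ha hb => simp only [map_add, ha, hb, TensorProduct.add_tmul]
  | tmul a b => simp [insertMul]

theorem insertMul_mul (h : H.IsRegular) (p a : Q) (t : Q ⊗[k] V) :
    TensorProduct.assoc k Q Q V ((TensorProduct.lift H.d1).rTensor V
      ((TensorProduct.assoc k Q Q V).symm (p ⊗ₜ (H.mul a).rTensor V t))) =
      insertMul H t (H.d1 p a) := by
  induction t with
  | zero => simp [insertMul]
  | add x y hx hy => simp only [map_add, TensorProduct.tmul_add, hx, hy, insertMul_add]
  | tmul y v => simp [insertMul_tmul, h.d1_mul_right]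

theorem mul_rTensor_insertMul (h : H.IsRegular) (p w : Q) (t : Q ⊗[k] V) :
    (H.mul w).rTensor _ (TensorProduct.assoc k Q Q V ((TensorProduct.lift H.d1).rTensor V
      ((TensorProduct.assoc k Q Q V).symm (p ⊗ₜ t)))) =
      insertMul H t (H.d2 p w) := by
  induction t with
  | zero => simp [insertMul]
  | add x y hx hy => simp only [map_add, TensorProduct.tmul_add, hx, hy, insertMul_add]
  | tmul y v =>
    simp only [TensorProduct.assoc_symm_tmul, LinearMap.rTensor_tmul, TensorProduct.lift.tmul,
      insertMul_tmul, ← h.d1_d2]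
    induction H.d1 p y with
    | zero => simp
    | add a b ha hb => simp only [map_add, ha, hb, TensorProduct.add_tmul]
    | tmul a b => simp

/-- Let Qt be the range of e ↦ (e ⊗ 1)t. The canonical map on the first two legs of Q ⊗ (Q ⊗ V) maps
Q ⊗ Qt onto itself and is injective; it also sends p ⊗ t into Q ⊗ Qt. Hence p ⊗ t already lies in Q
⊗ Qt, and t in Qt. -/
theorem exists_local_unit (h : H.IsRegular) (t : Q ⊗[k] V) :
    ∃ e, (H.mul e).rTensor V t = t := by
  rcases subsingleton_or_nontrivial Q with hQ | hQ
  · exact ⟨0, Subsingleton.elim _ _⟩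
  obtain ⟨p, hp⟩ := exists_ne (0 : Q)
  let φ : Q →ₗ[k] Q ⊗[k] V := (LinearMap.rTensorHom V ∘ₗ H.mul).flip t
  have hφ : ∀ e, φ e = (H.mul e).rTensor V t := fun e => rfl
  let T : Q ⊗[k] (Q ⊗[k] V) →ₗ[k] Q ⊗[k] (Q ⊗[k] V) :=
    (TensorProduct.assoc k Q Q V).toLinearMap ∘ₗ
      (TensorProduct.lift H.d1).rTensor V ∘ₗ (TensorProduct.assoc k Q Q V).symm.toLinearMap
  have hT : Function.Injective T := by
    have h0 := Module.Flat.rTensor_preserves_injective_linearMap (M := V) _ h.bij1.injective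
    exact (TensorProduct.assoc k Q Q V).injective.comp
      (h0.comp (TensorProduct.assoc k Q Q V).symm.injective)
  have h1 : ∀ s, T (φ.lTensor Q s) = φ.lTensor Q (TensorProduct.lift H.d1 s) := by
    intro s
    induction s with
    | zero => simp
    | add x y hx hy => simp only [map_add, hx, hy]
    | tmul p a =>
      simp only [LinearMap.lTensor_tmul, hφ, TensorProduct.lift.tmul]
      exact h.insertMul_mul p a t
  have h2 : ∀ w, (H.mul w).rTensor _ (T (p ⊗ₜ t)) = φ.lTensor Q (H.d2 p w) := fun w =>
    h.mul_rTensor_insertMul p w t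
  let π := (LinearMap.range φ).mkQ
  have hπ : ∀ e, π (φ e) = 0 := fun e => by
    simp [π]
  -- Membership in Q ⊗ Qt is tested in the quotient by Qt, where cancelling a left factor w is
  -- allowed; with that factor, Δ(p) is covered and `h2` applies.
  have h3 : π.lTensor Q (T (p ⊗ₜ t)) = 0 := by
    refine h.cancel_mul fun w => ?_
    rw [rTensor_lTensor, h2, ← LinearMap.lTensor_comp_apply,
      show π ∘ₗ φ = 0 from LinearMap.ext hπ]
    simp
  have hex : Function.Exact φ π := by
    rw [LinearMap.exact_iff]; simp [π]
  -- Right exactness gives a preimage in Q ⊗ Q, and surjectivity of the canonical map lets it be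
  -- pulled inside `T`.
  obtain ⟨z, hz⟩ := (lTensor_exact Q hex (Submodule.mkQ_surjective _) _).1 h3
  obtain ⟨s, rfl⟩ := h.bij1.surjective z
  rw [← h1] at hz
  have h4 := congrArg (π.lTensor Q) (hT hz)
  rw [← LinearMap.lTensor_comp_apply, show π ∘ₗ φ = 0 from LinearMap.ext hπ] at h4
  have h5 : π t = 0 := by
    refine eq_of_tmul_eq_tmul (k := k) hp ?_
    simpa using h4.symm
  rw [Submodule.mkQ_apply, Submodule.Quotient.mk_eq_zero] at h5
  exact h5
end IsRegular
end CoverData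
-- The counit and the antipode
namespace CoverData

variable {k Q V W : Type*} [Field k] [AddCommGroup Q] [Module k Q] [AddCommGroup V] [Module k V]
  [AddCommGroup W] [Module k W] {H : CoverData k Q}

/-- `ε` is the counit. -/
structure IsCounit (H : CoverData k Q) (ε : Q →ₗ[k] k) : Prop where
  d1 : ∀ x y, sliceLeft ε Q (H.d1 x y) = H.mul x y
  d2 : ∀ x y, sliceRight ε Q (H.d2 x y) = H.mul y x
  d3 : ∀ x y, sliceRight ε Q (H.d3 x y) = H.mul x y
  d4 : ∀ x y, sliceLeft ε Q (H.d4 x y) = H.mul y x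
  map_mul : ∀ x y, ε (H.mul x y) = ε x * ε y

theorem IsCounit.cop {ε : Q →ₗ[k] k} (hε : H.IsCounit ε) : H.cop.IsCounit ε where
  d1 x y := (sliceLeft_comm ε _).trans (hε.d3 x y)
  d2 x y := (sliceRight_comm ε _).trans (hε.d4 x y)
  d3 x y := (sliceRight_comm ε _).trans (hε.d1 x y)
  d4 x y := (sliceLeft_comm ε _).trans (hε.d2 x y)
  map_mul := hε.map_mul

theorem IsCounit.exists_eq_one {ε : Q →ₗ[k] k} (hε : H.IsCounit ε) (h : H.IsRegular)
    [Nontrivial Q] : ∃ q, ε q = 1 := by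
  obtain ⟨x, hx⟩ := exists_ne (0 : Q)
  by_contra! hne
  have h0 : ε = 0 := by
    ext q
    by_contra hq
    refine hne ((ε q)⁻¹ • q) ?_
    rw [map_smul, smul_eq_mul]
    exact inv_mul_cancel₀ hq
  refine hx (h.alg.nondeg_left x fun y => ?_)
  rw [← hε.d1, h0, sliceLeft, LinearMap.comp_zero]
  exact TensorProduct.induction_on (H.d1 x y) (map_zero _) (fun _ _ => by simp)
    fun _ _ hx hy => by rw [map_add, hx, hy, add_zero]

namespace IsRegular

/-- The canonical map `x ⊗ y ↦ Δ(x)(1 ⊗ y)`. -/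
def canonical (h : H.IsRegular) : Q ⊗[k] Q ≃ₗ[k] Q ⊗[k] Q :=
  LinearEquiv.ofBijective (TensorProduct.lift H.d1) h.bij1

@[simp] theorem canonical_tmul (h : H.IsRegular) (x y : Q) :
    h.canonical (x ⊗ₜ y) = H.d1 x y := rfl

@[simp] theorem canonical_symm_d1 (h : H.IsRegular) (x y : Q) :
    h.canonical.symm (H.d1 x y) = x ⊗ₜ y :=
  h.canonical.symm_apply_apply (x ⊗ₜ y)

/-- Coassociativity, read as a commutation of the canonical map with (c ⊗ 1)Δ on an extra leg. In
this form it passes to the inverse of the canonical map. -/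
theorem canonical_coassoc (h : H.IsRegular) (c : Q) (s : Q ⊗[k] Q) :
    TensorProduct.assoc k Q Q Q ((H.d2.flip c).rTensor Q (h.canonical s)) =
      h.canonical.toLinearMap.lTensor Q
        (TensorProduct.assoc k Q Q Q ((H.d2.flip c).rTensor Q s)) := by
  induction s with
  | zero => simp
  | add x y hx hy => simp only [map_add, hx, hy]
  | tmul x z =>
    rw [canonical_tmul, h.coassoc12, LinearMap.rTensor_tmul, LinearMap.flip_apply]
    induction H.d2 x c with
    | zero => simp
    | add x y hx hy => simp only [map_add, hx, hy, TensorProduct.add_tmul]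
    | tmul p q => simp

theorem lTensor_symm_canonical (h : H.IsRegular) (c : Q) (f : Q ⊗[k] Q →ₗ[k] V) (t : Q ⊗[k] Q) :
    (f ∘ₗ h.canonical.symm.toLinearMap).lTensor Q
        (TensorProduct.assoc k Q Q Q ((H.d2.flip c).rTensor Q t)) =
      f.lTensor Q (TensorProduct.assoc k Q Q Q
        ((H.d2.flip c).rTensor Q (h.canonical.symm t))) := by
  obtain ⟨s, rfl⟩ := h.canonical.surjective t
  rw [canonical_coassoc, ← LinearMap.lTensor_comp_apply, LinearMap.comp_assoc]
  simp

/-- The maps that ought to be ε ⊗ id and id ⊗ ε are multiplication after the inverses of the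
canonical maps. Coassociativity gives p ⊗ E(q ⊗ b) = F(p ⊗ q) ⊗ b, which forces E(q ⊗ b) to be a
multiple of b by a scalar depending on q only. -/
theorem exists_counit_aux (h : H.IsRegular) :
    ∃ ε : Q →ₗ[k] k, (∀ x y, sliceLeft ε Q (H.d1 x y) = H.mul x y) ∧
      ∀ x y, sliceRight ε Q (H.d2 x y) = H.mul y x := by
  rcases subsingleton_or_nontrivial Q with hQ | hQ
  · exact ⟨0, fun _ _ => Subsingleton.elim _ _, fun _ _ => Subsingleton.elim _ _⟩
  let E : Q ⊗[k] Q →ₗ[k] Q := TensorProduct.lift H.mul ∘ₗ h.canonical.symm.toLinearMap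
  let T₂ := LinearEquiv.ofBijective (TensorProduct.lift H.d2) h.bij2
  let F : Q ⊗[k] Q →ₗ[k] Q := TensorProduct.lift H.mul.flip ∘ₗ T₂.symm.toLinearMap
  have h1 : ∀ c t, E.lTensor Q (TensorProduct.assoc k Q Q Q ((H.d2.flip c).rTensor Q t)) =
      (H.mul c).rTensor Q t := by
    intro c t
    rw [h.lTensor_symm_canonical]
    obtain ⟨s, rfl⟩ := h.canonical.surjective t
    rw [LinearEquiv.symm_apply_apply]
    induction s with
    | zero => simp
    | add x y hx hy => simp only [map_add, hx, hy]
    | tmul x z =>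
      rw [canonical_tmul, h.d1_d2, LinearMap.rTensor_tmul, LinearMap.flip_apply]
      induction H.d2 x c with
      | zero => simp
      | add x y hx hy => simp only [map_add, hx, hy, TensorProduct.add_tmul]
      | tmul p q => simp
  have h2 : ∀ b u, (E ∘ₗ (TensorProduct.mk k Q Q).flip b).lTensor Q u = F u ⊗ₜ[k] b := by
    intro b u
    obtain ⟨s, rfl⟩ := T₂.surjective u
    simp only [F, LinearMap.comp_apply, LinearEquiv.coe_coe, LinearEquiv.symm_apply_apply]
    induction s with
    | zero => simp
    | add x y hx hy => simp only [map_add, hx, hy, TensorProduct.add_tmul]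
    | tmul a c =>
      have := h1 c (a ⊗ₜ b)
      rw [LinearMap.rTensor_tmul, LinearMap.rTensor_tmul] at this
      simp only [TensorProduct.lift.tmul, LinearMap.flip_apply]
      rw [← this]
      rw [LinearMap.flip_apply, show T₂ (a ⊗ₜ c) = H.d2 a c from rfl]
      induction H.d2 a c with
      | zero => simp
      | add x y hx hy => simp only [map_add, hx, hy, TensorProduct.add_tmul]
      | tmul p q => simp
  obtain ⟨p, hp⟩ := exists_ne (0 : Q)
  obtain ⟨ω, hω⟩ := Module.Projective.exists_dual_ne_zero k hp
  -- Normalised at a fixed p with ω(p) ≠ 0, since F(p ⊗ q) is to be ε(q)p.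
  let ε : Q →ₗ[k] k := (ω p)⁻¹ • (ω ∘ₗ F ∘ₗ TensorProduct.mk k Q Q p)
  have hE : ∀ q b, E (q ⊗ₜ b) = ε q • b := by
    intro q b
    have := congrArg (sliceLeft ω Q) (h2 b (p ⊗ₜ q))
    simp only [LinearMap.lTensor_tmul, sliceLeft_tmul, LinearMap.comp_apply, LinearMap.flip_apply,
      TensorProduct.mk_apply] at this
    simp only [ε, LinearMap.smul_apply, LinearMap.comp_apply, TensorProduct.mk_apply, smul_eq_mul,
      mul_smul]
    rw [← this, smul_smul, inv_mul_cancel₀ hω, one_smul]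
  have hF : ∀ u, F u = sliceRight ε Q u := by
    intro u
    induction u with
    | zero => simp
    | add x y hx hy => simp only [map_add, hx, hy]
    | tmul r q =>
      have := h2 p (r ⊗ₜ q)
      simp only [LinearMap.lTensor_tmul, LinearMap.comp_apply, LinearMap.flip_apply,
        TensorProduct.mk_apply, hE] at this
      have := congrArg (sliceRight ω Q) this
      simp only [sliceRight_tmul, map_smul, smul_assoc] at this
      rw [smul_comm] at this
      exact (smul_right_injective Q hω this).symm
  have hE' : ∀ u, E u = sliceLeft ε Q u := by
    intro u
    induction u with
    | zero => simp
    | add x y hx hy => simp only [map_add, hx, hy]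
    | tmul r q => simp [hE]
  refine ⟨ε, fun x y => ?_, fun x y => ?_⟩
  · rw [← hE']
    simp [E]
  · rw [← hF, show H.d2 x y = T₂ (x ⊗ₜ y) from rfl]
    simp [F]

theorem exists_counit (h : H.IsRegular) : ∃ ε, H.IsCounit ε := by
  obtain ⟨ε, h1, h2⟩ := h.exists_counit_aux
  have h3 : ∀ x y, sliceRight ε Q (H.d3 x y) = H.mul x y := by
    intro x y
    rw [← sub_eq_zero]
    refine h.alg.nondeg_right _ fun z => ?_
    rw [map_sub, ← sliceRight_rTensor, h.d3_d2, sliceRight_rTensor, h2, LinearMap.flip_apply,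
      h.alg.assoc, sub_self]
  have h4 : ∀ x y, sliceLeft ε Q (H.d4 x y) = H.mul y x := by
    intro x y
    rw [← sub_eq_zero]
    refine h.alg.nondeg_left _ fun z => ?_
    rw [map_sub, LinearMap.sub_apply, ← LinearMap.flip_apply, ← sliceLeft_lTensor, ← h.d1_d4,
      sliceLeft_lTensor, h1, h.alg.assoc, sub_self]
  refine ⟨ε, h1, h2, h3, h4, ?_⟩
  intro x y
  rcases subsingleton_or_nontrivial Q with hQ | hQ
  · simp [Subsingleton.elim x 0]
  obtain ⟨z, hz⟩ := exists_ne (0 : Q)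
  have key : ∀ a u, sliceLeft ε Q (H.comulR a u) = H.mul a (sliceLeft ε Q u) := by
    intro a u
    obtain ⟨s, rfl⟩ := h.canonical.surjective u
    induction s with
    | zero => simp
    | add x y hx hy => simp only [map_add, hx, hy]
    | tmul b c => rw [canonical_tmul, ← h.d1_mul, h1, h1, h.alg.assoc]
  -- Writing u = Δ(b)(1 ⊗ c), the element u(p ⊗ 1) is Δ(b)(p ⊗ c), to which `key` applies. Taking a
  -- pure tensor for u then gives multiplicativity of ε.
  have key2 : ∀ p u, sliceLeft ε Q ((H.mul.flip p).rTensor Q u) = ε p • sliceLeft ε Q u := by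
    intro p u
    obtain ⟨s, rfl⟩ := h.canonical.surjective u
    induction s with
    | zero => simp
    | add x y hx hy => simp only [map_add, hx, hy, smul_add]
    | tmul b c => rw [canonical_tmul, ← comulR_tmul, key, h1, sliceLeft_tmul, map_smul]
  have := key2 y (x ⊗ₜ z)
  simp only [LinearMap.rTensor_tmul, sliceLeft_tmul, LinearMap.flip_apply, smul_smul] at this
  rw [smul_left_injective k hz this, mul_comm]

/-- `σ(v, z)` plays the role of `S(v) z` for the antipode `S`; the second identity reads
`p₁ S(y p₂) z = ε(p) S(y) z`. -/
theorem exists_antipode (h : H.IsRegular) {ε : Q →ₗ[k] k} (hε : H.IsCounit ε) :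
    ∃ σ : Q →ₗ[k] Q →ₗ[k] Q, (∀ p z, TensorProduct.lift σ (H.d1 p z) = ε p • z) ∧
      ∀ p y z, TensorProduct.lift (H.mul.compl₂ (σ.flip z)) (H.d4 p y) = ε p • σ y z := by
  -- The inverse canonical map is formally v ⊗ z ↦ v₁ ⊗ S(v₂)z, so slicing its first leg by ε leaves
  -- S(v)z.
  let σ' : Q ⊗[k] Q →ₗ[k] Q := sliceLeft ε Q ∘ₗ h.canonical.symm.toLinearMap
  let σ : Q →ₗ[k] Q →ₗ[k] Q := TensorProduct.curry σ'
  have hσ : ∀ v z, σ v z = σ' (v ⊗ₜ z) := fun v z => rfl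
  -- The antipode law c p₁ S(p₂) z = ε(p) c z, obtained by computing the inverse canonical map once
  -- by coassociativity (`e1`) and once by multiplying its legs (`e2`).
  have h1 : ∀ p c z, TensorProduct.lift (H.mul.compl₂ (σ.flip z)) (H.d2 p c) =
      ε p • H.mul c z := by
    intro p c z
    have e1 : ∀ t, σ'.lTensor Q (TensorProduct.assoc k Q Q Q ((H.d2.flip c).rTensor Q t)) =
        (H.mul c).rTensor Q (h.canonical.symm t) := by
      intro t
      rw [h.lTensor_symm_canonical]
      induction h.canonical.symm t with
      | zero => simp
      | add x y hx hy => simp only [map_add, hx, hy]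
      | tmul x z =>
        rw [LinearMap.rTensor_tmul, LinearMap.flip_apply, LinearMap.rTensor_tmul, ← hε.d2]
        induction H.d2 x c with
        | zero => simp
        | add x y hx hy => simp only [map_add, hx, hy, TensorProduct.add_tmul]
        | tmul p q => simp [TensorProduct.smul_tmul]
    have e2 : ∀ t, TensorProduct.lift H.mul ((H.mul c).rTensor Q (h.canonical.symm t)) =
        H.mul c (sliceLeft ε Q t) := by
      intro t
      obtain ⟨s, rfl⟩ := h.canonical.surjective t
      rw [LinearEquiv.symm_apply_apply]
      induction s with
      | zero => simp
      | add x y hx hy => simp only [map_add, hx, hy]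
      | tmul x z => simp [hε.d1, h.alg.assoc]
    have e3 := e2 (p ⊗ₜ z)
    rw [← e1, sliceLeft_tmul, map_smul, LinearMap.rTensor_tmul, LinearMap.flip_apply] at e3
    rw [← e3]
    induction H.d2 p c with
    | zero => simp
    | add x y hx hy => simp only [map_add, hx, hy, TensorProduct.add_tmul]
    | tmul p q => simp [hσ]
  refine ⟨σ, fun p z => ?_, fun p y z => ?_⟩
  · have hl : TensorProduct.lift σ = σ' := TensorProduct.ext' fun _ _ => rfl
    rw [hl]
    simp [σ']
  -- It is enough to test u = (c ⊗ 1)Δ(x), as such elements span. There uΔ(p) = (c ⊗ 1)Δ(xp), and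
  -- multiplicativity of ε finishes, with no separate proof that S is antimultiplicative.
  · have h2 : ∀ u, TensorProduct.lift (H.mul.compl₂ (σ.flip z)) (H.comulL p u) =
        ε p • TensorProduct.lift (H.mul.compl₂ (σ.flip z)) u := by
      intro u
      obtain ⟨s, rfl⟩ := h.bij2.surjective u
      induction s with
      | zero => simp
      | add x y hx hy => simp only [map_add, hx, hy, smul_add]
      | tmul x c =>
        rw [TensorProduct.lift.tmul, ← h.d2_mul, h1, h1, hε.map_mul, mul_comm, mul_smul]
    rw [← sub_eq_zero]
    refine h.alg.nondeg_right _ fun w => ?_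
    have h3 := h2 (w ⊗ₜ y)
    rw [comulL_tmul] at h3
    rw [map_sub, map_smul, sub_eq_zero]
    refine Eq.trans ?_ h3
    induction H.d4 p y with
    | zero => simp
    | add x y hx hy => simp only [map_add, hx, hy]
    | tmul p q => simp [h.alg.assoc]

end IsRegular
end CoverData

/-! ### Maps on the legs of a triple tensor product -/

section Tensor

variable {k P Q R V : Type*} [Field k] [AddCommGroup P] [Module k P] [AddCommGroup Q] [Module k Q]
  [AddCommGroup R] [Module k R] [AddCommGroup V] [Module k V]

theorem rTensor_assoc_rTensor (f : Q →ₗ[k] R) (g : P →ₗ[k] Q ⊗[k] Q) (t : P ⊗[k] V) :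
    f.rTensor (Q ⊗[k] V) (TensorProduct.assoc k Q Q V (g.rTensor V t)) =
      TensorProduct.assoc k R Q V ((f.rTensor Q ∘ₗ g).rTensor V t) := by
  induction t with
  | zero => simp
  | add x y hx hy => simp only [map_add, hx, hy]
  | tmul p v =>
    simp only [LinearMap.rTensor_tmul, LinearMap.comp_apply]
    induction g p with
    | zero => simp
    | add x y hx hy => simp only [map_add, hx, hy, TensorProduct.add_tmul]
    | tmul p q => simp

theorem sliceLeft_assoc_rTensor (ε : Q →ₗ[k] k) (g : P →ₗ[k] Q ⊗[k] R) (t : P ⊗[k] V) :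
    sliceLeft ε _ (TensorProduct.assoc k Q R V (g.rTensor V t)) =
      (sliceLeft ε R ∘ₗ g).rTensor V t := by
  induction t with
  | zero => simp
  | add x y hx hy => simp only [map_add, hx, hy]
  | tmul p v =>
    simp only [LinearMap.rTensor_tmul, LinearMap.comp_apply]
    induction g p with
    | zero => simp
    | add x y hx hy => simp only [map_add, hx, hy, TensorProduct.add_tmul]
    | tmul p q => simp [TensorProduct.smul_tmul']

end Tensor

/-! ### Covered comodules -/

section Comodule

variable {k Q A : Type*} [Field k] [AddCommGroup Q] [Module k Q] [AddCommGroup A] [Module k A]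

/-- `u ⊗ v ↦ ∑ p ⊗ g(c, v)`, where `g(a, u) = ∑ p ⊗ c`. -/
def iterateCover (g : A →ₗ[k] Q →ₗ[k] Q ⊗[k] A) (a : A) :
    Q ⊗[k] Q →ₗ[k] Q ⊗[k] (Q ⊗[k] A) :=
  TensorProduct.lift ((LinearMap.lTensorHom Q ∘ₗ g.flip).flip ∘ₗ g a)

@[simp] theorem iterateCover_tmul (g : A →ₗ[k] Q →ₗ[k] Q ⊗[k] A) (a : A) (u v : Q) :
    iterateCover g a (u ⊗ₜ v) = (g.flip v).lTensor Q (g a u) := rfl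

/-- Compatibility of the two covers and cancellation suffice. Coassociativity is deliberately not
assumed, because the lemma is also used to establish it. -/
theorem right_mul_of_cover {H : CoverData k Q} {gR gL : A →ₗ[k] Q →ₗ[k] Q ⊗[k] A}
    (hg : ∀ a x y, (H.mul x).rTensor A (gR a y) = (H.mul.flip y).rTensor A (gL a x))
    (h : H.IsRegular) (a : A) (x y : Q) :
    gR a (H.mul x y) = (H.mul.flip y).rTensor A (gR a x) := by
  refine h.cancel_mul fun w => ?_
  rw [hg, h.alg.flip_mul_comp, LinearMap.rTensor_comp_apply, ← hg,
    ← LinearMap.rTensor_comp_apply, ← LinearMap.rTensor_comp_apply, h.alg.mul_comp_flip]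

/-- `gR(a, x) = Γ(a)(x ⊗ 1)` and `gL(a, x) = (x ⊗ 1)Γ(a)` for an injective coassociative left
coaction `Γ`. -/
structure IsCoveredComodule (H : CoverData k Q) (gR gL : A →ₗ[k] Q →ₗ[k] Q ⊗[k] A) : Prop where
  cover : ∀ a x y, (H.mul x).rTensor A (gR a y) = (H.mul.flip y).rTensor A (gL a x)
  inj_right : ∀ a, (∀ y, gR a y = 0) → a = 0
  inj_left : ∀ a, (∀ y, gL a y = 0) → a = 0
  coassoc1 : ∀ a q v, TensorProduct.assoc k Q Q A ((H.d1.flip v).rTensor A (gR a q)) =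
    iterateCover gR a (H.d1 q v)
  coassoc2 : ∀ a q v, TensorProduct.assoc k Q Q A ((H.d2.flip v).rTensor A (gL a q)) =
    iterateCover gL a (H.d2 q v)
  coassoc3 : ∀ a q v, TensorProduct.assoc k Q Q A ((H.d3.flip v).rTensor A (gR a q)) =
    iterateCover gR a (H.d3 q v)
  coassoc4 : ∀ a q v, TensorProduct.assoc k Q Q A ((H.d4.flip v).rTensor A (gL a q)) =
    iterateCover gL a (H.d4 q v)

namespace IsCoveredComodule

variable {H : CoverData k Q} {gR gL : A →ₗ[k] Q →ₗ[k] Q ⊗[k] A}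

theorem op (hg : IsCoveredComodule H gR gL) : IsCoveredComodule H.op gL gR where
  cover a x y := (hg.cover a y x).symm
  inj_right := hg.inj_left
  inj_left := hg.inj_right
  coassoc1 := hg.coassoc4
  coassoc2 := hg.coassoc3
  coassoc3 := hg.coassoc2
  coassoc4 := hg.coassoc1

theorem right_mul (hg : IsCoveredComodule H gR gL) (h : H.IsRegular) (a : A) (x y : Q) :
    gR a (H.mul x y) = (H.mul.flip y).rTensor A (gR a x) :=
  right_mul_of_cover hg.cover h a x y

/-- Slicing the first leg of the coassociativity law by ε gives gR((ε ⊗ id)gR(a, u), v) = ε(u) gR(a,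
v); injectivity of the coaction removes v. -/
theorem counit_right (hg : IsCoveredComodule H gR gL) (h : H.IsRegular) {ε : Q →ₗ[k] k}
    (hε : H.IsCounit ε) (a : A) (u : Q) : sliceLeft ε A (gR a u) = ε u • a := by
  have key : ∀ t, sliceLeft ε _ (iterateCover gR a t) = gR a (sliceLeft ε Q t) := by
    intro t
    obtain ⟨s, rfl⟩ := h.bij1.surjective t
    induction s with
    | zero => simp
    | add x y hx hy => simp only [map_add, hx, hy]
    | tmul q v =>
      rw [TensorProduct.lift.tmul, ← hg.coassoc1, sliceLeft_assoc_rTensor, hε.d1,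
        hg.right_mul h]
      congr 2
      ext p
      exact hε.d1 p v
  rw [← sub_eq_zero]
  refine hg.inj_right _ fun v => ?_
  have := key (u ⊗ₜ v)
  rw [iterateCover_tmul, sliceLeft_lTensor, sliceLeft_tmul, map_smul, LinearMap.flip_apply] at this
  rw [map_sub, LinearMap.sub_apply, this, map_smul, LinearMap.smul_apply, sub_self]

/-- `Γ(A)(Q ⊗ 1) = Q ⊗ A` -/
theorem right_surjective (hg : IsCoveredComodule H gR gL) (h : H.IsRegular) :
    Function.Surjective (TensorProduct.lift gR) := by
  rcases subsingleton_or_nontrivial Q with hQ | hQ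
  · exact fun t => ⟨0, Subsingleton.elim _ _⟩
  obtain ⟨ε, hε⟩ := h.exists_counit
  obtain ⟨σ, hσ1, hσ2⟩ := h.cop.exists_antipode hε.cop
  obtain ⟨q, hq⟩ := hε.exists_eq_one h
  rw [← LinearMap.range_eq_top]
  by_contra hne
  -- If the range were proper, a nonzero functional would vanish on it. The antipode of the opposite
  -- coproduct shows that such a functional is zero.
  obtain ⟨f, hf0, hf⟩ := Submodule.exists_le_ker_of_lt_top _ (lt_top_iff_ne_top.2 hne)
  apply hf0
  have hfg : ∀ a y, f (gR a y) = 0 := fun a y => hf ⟨a ⊗ₜ y, rfl⟩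
  let G : Q ⊗[k] A →ₗ[k] Q →ₗ[k] k := (LinearMap.rTensorHom A ∘ₗ H.mul.flip).flip.compr₂ f
  have h1 : ∀ z a q u, (f ∘ₗ (H.mul.flip z).rTensor A).lTensor Q
      (TensorProduct.assoc k Q Q A ((H.d3.flip u).rTensor A (gR a q))) = 0 := by
    intro z a q u
    rw [hg.coassoc3]
    induction H.d3 q u with
    | zero => simp
    | add x y hx hy => simp only [map_add, hx, hy, add_zero]
    | tmul r s =>
      rw [iterateCover_tmul, ← LinearMap.lTensor_comp_apply]
      have : (f ∘ₗ (H.mul.flip z).rTensor A) ∘ₗ gR.flip s = 0 := by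
        ext c
        simp only [LinearMap.comp_apply, LinearMap.flip_apply]
        rw [← hg.right_mul h, hfg, LinearMap.zero_apply]
      rw [this, LinearMap.lTensor_zero, LinearMap.zero_apply]
  -- The same vanishing with the cover moved from the right of the first leg to its left, as the
  -- antipode identity requires.
  have h2 : ∀ z a q w, (f ∘ₗ (H.mul.flip z).rTensor A).lTensor Q
      (TensorProduct.assoc k Q Q A ((H.d2.flip w).rTensor A (gR a q))) = 0 := by
    intro z a q w
    refine h.cancel_flip fun u => ?_
    have : (H.mul.flip u).rTensor Q ∘ₗ H.d2.flip w = (H.mul w).rTensor Q ∘ₗ H.d3.flip u := by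
      ext p
      exact (h.d3_d2 p w u).symm
    rw [rTensor_lTensor, rTensor_assoc_rTensor, this, ← rTensor_assoc_rTensor, ← rTensor_lTensor,
      h1, map_zero, map_zero]
  -- The factor z is about to be replaced by an expression in the first leg, so the vanishing for
  -- each fixed z is first restated with values in functionals of z.
  have h3 : ∀ a q w, G.lTensor Q
      (TensorProduct.assoc k Q Q A ((H.d2.flip w).rTensor A (gR a q))) = 0 := by
    intro a q w
    refine eq_zero_of_lTensor (fun z => LinearMap.applyₗ z) (fun x hx => LinearMap.ext hx) _
      fun z => ?_
    rw [← LinearMap.lTensor_comp_apply]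
    exact h2 z a q w
  -- With S' the antipode of the opposite coproduct, this is ∑ p₂ S'(w p₁) y = ε(p) S'(w) y applied
  -- under f.
  have h4 : ∀ w y t, TensorProduct.lift ((LinearMap.applyₗ ∘ₗ σ.flip y))
      (G.lTensor Q (TensorProduct.assoc k Q Q A ((H.d2.flip w).rTensor A t))) =
      f (σ w y ⊗ₜ sliceLeft ε A t) := by
    intro w y t
    induction t with
    | zero => simp
    | add x y hx hy => simp only [map_add, hx, hy, TensorProduct.tmul_add]
    | tmul p c =>
      rw [sliceLeft_tmul, ← TensorProduct.smul_tmul, ← hσ2, LinearMap.rTensor_tmul]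
      simp only [CoverData.cop, LinearMap.compr₂_apply, LinearMap.flip_apply]
      induction H.d2 p w with
      | zero => simp
      | add x y hx hy => simp only [map_add, hx, hy, TensorProduct.add_tmul]
      | tmul r s => simp [G]
  have h5 : ∀ a (u : Q ⊗[k] Q), f (TensorProduct.lift σ u ⊗ₜ a) = 0 := by
    intro a u
    induction u with
    | zero => simp
    | add x y hx hy => simp only [map_add, hx, hy, TensorProduct.add_tmul, add_zero]
    | tmul w y =>
      have := h4 w y (gR a q)
      rw [h3, map_zero, hg.counit_right h hε, hq, one_smul] at this
      exact this.symm
  refine TensorProduct.ext' fun z a => ?_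
  have := h5 a (H.cop.d1 q z)
  rw [hσ1, hq, one_smul] at this
  rw [this, LinearMap.zero_apply]

/-- `(Q ⊗ 1)Γ(A) = Q ⊗ A` -/
theorem left_surjective (hg : IsCoveredComodule H gR gL) (h : H.IsRegular) :
    Function.Surjective (TensorProduct.lift gL) :=
  hg.op.right_surjective h.op

end IsCoveredComodule
end Comodule

/-! ### The left twisted product of a left-left Long module algebra -/

section Long

variable {k Q A V W : Type*} [Field k] [AddCommGroup Q] [Module k Q] [AddCommGroup A] [Module k A]
  [AddCommGroup V] [Module k V] [AddCommGroup W] [Module k W]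

/-- `act` is a unital action of the algebra `(Q, m)`. -/
structure IsUnitalAction (m : Q →ₗ[k] Q →ₗ[k] Q) (act : Q →ₗ[k] A →ₗ[k] A) : Prop where
  mul_act : ∀ x y a, act (m x y) a = act x (act y a)
  surj : Function.Surjective (TensorProduct.lift act)

namespace IsUnitalAction

variable {m : Q →ₗ[k] Q →ₗ[k] Q} {act : Q →ₗ[k] A →ₗ[k] A}

theorem ext (hu : IsUnitalAction m act) {f g : A →ₗ[k] V}
    (hfg : ∀ y b, f (act y b) = g (act y b)) : f = g := by
  ext a
  obtain ⟨t, rfl⟩ := hu.surj a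
  induction t with
  | zero => simp
  | add x y hx hy => simp only [map_add, hx, hy]
  | tmul y b => exact hfg y b

theorem act_lift (hu : IsUnitalAction m act) (x : Q) (t : Q ⊗[k] A) :
    act x (TensorProduct.lift act t) = TensorProduct.lift act ((m x).rTensor A t) := by
  induction t with
  | zero => simp
  | add x y hx hy => simp only [map_add, hx, hy]
  | tmul y b => simp [hu.mul_act]

end IsUnitalAction

/-- `act` makes `(A, μ)` a module algebra. -/
structure IsCoveredModuleAlgebra (H : CoverData k Q) (μ : A →ₗ[k] A →ₗ[k] A)
    (act : Q →ₗ[k] A →ₗ[k] A) : Prop extends IsUnitalAction H.mul act where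
  act_mul1 : ∀ x z a b, act x (μ a (act z b)) =
    TensorProduct.lift μ (TensorProduct.map (act.flip a) (act.flip b) (H.d1 x z))
  act_mul3 : ∀ x y a b, act x (μ (act y a) b) =
    TensorProduct.lift μ (TensorProduct.map (act.flip a) (act.flip b) (H.d3 x y))

/-- `p ⊗ c ↦ ∑ s ⊗ e c`, where `g(a, p) = ∑ s ⊗ e`; this is `t ↦ Γ(a) t`. -/
def coactMul (μ : A →ₗ[k] A →ₗ[k] A) (g : A →ₗ[k] Q →ₗ[k] Q ⊗[k] A) (a : A) :
    Q ⊗[k] A →ₗ[k] Q ⊗[k] A :=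
  TensorProduct.lift ((LinearMap.lTensorHom Q ∘ₗ μ.flip).compl₂ (g a)).flip

@[simp] theorem coactMul_tmul (μ : A →ₗ[k] A →ₗ[k] A) (g : A →ₗ[k] Q →ₗ[k] Q ⊗[k] A) (a : A)
    (p : Q) (c : A) : coactMul μ g a (p ⊗ₜ c) = (μ.flip c).lTensor Q (g a p) := rfl

/-- The coaction given by `gR` and `gL` is multiplicative. -/
structure IsCoactionMul (μ : A →ₗ[k] A →ₗ[k] A) (gR gL : A →ₗ[k] Q →ₗ[k] Q ⊗[k] A) : Prop where
  right : ∀ a b y, gR (μ a b) y = coactMul μ gR a (gR b y)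
  left : ∀ a b x, gL (μ a b) x = coactMul μ.flip gL b (gL a x)

theorem IsCoactionMul.flip {μ : A →ₗ[k] A →ₗ[k] A} {gR gL : A →ₗ[k] Q →ₗ[k] Q ⊗[k] A}
    (h : IsCoactionMul μ gR gL) : IsCoactionMul μ.flip gL gR where
  right a b y := h.left b a y
  left a b y := h.right b a y

/-- The linear map `f` commutes with the coaction given by `gR` and `gL`. -/
structure IsColinear (f : A →ₗ[k] A) (gR gL : A →ₗ[k] Q →ₗ[k] Q ⊗[k] A) : Prop where
  right : ∀ a y, gR (f a) y = f.lTensor Q (gR a y)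
  left : ∀ a y, gL (f a) y = f.lTensor Q (gL a y)

theorem IsColinear.flip {f : A →ₗ[k] A} {gR gL : A →ₗ[k] Q →ₗ[k] Q ⊗[k] A}
    (h : IsColinear f gR gL) : IsColinear f gL gR := ⟨h.left, h.right⟩

/-- A left-left Long module algebra in terms of covered coactions. -/
structure IsCoveredLong (H : CoverData k Q) (μ : A →ₗ[k] A →ₗ[k] A) (act : Q →ₗ[k] A →ₗ[k] A)
    (gR gL : A →ₗ[k] Q →ₗ[k] Q ⊗[k] A) : Prop where
  alg : IsAlg μ
  modAlg : IsCoveredModuleAlgebra H μ act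
  comod : IsCoveredComodule H gR gL
  coactMul : IsCoactionMul μ gR gL
  long : ∀ x, IsColinear (act x) gR gL

/-- `p ⊗ c ↦ c (p ▷ b)` -/
def evalAct (μ : A →ₗ[k] A →ₗ[k] A) (act : Q →ₗ[k] A →ₗ[k] A) (b : A) : Q ⊗[k] A →ₗ[k] A :=
  TensorProduct.lift (μ.flip ∘ₗ act.flip b)

@[simp] theorem evalAct_tmul (μ : A →ₗ[k] A →ₗ[k] A) (act : Q →ₗ[k] A →ₗ[k] A) (b c : A) (p : Q) :
    evalAct μ act b (p ⊗ₜ c) = μ c (act p b) := rfl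

theorem evalAct_add (μ : A →ₗ[k] A →ₗ[k] A) (act : Q →ₗ[k] A →ₗ[k] A) (b c : A) :
    evalAct μ act (b + c) = evalAct μ act b + evalAct μ act c :=
  TensorProduct.ext' fun _ _ => by simp

theorem evalAct_smul (μ : A →ₗ[k] A →ₗ[k] A) (act : Q →ₗ[k] A →ₗ[k] A) (r : k) (b : A) :
    evalAct μ act (r • b) = r • evalAct μ act b :=
  TensorProduct.ext' fun _ _ => by simp

theorem evalAct_zero (μ : A →ₗ[k] A →ₗ[k] A) (act : Q →ₗ[k] A →ₗ[k] A) : evalAct μ act 0 = 0 :=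
  TensorProduct.ext' fun _ _ => by simp

theorem evalAct_act {H : CoverData k Q} {μ : A →ₗ[k] A →ₗ[k] A} {act : Q →ₗ[k] A →ₗ[k] A}
    (hu : IsUnitalAction H.mul act) (y : Q) (b : A) (t : Q ⊗[k] A) :
    evalAct μ act (act y b) t = evalAct μ act b ((H.mul.flip y).rTensor A t) := by
  induction t with
  | zero => simp
  | add x y hx hy => simp only [map_add, hx, hy]
  | tmul y b => simp [hu.mul_act]

/-- `p, c ↦ (b ↦ c (p ▷ b))` -/
def mulAct (μ : A →ₗ[k] A →ₗ[k] A) (act : Q →ₗ[k] A →ₗ[k] A) : Q →ₗ[k] A →ₗ[k] A →ₗ[k] A :=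
  LinearMap.mk₂ k (fun p c => μ c ∘ₗ act p) (fun _ _ _ => by ext; simp)
    (fun _ _ _ => by ext; simp) (fun _ _ _ => by ext; simp) (fun _ _ _ => by ext; simp)

@[simp] theorem mulAct_apply (μ : A →ₗ[k] A →ₗ[k] A) (act : Q →ₗ[k] A →ₗ[k] A) (p : Q) (c : A) :
    mulAct μ act p c = μ c ∘ₗ act p := rfl

/-- `ν(a, y ▷ b) = ∑ c (p ▷ b)`, where `gR(a, y) = ∑ p ⊗ c`. -/
def IsTwist (μ : A →ₗ[k] A →ₗ[k] A) (act : Q →ₗ[k] A →ₗ[k] A)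
    (gR : A →ₗ[k] Q →ₗ[k] Q ⊗[k] A) (ν : A →ₗ[k] A →ₗ[k] A) : Prop :=
  ∀ a y b, ν a (act y b) = evalAct μ act b (gR a y)

section Existence

variable {H : CoverData k Q} {act : Q →ₗ[k] A →ₗ[k] A} {gR gL : A →ₗ[k] Q →ₗ[k] Q ⊗[k] A}

theorem IsTwist.unique (hu : IsUnitalAction H.mul act) {μ ν ν' : A →ₗ[k] A →ₗ[k] A}
    (hν : IsTwist μ act gR ν) (hν' : IsTwist μ act gR ν') : ν = ν' := by
  ext1 a
  exact hu.ext fun y b => (hν a y b).trans (hν' a y b).symm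

/-- The formula must vanish on every relation ∑ yᵢ ▷ bᵢ = 0. A local unit e on the left of a₍₋₁₎
makes the cover by the yᵢ superfluous, so the yᵢ can be recombined with the bᵢ. No property of `μ`
is used, so the lemma also applies to a product that is itself twisted. -/
theorem exists_isTwist (h : H.IsRegular) (hu : IsUnitalAction H.mul act)
    (hg : IsCoveredComodule H gR gL) (μ : A →ₗ[k] A →ₗ[k] A) : ∃ ν, IsTwist μ act gR ν := by
  let ev : A →ₗ[k] Q ⊗[k] A →ₗ[k] A :=
    { toFun := evalAct μ act
      map_add' := evalAct_add μ act
      map_smul' := evalAct_smul μ act }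
  let Φ : A → Q ⊗[k] A →ₗ[k] A := fun a => TensorProduct.lift (ev.flip ∘ₗ gR a)
  have hΦ : ∀ a y b, Φ a (y ⊗ₜ b) = evalAct μ act b (gR a y) := fun a y b => rfl
  have hker : ∀ a t, TensorProduct.lift act t = 0 → Φ a t = 0 := by
    intro a t ht
    obtain ⟨e, he⟩ := h.exists_local_unit
      (TensorProduct.assoc k Q A A ((gR a).rTensor A t))
    have h1 : ∀ s, TensorProduct.lift ev.flip ((TensorProduct.assoc k Q A A).symm
        ((H.mul e).rTensor _ (TensorProduct.assoc k Q A A ((gR a).rTensor A s)))) =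
        evalAct μ act (TensorProduct.lift act s) (gL a e) := by
      intro s
      induction s with
      | zero => simp [evalAct_zero]
      | add x y hx hy => simp only [map_add, hx, hy, evalAct_add, LinearMap.add_apply]
      | tmul y b =>
        rw [TensorProduct.lift.tmul, evalAct_act hu, ← hg.cover, LinearMap.rTensor_tmul]
        induction gR a y with
        | zero => simp
        | add x y hx hy => simp only [map_add, hx, hy, TensorProduct.add_tmul]
        | tmul p c => simp [ev]
    have h2 : Φ a t = TensorProduct.lift ev.flip ((gR a).rTensor A t) := by
      rw [← LinearMap.comp_apply]
      congr 1
      exact TensorProduct.ext' fun _ _ => rfl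
    have h3 := h1 t
    rw [he, LinearEquiv.symm_apply_apply, ht] at h3
    rw [h2, h3, evalAct_zero, LinearMap.zero_apply]
  -- A linear section of Q ⊗ A → A turns the induced formula into a bilinear map; `hker` makes its
  -- values independent of the section.
  obtain ⟨s, hs⟩ := LinearMap.exists_rightInverse_of_surjective _
    (LinearMap.range_eq_top.2 hu.surj)
  refine ⟨LinearMap.mk₂ k (fun a b => Φ a (s b)) ?_ ?_ ?_ ?_, ?_⟩
  · intro a a' b
    have : Φ (a + a') = Φ a + Φ a' := TensorProduct.ext' fun y b => by
      rw [LinearMap.add_apply, hΦ, hΦ, hΦ, map_add, LinearMap.add_apply, map_add]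
    rw [this, LinearMap.add_apply]
  · intro r a b
    have : Φ (r • a) = r • Φ a := TensorProduct.ext' fun y b => by
      rw [LinearMap.smul_apply, hΦ, hΦ, map_smul, LinearMap.smul_apply, map_smul]
    rw [this, LinearMap.smul_apply]
  · intro a b c
    rw [map_add, map_add]
  · intro r a b
    rw [map_smul, map_smul]
  · intro a y b
    rw [LinearMap.mk₂_apply, ← hΦ, ← sub_eq_zero, ← map_sub]
    apply hker
    rw [map_sub, ← LinearMap.comp_apply, hs]
    simp

end Existence

namespace IsCoveredLong

variable {H : CoverData k Q} {μ ν : A →ₗ[k] A →ₗ[k] A} {act : Q →ₗ[k] A →ₗ[k] A}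
  {gR gL : A →ₗ[k] Q →ₗ[k] Q ⊗[k] A}

/-- `p ⊗ s ⊗ e ↦ s ⊗ e (p ▷ d)` -/
def evalIter (μ : A →ₗ[k] A →ₗ[k] A) (act : Q →ₗ[k] A →ₗ[k] A) (d : A) :
    Q ⊗[k] (Q ⊗[k] A) →ₗ[k] Q ⊗[k] A :=
  TensorProduct.lift (LinearMap.lTensorHom Q ∘ₗ μ.flip ∘ₗ act.flip d)

@[simp] theorem evalIter_tmul (d : A) (p : Q) (t : Q ⊗[k] A) :
    evalIter μ act d (p ⊗ₜ t) = (μ.flip (act p d)).lTensor Q t := rfl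

theorem evalIter_add (d d' : A) :
    evalIter μ act (d + d') = evalIter μ act d + evalIter μ act d' :=
  TensorProduct.ext' fun _ _ => by simp [LinearMap.lTensor_add]

theorem evalIter_smul (r : k) (d : A) :
    evalIter μ act (r • d) = r • evalIter μ act d :=
  TensorProduct.ext' fun _ _ => by simp [LinearMap.lTensor_smul]

/-- For `t = ∑ p ⊗ c`, the map `r ⊗ d ↦ ∑ s ⊗ e (p ▷ d)` with `gR(c, r) = ∑ s ⊗ e`. -/
def twistCoact (μ : A →ₗ[k] A →ₗ[k] A) (act : Q →ₗ[k] A →ₗ[k] A)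
    (gR : A →ₗ[k] Q →ₗ[k] Q ⊗[k] A) (t : Q ⊗[k] A) : Q ⊗[k] A →ₗ[k] Q ⊗[k] A :=
  TensorProduct.lift (LinearMap.mk₂ k (fun r d => evalIter μ act d ((gR.flip r).lTensor Q t))
    (fun r r' d => by simp [LinearMap.lTensor_add])
    (fun c r d => by simp [LinearMap.lTensor_smul])
    (fun r d d' => by simp [evalIter_add])
    (fun c r d => by simp [evalIter_smul]))

@[simp] theorem twistCoact_tmul (t : Q ⊗[k] A) (r : Q) (d : A) :
    twistCoact μ act gR t (r ⊗ₜ d) = evalIter μ act d ((gR.flip r).lTensor Q t) := rfl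

/-- Γ is multiplicative and commutes with the action. Only these two facts are used, so the lemma
serves for the right coaction as well. -/
theorem coact_evalAct (hg : ∀ a b y, gR (μ a b) y = TwistedAlg.coactMul μ gR a (gR b y))
    (hl : ∀ x a y, gR (act x a) y = (act x).lTensor Q (gR a y)) (t : Q ⊗[k] A) (b : A) (y : Q) :
    gR (evalAct μ act b t) y = twistCoact μ act gR t (gR b y) := by
  induction t with
  | zero =>
    have : twistCoact μ act gR 0 = 0 := TensorProduct.ext' fun _ _ => by simp
    simp [this]
  | add s t hs ht =>
    have : twistCoact μ act gR (s + t) = twistCoact μ act gR s + twistCoact μ act gR t :=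
      TensorProduct.ext' fun _ _ => by simp
    simp only [map_add, hs, ht, this, LinearMap.add_apply]
  | tmul p c =>
    rw [evalAct_tmul, hg, hl]
    induction gR b y with
    | zero => simp
    | add s t hs ht => simp only [map_add, hs, ht]
    | tmul r d => simp

theorem right_twist (hA : IsCoveredLong H μ act gR gL) (hν : IsTwist μ act gR ν)
    (a b : A) (x y : Q) : gR (ν a (act x b)) y = twistCoact μ act gR (gR a x) (gR b y) := by
  rw [hν, coact_evalAct hA.coactMul.right fun x => (hA.long x).right]

/-- `a • ((x ▷ d) (r ▷ c)) = ∑ a₀ (a₍₋₂₎ x ▷ d) (a₍₋₁₎ r ▷ c)` -/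
theorem twist_mul (h : H.IsRegular) (hA : IsCoveredLong H μ act gR gL)
    (hν : IsTwist μ act gR ν) (a d c : A) (t : Q ⊗[k] Q) :
    ν a (TensorProduct.lift μ (TensorProduct.map (act.flip d) (act.flip c) t)) =
      evalAct μ act c (evalIter μ act d (iterateCover gR a t)) := by
  obtain ⟨s, rfl⟩ := h.bij1.surjective t
  induction s with
  | zero => simp
  | add x y hx hy => simp only [map_add, hx, hy]
  | tmul q v =>
    rw [TensorProduct.lift.tmul, ← hA.modAlg.act_mul1, hν, ← hA.comod.coassoc1]
    induction gR a q with
    | zero => simp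
    | add x y hx hy => simp only [map_add, hx, hy]
    | tmul p e =>
      rw [evalAct_tmul, hA.modAlg.act_mul1, LinearMap.rTensor_tmul, LinearMap.flip_apply]
      induction H.d1 p v with
      | zero => simp
      | add x y hx hy => simp only [map_add, hx, hy, TensorProduct.add_tmul]
      | tmul p s => simp [hA.alg.assoc]

/-- For factors x ▷ b and y ▷ c, both sides evaluate the same twice iterated coaction of a: the left
one through `right_twist`, the right one through the module algebra law in `twist_mul`. -/
theorem twist_assoc (h : H.IsRegular) (hA : IsCoveredLong H μ act gR gL)
    (hν : IsTwist μ act gR ν) (a b c : A) : ν (ν a b) c = ν a (ν b c) := by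
  have hb : ν.compr₂ (ν.flip c) a = ν a ∘ₗ ν.flip c := by
    refine hA.modAlg.ext fun x b => ?_
    have hc : ν (ν a (act x b)) = ν a ∘ₗ ν (act x b) := by
      refine hA.modAlg.ext fun y c => ?_
      rw [LinearMap.comp_apply, hν, hν (act x b), hA.right_twist hν, (hA.long x).right]
      induction gR b y with
      | zero => simp
      | add x y hx hy => simp only [map_add, hx, hy]
      | tmul r d =>
        rw [twistCoact_tmul, ← iterateCover_tmul, ← hA.twist_mul h hν]
        simp
    exact LinearMap.congr_fun hc c
  exact LinearMap.congr_fun hb b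

/-- From a • A = 0, coacting gives ∑ a₍₋₁₎r ⊗ a₀(a₍₋₂₎x ▷ d) = 0 for all r, x, d. Replacing the
action on d by one composed with the antipode of the other leg collapses this to a(S(y)z ▷ b) = 0,
and the elements S(y)z span `Q`. -/
theorem twist_nondeg_left (h : H.IsRegular) (hA : IsCoveredLong H μ act gR gL)
    (hν : IsTwist μ act gR ν) (a : A) (ha : ∀ b, ν a b = 0) : a = 0 := by
  rcases subsingleton_or_nontrivial Q with hQ | hQ
  · obtain ⟨t, rfl⟩ := hA.modAlg.surj a
    rw [Subsingleton.elim t 0, map_zero]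
  obtain ⟨ε, hε⟩ := h.exists_counit
  obtain ⟨σ, hσ1, hσ2⟩ := h.exists_antipode hε
  obtain ⟨q, hq⟩ := hε.exists_eq_one h
  have h1 : ∀ d t, evalIter μ act d (iterateCover gR a t) = 0 := by
    intro d t
    induction t with
    | zero => simp
    | add x y hx hy => simp only [map_add, hx, hy, add_zero]
    | tmul x r =>
      rw [iterateCover_tmul, ← twistCoact_tmul]
      obtain ⟨s, hs⟩ := hA.comod.right_surjective h (r ⊗ₜ d)
      rw [← hs]
      clear hs
      induction s with
      | zero => simp
      | add x y hx hy => simp only [map_add, hx, hy, add_zero]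
      | tmul b y => rw [TensorProduct.lift.tmul, ← hA.right_twist hν, ha, map_zero,
          LinearMap.zero_apply]
  -- Taking d = z ▷ d' supplies the cover of the acting leg, which frees the other leg to be covered
  -- from the left by y.
  have h2 : ∀ y d, evalIter μ act d
      (TensorProduct.assoc k Q Q A ((H.d4.flip y).rTensor A (gR a q))) = 0 := by
    intro y d
    obtain ⟨s, rfl⟩ := hA.modAlg.surj d
    induction s with
    | zero =>
      have : evalIter μ act 0 = 0 := TensorProduct.ext' fun _ _ => by simp
      simp [this]
    | add x y hx hy => rw [map_add, evalIter_add, LinearMap.add_apply, hx, hy, add_zero]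
    | tmul z d =>
      have h3 := congrArg ((H.mul y).rTensor A) (h1 d (H.d3 q z))
      rw [← hA.comod.coassoc3, map_zero] at h3
      rw [← h3]
      induction gR a q with
      | zero => simp
      | add x y hx hy => simp only [map_add, hx, hy]
      | tmul p e =>
        have h4 : ∀ t, (H.mul y).rTensor A (evalIter μ act d (TensorProduct.assoc k Q Q A
            (t ⊗ₜ e))) = evalIter μ act d (TensorProduct.assoc k Q Q A
              ((H.mul y).lTensor Q t ⊗ₜ e)) := by
          intro t
          induction t with
          | zero => simp
          | add x y hx hy => simp only [map_add, hx, hy, TensorProduct.add_tmul]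
          | tmul u v => simp
        simp only [LinearMap.rTensor_tmul, LinearMap.flip_apply]
        rw [h4, h.d3_d4]
        induction H.d4 p y with
        | zero => simp
        | add x y hx hy => simp only [map_add, hx, hy, TensorProduct.add_tmul]
        | tmul u v => simp [hA.modAlg.mul_act]
  -- Keeps d as a variable, because it is to be replaced by S(y p₂)z ▷ b, which depends on the
  -- remaining leg.
  let Y : Q ⊗[k] (Q ⊗[k] A) →ₗ[k] Q ⊗[k] (A →ₗ[k] A) :=
    TensorProduct.lift (LinearMap.lTensorHom Q ∘ₗ mulAct μ act)
  have h3 : ∀ y, Y (TensorProduct.assoc k Q Q A ((H.d4.flip y).rTensor A (gR a q))) = 0 := by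
    intro y
    refine eq_zero_of_lTensor (fun z => LinearMap.applyₗ z) (fun x hx => LinearMap.ext hx) _
      fun d => ?_
    rw [← h2 y d, ← LinearMap.comp_apply]
    congr 1
    refine TensorProduct.ext' fun u t => ?_
    simp only [LinearMap.comp_apply, Y, TensorProduct.lift.tmul, LinearMap.coe_lTensorHom,
      evalIter_tmul, ← LinearMap.lTensor_comp_apply]
    rfl
  have h4 : ∀ y z b t, TensorProduct.lift (LinearMap.applyₗ ∘ₗ act.flip b ∘ₗ σ.flip z)
      (Y (TensorProduct.assoc k Q Q A ((H.d4.flip y).rTensor A t))) =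
      μ (sliceLeft ε A t) (act (σ y z) b) := by
    intro y z b t
    induction t with
    | zero => simp
    | add x y hx hy => simp only [map_add, hx, hy, LinearMap.add_apply]
    | tmul p e =>
      rw [sliceLeft_tmul, map_smul, LinearMap.smul_apply, ← map_smul, ← LinearMap.smul_apply,
        ← map_smul, ← hσ2, LinearMap.rTensor_tmul, LinearMap.flip_apply]
      induction H.d4 p y with
      | zero => simp
      | add x y hx hy => simp only [map_add, hx, hy, TensorProduct.add_tmul, LinearMap.add_apply]
      | tmul u v => simp [Y, hA.modAlg.mul_act]
  have h5 : ∀ b (u : Q ⊗[k] Q), μ a (act (TensorProduct.lift σ u) b) = 0 := by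
    intro b u
    induction u with
    | zero => simp
    | add x y hx hy => simp only [map_add, hx, hy, LinearMap.add_apply, add_zero]
    | tmul w y =>
      have := h4 w y b (gR a q)
      rw [h3, map_zero, hA.comod.counit_right h hε, hq, one_smul] at this
      exact this.symm
  refine hA.alg.nondeg_left a fun b => ?_
  have : μ a = 0 := hA.modAlg.ext fun z b => by
    have := h5 b (H.d1 q z)
    rw [hσ1, hq, one_smul] at this
    exact this
  rw [this, LinearMap.zero_apply]

/-- Formally x ▷ ((w ▷ a) • b) = ∑ (x₁w ▷ a₀)(x₂a₍₋₁₎ ▷ b). The element w covers x₁ and x₂ covers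
a₍₋₁₎, so b itself need not be covered. -/
theorem act_twist (hA : IsCoveredLong H μ act gR gL) (hν : IsTwist μ act gR ν)
    (a b : A) (x w : Q) : act x (ν (act w a) b) =
      TensorProduct.lift (((LinearMap.lTensorHom Q ∘ₗ act).compl₂ (gL a)).compr₂
        (evalAct μ act b)) (H.d3 x w) := by
  obtain ⟨t, rfl⟩ := hA.modAlg.surj b
  induction t with
  | zero =>
    rw [map_zero, map_zero, map_zero, evalAct_zero]
    exact TensorProduct.induction_on (H.d3 x w) (map_zero _).symm (fun _ _ => by simp)
      fun _ _ hx hy => by rw [map_add, ← hx, ← hy, add_zero]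
  | add s t hs ht =>
    rw [map_add, map_add, map_add, hs, ht, evalAct_add]
    induction H.d3 x w with
    | zero => simp
    | add x y hx hy =>
      simp only [map_add, ← hx, ← hy]
      abel
    | tmul u v => simp
  | tmul z b =>
    rw [TensorProduct.lift.tmul, hν, (hA.long w).right]
    have h1 : ∀ s : Q ⊗[k] Q, TensorProduct.lift (((LinearMap.lTensorHom Q ∘ₗ act).compl₂
        (gL a)).compr₂ (evalAct μ act (act z b))) s =
        TensorProduct.lift (((LinearMap.lTensorHom Q ∘ₗ act).compl₂
          ((LinearMap.rTensorHom A ∘ₗ H.mul).flip (gR a z))).compr₂ (evalAct μ act b)) s := by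
      intro s
      induction s with
      | zero => simp
      | add x y hx hy => simp only [map_add, hx, hy]
      | tmul u v =>
        simp only [TensorProduct.lift.tmul, LinearMap.compr₂_apply, LinearMap.compl₂_apply,
          LinearMap.comp_apply, LinearMap.coe_lTensorHom, LinearMap.flip_apply,
          LinearMap.coe_rTensorHom, hA.comod.cover]
        rw [evalAct_act hA.modAlg.toIsUnitalAction, rTensor_lTensor]
    rw [h1]
    induction gR a z with
    | zero =>
      rw [map_zero, map_zero, map_zero, map_zero]
      exact TensorProduct.induction_on (H.d3 x w) (map_zero _).symm (fun _ _ => by simp)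
        fun _ _ hx hy => by rw [map_add, ← hx, ← hy, add_zero]
    | add s t hs ht =>
      simp only [map_add, hs, ht]
      induction H.d3 x w with
      | zero => simp
      | add x y hx hy =>
        simp only [map_add, ← hx, ← hy]
        abel
      | tmul u v => simp
    | tmul p c =>
      rw [LinearMap.lTensor_tmul, evalAct_tmul, hA.modAlg.act_mul3]
      induction H.d3 x w with
      | zero => simp
      | add x y hx hy => simp only [map_add, hx, hy]
      | tmul u v => simp [hA.modAlg.mul_act]

/-- In `act_twist`, x₁w ⊗ x₂ ranges over a spanning set of Q ⊗ Q, and then x₂a₍₋₁₎ ⊗ a₀ over one of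
Q ⊗ A. Thus (u ▷ c)(q ▷ b) = 0 for all u, c, q, hence Q ▷ b = 0, and a local unit recovers b. -/
theorem twist_nondeg_right (h : H.IsRegular) (hA : IsCoveredLong H μ act gR gL)
    (hν : IsTwist μ act gR ν) (b : A) (hb : ∀ a, ν a b = 0) : b = 0 := by
  have h1 : ∀ a (t : Q ⊗[k] Q), TensorProduct.lift (((LinearMap.lTensorHom Q ∘ₗ act).compl₂
      (gL a)).compr₂ (evalAct μ act b)) t = 0 := by
    intro a t
    obtain ⟨s, rfl⟩ := h.bij3.surjective t
    induction s with
    | zero => simp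
    | add x y hx hy => simp only [map_add, hx, hy, add_zero]
    | tmul x w => rw [TensorProduct.lift.tmul, ← hA.act_twist hν, hb, map_zero]
  have h2 : ∀ u t, evalAct μ act b ((act u).lTensor Q t) = 0 := by
    intro u t
    obtain ⟨s, rfl⟩ := hA.comod.left_surjective h t
    induction s with
    | zero => simp
    | add x y hx hy => simp only [map_add, hx, hy, add_zero]
    | tmul a v => exact h1 a (u ⊗ₜ v)
  have h3 : ∀ q, act q b = 0 := by
    intro q
    refine hA.alg.nondeg_right _ fun c => ?_
    have : μ.flip (act q b) = 0 := hA.modAlg.ext fun u c => h2 u (q ⊗ₜ c)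
    exact LinearMap.congr_fun this c
  obtain ⟨t, rfl⟩ := hA.modAlg.surj b
  obtain ⟨e, he⟩ := h.exists_local_unit t
  rw [← he, ← hA.modAlg.act_lift, h3]

theorem twist_isAlg (h : H.IsRegular) (hA : IsCoveredLong H μ act gR gL)
    (hν : IsTwist μ act gR ν) : IsAlg ν :=
  ⟨hA.twist_assoc h hν, hA.twist_nondeg_left h hν, hA.twist_nondeg_right h hν⟩

end IsCoveredLong
end Long

theorem CoverData.cop_op_cop_op {k Q : Type*} [Field k] [AddCommGroup Q] [Module k Q]
    (H : CoverData k Q) : H.cop.op.cop.op = H := by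
  have : ∀ d : Q →ₗ[k] Q →ₗ[k] Q ⊗[k] Q,
      (d.compr₂ (TensorProduct.comm k Q Q).toLinearMap).compr₂
        (TensorProduct.comm k Q Q).toLinearMap = d := by
    intro d
    ext x y
    simp
  simp only [CoverData.cop, CoverData.op, this]
  rfl

/-! ### Right structures on the left twisted product, and the L-R-twisted product -/

section FourSided

variable {k Q A : Type*} [Field k] [AddCommGroup Q] [Module k Q] [AddCommGroup A] [Module k A]

/-- The coactions with covered values `g` and `r` commute. -/
def CoactionsCommute (g r : A →ₗ[k] Q →ₗ[k] Q ⊗[k] A) : Prop :=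
  ∀ a x y, (r.flip x).lTensor Q (g a y) =
    TensorProduct.leftComm k Q Q A ((g.flip y).lTensor Q (r a x))

theorem CoactionsCommute.symm {g r : A →ₗ[k] Q →ₗ[k] Q ⊗[k] A} (h : CoactionsCommute g r) :
    CoactionsCommute r g := by
  intro a x y
  rw [h]
  exact ((TensorProduct.leftComm k Q Q A).symm_apply_apply _).symm

/-- A four-sided Long module algebra in terms of covered coactions; the right (co)action is turned
into a left one of the opposite and co-opposite multiplier Hopf algebra. -/
structure IsCoveredFourSided (H : CoverData k Q) (μ : A →ₗ[k] A →ₗ[k] A)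
    (act ract : Q →ₗ[k] A →ₗ[k] A) (gR gL rR rL : A →ₗ[k] Q →ₗ[k] Q ⊗[k] A) : Prop where
  left : IsCoveredLong H μ act gR gL
  right : IsCoveredLong H.cop.op μ.flip ract rL rR
  act_colinear : ∀ x, IsColinear (act x) rR rL
  ract_colinear : ∀ x, IsColinear (ract x) gR gL
  bimodule : ∀ x y a, ract y (act x a) = act x (ract y a)
  commute_right_right : CoactionsCommute gR rR
  commute_right_left : CoactionsCommute gR rL
  commute_left_left : CoactionsCommute gL rL

/-- `(q ⊗ c) ⊗ (p ⊗ d) ↦ (c ◁ p) (q ▷ d)` -/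
def evalLR (μ : A →ₗ[k] A →ₗ[k] A) (act ract : Q →ₗ[k] A →ₗ[k] A) :
    Q ⊗[k] A →ₗ[k] Q ⊗[k] A →ₗ[k] A :=
  TensorProduct.lift (LinearMap.mk₂ k
    (fun q c => TensorProduct.lift ((μ ∘ₗ ract.flip c).compl₂ (act q)))
    (fun _ _ _ => by ext; simp) (fun _ _ _ => by ext; simp)
    (fun _ _ _ => by ext; simp) (fun _ _ _ => by ext; simp))

@[simp] theorem evalLR_tmul (μ : A →ₗ[k] A →ₗ[k] A) (act ract : Q →ₗ[k] A →ₗ[k] A)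
    (p q : Q) (c d : A) :
    evalLR μ act ract (q ⊗ₜ c) (p ⊗ₜ d) = μ (ract p c) (act q d) := rfl

theorem evalLR_flip (μ : A →ₗ[k] A →ₗ[k] A) (act ract : Q →ₗ[k] A →ₗ[k] A) (s t : Q ⊗[k] A) :
    evalLR μ.flip ract act t s = evalLR μ act ract s t := by
  induction s with
  | zero => simp
  | add x y hx hy => simp only [map_add, hx, hy, LinearMap.add_apply]
  | tmul q c =>
    induction t with
    | zero => simp
    | add x y hx hy => simp only [map_add, hx, hy, LinearMap.add_apply]
    | tmul p d => simp

/-- `ν` is the L-R-twisted product. -/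
def IsLRTwist (μ : A →ₗ[k] A →ₗ[k] A) (act ract : Q →ₗ[k] A →ₗ[k] A)
    (gR rL : A →ₗ[k] Q →ₗ[k] Q ⊗[k] A) (ν : A →ₗ[k] A →ₗ[k] A) : Prop :=
  ∀ a y z b, ν (ract y a) (act z b) = evalLR μ act ract (gR a z) (rL b y)

theorem IsLRTwist.flip {μ ν : A →ₗ[k] A →ₗ[k] A} {act ract : Q →ₗ[k] A →ₗ[k] A}
    {gR rL : A →ₗ[k] Q →ₗ[k] Q ⊗[k] A} (h : IsLRTwist μ act ract gR rL ν) :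
    IsLRTwist μ.flip ract act rL gR ν.flip := fun a y z b => by
  rw [LinearMap.flip_apply, h, evalLR_flip]

/-- Brings the iterated evaluation into the form in which commutation of two coactions can be
applied. -/
theorem evalIter_eq (μ : A →ₗ[k] A →ₗ[k] A) (act : Q →ₗ[k] A →ₗ[k] A) (d : A)
    (t : Q ⊗[k] (Q ⊗[k] A)) : IsCoveredLong.evalIter μ act d t =
      (evalAct μ act d).lTensor Q (TensorProduct.leftComm k Q Q A t) := by
  rw [← LinearEquiv.coe_coe, ← LinearMap.comp_apply]
  congr 1
  ext p s e
  simp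

namespace IsCoveredFourSided

variable {H : CoverData k Q} {μ ν : A →ₗ[k] A →ₗ[k] A} {act ract : Q →ₗ[k] A →ₗ[k] A}
  {gR gL rR rL : A →ₗ[k] Q →ₗ[k] Q ⊗[k] A}

/-- The left twisted product of the mirror image is the opposite of the right twisted product, so
every statement about • yields one about ∗. -/
theorem mirror (hA : IsCoveredFourSided H μ act ract gR gL rR rL) :
    IsCoveredFourSided H.cop.op μ.flip ract act rL rR gL gR where
  left := hA.right
  right := by
    rw [H.cop_op_cop_op]
    exact hA.left
  act_colinear x := (hA.ract_colinear x).flip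
  ract_colinear x := (hA.act_colinear x).flip
  bimodule x y a := (hA.bimodule y x a).symm
  commute_right_right := hA.commute_left_left.symm
  commute_right_left := hA.commute_right_left.symm
  commute_left_left := hA.commute_right_right.symm

/-- The left twisted product satisfies the module algebra law for the right action. -/
theorem ract_twist (hA : IsCoveredFourSided H μ act ract gR gL rR rL)
    (hν : IsTwist μ act gR ν) (x z : Q) (a b : A) : ract x (ν (ract z b) a) =
    TensorProduct.lift ν.flip (TensorProduct.map (ract.flip a) (ract.flip b)
      (H.cop.op.d1 x z)) := by
  obtain ⟨t, rfl⟩ := hA.left.modAlg.surj a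
  induction t with
  | zero =>
    simp only [map_zero]
    exact TensorProduct.induction_on (H.cop.op.d1 x z) (by simp) (fun _ _ => by simp)
      fun _ _ hx hy => by simp only [map_add, ← hx, ← hy, add_zero]
  | add s t hs ht =>
    simp only [map_add, hs, ht, TensorProduct.map_add_left, LinearMap.add_apply]
  | tmul u a =>
    rw [TensorProduct.lift.tmul, hν, (hA.ract_colinear z).right]
    have h1 : TensorProduct.lift ν.flip (TensorProduct.map (ract.flip (act u a)) (ract.flip b)
        (H.cop.op.d1 x z)) = TensorProduct.lift (((TensorProduct.mk k Q A).flip ∘ₗ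
          ract.flip a).compr₂ (evalLR μ act ract (gR b u))) (H.cop.op.d1 x z) := by
      induction H.cop.op.d1 x z with
      | zero => simp
      | add x y hx hy => simp only [map_add, hx, hy]
      | tmul r s =>
        simp only [TensorProduct.map_tmul, TensorProduct.lift.tmul, LinearMap.flip_apply,
          LinearMap.compr₂_apply, LinearMap.comp_apply, TensorProduct.mk_apply, hA.bimodule]
        rw [hν, (hA.ract_colinear s).right]
        induction gR b u with
        | zero => simp
        | add x y hx hy => simp only [map_add, hx, hy, LinearMap.add_apply]
        | tmul p c => simp
    -- The right action commutes with Γ and ▷, so both sides are now linear in gR(b, u). On p ⊗ c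
    -- the claim is the module algebra law for the original product.
    rw [h1]
    induction gR b u with
    | zero =>
      simp only [map_zero]
      exact TensorProduct.induction_on (H.cop.op.d1 x z) (by simp) (fun _ _ => by simp)
        fun _ _ hx hy => by simp only [map_add, ← hx, ← hy, add_zero]
    | add s t hs ht =>
      simp only [map_add, hs, ht]
      induction H.cop.op.d1 x z with
      | zero => simp
      | add x y hx hy => simp only [map_add, ← hx, ← hy]; abel
      | tmul r s => simp
    | tmul p c =>
      rw [LinearMap.lTensor_tmul, evalAct_tmul, ← LinearMap.flip_apply μ,
        hA.right.modAlg.act_mul1]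
      induction H.cop.op.d1 x z with
      | zero => simp
      | add x y hx hy => simp only [map_add, hx, hy]
      | tmul r s => simp [hA.bimodule]

/-- Υ is multiplicative for `μ`, commutes with ▷ and commutes with Γ; hence it passes through every
ingredient of a₀(a₍₋₁₎ ▷ b). -/
theorem coactionMul_twist (hA : IsCoveredFourSided H μ act ract gR gL rR rL)
    (hν : IsTwist μ act gR ν) : IsCoactionMul ν rR rL := by
  have hm : IsCoactionMul μ rR rL := hA.right.coactMul.flip
  have hev : ∀ x c, ν.flip (act x c) = evalAct μ act c ∘ₗ gR.flip x :=
    fun x c => LinearMap.ext fun a => hν a x c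
  constructor
  · intro a b y
    have : rR.flip y ∘ₗ ν a = coactMul ν rR a ∘ₗ rR.flip y := by
      refine hA.left.modAlg.ext fun x b => ?_
      simp only [LinearMap.comp_apply, LinearMap.flip_apply]
      rw [hν, IsCoveredLong.coact_evalAct hm.right fun x => (hA.act_colinear x).right,
        (hA.act_colinear x).right]
      induction rR b y with
      | zero => simp
      | add s t hs ht => simp only [map_add, hs, ht]
      | tmul p c =>
        rw [IsCoveredLong.twistCoact_tmul, evalIter_eq, ← hA.commute_right_right.symm,
          LinearMap.lTensor_tmul, coactMul_tmul, hev, LinearMap.lTensor_comp_apply]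
    exact LinearMap.congr_fun this b
  · intro a b y
    let ω : A → Q ⊗[k] (Q ⊗[k] A) →ₗ[k] Q ⊗[k] A := fun b =>
      TensorProduct.lift (((LinearMap.lTensorHom Q ∘ₗ TensorProduct.lift (mulAct μ act)).flip ∘ₗ
        rL b))
    have hω : ∀ b p t, ω b (p ⊗ₜ t) = (TensorProduct.lift (mulAct μ act) t).lTensor Q (rL b p) :=
      fun b p t => rfl
    have hev' : ∀ c x, ν c ∘ₗ act x = TensorProduct.lift (mulAct μ act) (gR c x) := by
      intro c x
      ext b
      rw [LinearMap.comp_apply, hν]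
      induction gR c x with
      | zero => simp
      | add s t hs ht => simp only [map_add, hs, ht, LinearMap.add_apply]
      | tmul p c => simp
    obtain ⟨s, rfl⟩ := hA.left.modAlg.surj b
    induction s with
    | zero =>
      have : coactMul ν.flip rL 0 = 0 := TensorProduct.ext' fun _ _ => by simp
      simp [this]
    | add s t hs ht =>
      have : ∀ b c, coactMul ν.flip rL (b + c) = coactMul ν.flip rL b + coactMul ν.flip rL c :=
        fun b c => TensorProduct.ext' fun _ _ => by simp
      simp only [map_add, LinearMap.add_apply, hs, ht, this]
    | tmul x b =>
      rw [TensorProduct.lift.tmul, hν]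
      -- Both sides are `ω b` of a twofold coaction of a, with Γ taken first in one and Υ first in
      -- the other; the commutation of the coactions identifies them.
      trans ω b (TensorProduct.leftComm k Q Q A ((rL.flip y).lTensor Q (gR a x)))
      · induction gR a x with
        | zero => simp
        | add s t hs ht => simp only [map_add, LinearMap.add_apply, hs, ht]
        | tmul q c =>
          rw [evalAct_tmul, hm.left, LinearMap.lTensor_tmul, LinearMap.flip_apply]
          induction rL c y with
          | zero => simp
          | add s t hs ht => simp only [map_add, hs, ht, TensorProduct.tmul_add]
          | tmul p d =>
            rw [coactMul_tmul, (hA.act_colinear q).left, ← LinearMap.lTensor_comp_apply,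
              TensorProduct.leftComm_tmul, hω]
            simp [LinearMap.flip_flip]
      · rw [← hA.commute_right_left.symm]
        induction rL a y with
        | zero => simp
        | add s t hs ht => simp only [map_add, hs, ht]
        | tmul p c =>
          rw [coactMul_tmul, (hA.act_colinear x).left, ← LinearMap.lTensor_comp_apply,
            LinearMap.lTensor_tmul, hω, LinearMap.flip_flip, hev', LinearMap.flip_apply]

theorem evalAct_twist (hA : IsCoveredFourSided H μ act ract gR gL rR rL)
    (hν : IsTwist μ act gR ν) (a b : A) (y z : Q) :
    evalAct ν.flip ract a (rL (act z b) y) = evalLR μ act ract (gR a z) (rL b y) := by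
  rw [(hA.act_colinear z).left]
  induction rL b y with
  | zero => simp
  | add s t hs ht => simp only [map_add, hs, ht]
  | tmul p c =>
    rw [LinearMap.lTensor_tmul, evalAct_tmul, LinearMap.flip_apply, hν,
      (hA.ract_colinear p).right]
    induction gR a z with
    | zero => simp
    | add s t hs ht => simp only [map_add, hs, ht, LinearMap.add_apply]
    | tmul q d => simp

/-- The L-R-twisted product is the right twisted product of the left twisted product. -/
theorem isLRTwist_iff (hA : IsCoveredFourSided H μ act ract gR gL rR rL)
    (hν : IsTwist μ act gR ν) (lr : A →ₗ[k] A →ₗ[k] A) :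
    IsLRTwist μ act ract gR rL lr ↔ IsTwist ν.flip ract rL lr.flip := by
  constructor
  · intro h b y a
    have e : lr (ract y a) = evalAct ν.flip ract a ∘ₗ rL.flip y :=
      hA.left.modAlg.ext fun z b => by
        rw [h, LinearMap.comp_apply, LinearMap.flip_apply, hA.evalAct_twist hν]
    exact LinearMap.congr_fun e b
  · intro h a y z b
    rw [← hA.evalAct_twist hν]
    exact h _ _ _

end IsCoveredFourSided
end FourSided

/-! ### Multipliers of tensor products -/

section Multipliers

variable {k V W : Type*} [Field k] [AddCommGroup V] [Module k V] [AddCommGroup W] [Module k W]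
  {μ : V →ₗ[k] V →ₗ[k] V} {ν : W →ₗ[k] W →ₗ[k] W}

theorem tensorProd_tmul_left (a : V) (b : W) (t : V ⊗[k] W) :
    tensorProd μ ν (a ⊗ₜ b) t = (μ a).rTensor W ((ν b).lTensor V t) := by
  rw [tensorProd, TensorProduct.map₂_apply_tmul, ← LinearMap.comp_apply,
    LinearMap.rTensor_comp_lTensor]

theorem tensorProd_flip (s t : V ⊗[k] W) :
    tensorProd μ.flip ν.flip s t = tensorProd μ ν t s := by
  induction s with
  | zero => simp
  | add x y hx hy => simp only [map_add, hx, hy, LinearMap.add_apply]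
  | tmul a b =>
    induction t with
    | zero => simp
    | add x y hx hy => simp only [map_add, hx, hy, LinearMap.add_apply]
    | tmul c d => simp [tensorProd]

theorem tensorProd_tmul_right (a : V) (b : W) (t : V ⊗[k] W) :
    tensorProd μ ν t (a ⊗ₜ b) = (μ.flip a).rTensor W ((ν.flip b).lTensor V t) := by
  rw [← tensorProd_flip, tensorProd_tmul_left]

theorem tensorProd_comm (s t : V ⊗[k] W) :
    tensorProd ν μ (TensorProduct.comm k V W s) (TensorProduct.comm k V W t) =
      TensorProduct.comm k V W (tensorProd μ ν s t) := by
  induction s with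
  | zero => simp
  | add x y hx hy => simp only [map_add, hx, hy, LinearMap.add_apply]
  | tmul a b =>
    induction t with
    | zero => simp
    | add x y hx hy => simp only [map_add, hx, hy]
    | tmul c d => simp [tensorProd]

/-- Multiplying by pure tensors and cancelling one leg at a time reduces this to nondegeneracy of
each factor. -/
theorem tensorProd_nondeg_left (hμ : IsAlg μ) (hν : IsAlg ν) {s s' : V ⊗[k] W}
    (h : ∀ t, tensorProd μ ν s t = tensorProd μ ν s' t) : s = s' := by
  rw [← sub_eq_zero]
  refine eq_zero_of_lTensor ν.flip (fun x hx => hν.nondeg_left x hx) _ fun b => ?_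
  refine eq_zero_of_rTensor μ.flip (fun x hx => hμ.nondeg_left x hx) _ fun a => ?_
  rw [← tensorProd_tmul_right, map_sub, LinearMap.sub_apply, h, sub_self]

theorem tensorProd_nondeg_right (hμ : IsAlg μ) (hν : IsAlg ν) {s s' : V ⊗[k] W}
    (h : ∀ t, tensorProd μ ν t s = tensorProd μ ν t s') : s = s' :=
  tensorProd_nondeg_left hμ.flip hν.flip fun t => by
    rw [tensorProd_flip, tensorProd_flip, h]

theorem tensorProd_mul_rTensor (hμ : IsAlg μ) (a : V) (s t : V ⊗[k] W) :
    tensorProd μ ν ((μ a).rTensor W s) t = (μ a).rTensor W (tensorProd μ ν s t) := by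
  induction s with
  | zero => simp
  | add x y hx hy => simp only [map_add, hx, hy, LinearMap.add_apply]
  | tmul c d =>
    rw [LinearMap.rTensor_tmul, tensorProd_tmul_left, tensorProd_tmul_left, hμ.mul_comp,
      LinearMap.rTensor_comp_apply]

theorem tensorProd_mul_lTensor (hν : IsAlg ν) (b : W) (s t : V ⊗[k] W) :
    tensorProd μ ν ((ν b).lTensor V s) t = (ν b).lTensor V (tensorProd μ ν s t) := by
  induction s with
  | zero => simp
  | add x y hx hy => simp only [map_add, hx, hy, LinearMap.add_apply]
  | tmul c d =>
    rw [LinearMap.lTensor_tmul, tensorProd_tmul_left, tensorProd_tmul_left, hν.mul_comp,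
      LinearMap.lTensor_comp_apply, rTensor_lTensor]

theorem tensorProd_rTensor_middle (hμ : IsAlg μ) (a : V) (s t : V ⊗[k] W) :
    tensorProd μ ν ((μ.flip a).rTensor W s) t = tensorProd μ ν s ((μ a).rTensor W t) := by
  induction s with
  | zero => simp
  | add x y hx hy => simp only [map_add, hx, hy, LinearMap.add_apply]
  | tmul c d =>
    rw [LinearMap.rTensor_tmul, tensorProd_tmul_left, tensorProd_tmul_left, ← rTensor_lTensor,
      LinearMap.flip_apply, hμ.mul_comp, LinearMap.rTensor_comp_apply]

theorem tensorProd_lTensor_middle (hν : IsAlg ν) (b : W) (s t : V ⊗[k] W) :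
    tensorProd μ ν ((ν.flip b).lTensor V s) t = tensorProd μ ν s ((ν b).lTensor V t) := by
  induction s with
  | zero => simp
  | add x y hx hy => simp only [map_add, hx, hy, LinearMap.add_apply]
  | tmul c d =>
    rw [LinearMap.lTensor_tmul, tensorProd_tmul_left, tensorProd_tmul_left,
      LinearMap.flip_apply, hν.mul_comp, LinearMap.lTensor_comp_apply]

theorem tensorProd_assoc (hμ : IsAlg μ) (hν : IsAlg ν) (s t u : V ⊗[k] W) :
    tensorProd μ ν (tensorProd μ ν s t) u = tensorProd μ ν s (tensorProd μ ν t u) := by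
  induction s with
  | zero => simp
  | add x y hx hy => simp only [map_add, hx, hy, LinearMap.add_apply]
  | tmul c d =>
    rw [tensorProd_tmul_left, tensorProd_tmul_left, tensorProd_mul_rTensor hμ,
      tensorProd_mul_lTensor hν]

theorem tensorProd_isAlg (hμ : IsAlg μ) (hν : IsAlg ν) : IsAlg (tensorProd μ ν) where
  assoc := tensorProd_assoc hμ hν
  nondeg_left a h := tensorProd_nondeg_left hμ hν fun t => by simp [h t]
  nondeg_right a h := tensorProd_nondeg_right hμ hν fun t => by simp [h t]

theorem mul_onMul (m : multiplierAlgebra μ) (a b : V) : μ (onMul m a) b = μ a (mulOn m b) :=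
  m.2 a b

/-- A multiplier is only required to satisfy the exchange law; nondegeneracy makes its left
operation a right module map. -/
theorem mulOn_mul (hμ : IsAlg μ) (m : multiplierAlgebra μ) (a b : V) :
    mulOn m (μ a b) = μ (mulOn m a) b := by
  rw [← sub_eq_zero]
  refine hμ.nondeg_right _ fun c => ?_
  rw [map_sub, ← mul_onMul, ← hμ.assoc, mul_onMul, hμ.assoc, sub_self]

theorem onMul_mul (hμ : IsAlg μ) (m : multiplierAlgebra μ) (a b : V) :
    onMul m (μ a b) = μ a (onMul m b) := by
  rw [← sub_eq_zero]
  refine hμ.nondeg_left _ fun c => ?_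
  rw [map_sub, LinearMap.sub_apply, mul_onMul, hμ.assoc, hμ.assoc, mul_onMul, sub_self]

theorem multiplier_ext {m n : multiplierAlgebra μ} (h1 : mulOn m = mulOn n)
    (h2 : onMul m = onMul n) : m = n :=
  Subtype.ext (Prod.ext h1 (MulOpposite.unop_injective h2))

theorem mulOn_eq_zero_iff (hμ : IsAlg μ) (m : multiplierAlgebra μ) :
    mulOn m = 0 ↔ onMul m = 0 := by
  constructor
  · intro h
    ext a
    refine hμ.nondeg_left _ fun b => ?_
    rw [mul_onMul, h, LinearMap.zero_apply, map_zero]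
  · intro h
    ext a
    refine hμ.nondeg_right _ fun b => ?_
    rw [← mul_onMul, h, LinearMap.zero_apply, map_zero, LinearMap.zero_apply]

/-- Transport of pairs of linear maps along the flip `V ⊗ W ≃ W ⊗ V`. -/
def swapPair (m : LinPair k (V ⊗[k] W)) : LinPair k (W ⊗[k] V) :=
  ((TensorProduct.comm k V W).toLinearMap ∘ₗ m.1 ∘ₗ (TensorProduct.comm k W V).toLinearMap,
    MulOpposite.op ((TensorProduct.comm k V W).toLinearMap ∘ₗ m.2.unop ∘ₗ
      (TensorProduct.comm k W V).toLinearMap))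

theorem swapPair_swapPair (m : LinPair k (V ⊗[k] W)) : swapPair (swapPair m) = m := by
  refine Prod.ext (LinearMap.ext fun t => ?_) (MulOpposite.unop_injective
    (LinearMap.ext fun t => ?_)) <;> simp [swapPair]

theorem swapPair_injective : Function.Injective (swapPair (k := k) (V := V) (W := W)) :=
  Function.LeftInverse.injective swapPair_swapPair

theorem swapPair_mul (m n : LinPair k (V ⊗[k] W)) :
    swapPair (m * n) = swapPair m * swapPair n := by
  refine Prod.ext (LinearMap.ext fun t => ?_) (MulOpposite.unop_injective
    (LinearMap.ext fun t => ?_)) <;> simp [swapPair]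

theorem swapPair_secondLeg (w : W) : swapPair (secondLeg V ν w) = firstLeg V ν w := by
  refine Prod.ext (LinearMap.ext fun t => ?_) (MulOpposite.unop_injective
    (LinearMap.ext fun t => ?_)) <;> simp [swapPair, secondLeg, firstLeg, ← LinearMap.rTensor_comm]

theorem swapPair_ofElem (s : V ⊗[k] W) : swapPair (ofElem (tensorProd μ ν) s) =
    ofElem (tensorProd ν μ) (TensorProduct.comm k V W s) := by
  refine Prod.ext (LinearMap.ext fun t => ?_) (MulOpposite.unop_injective
    (LinearMap.ext fun t => ?_)) <;> simp [swapPair, ofElem, ← tensorProd_comm]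

/-- Transport of multipliers along the flip `V ⊗ W ≃ W ⊗ V`. -/
def swapMultiplier : multiplierAlgebra (tensorProd μ ν) →ₗ[k]
    multiplierAlgebra (tensorProd ν μ) where
  toFun m := ⟨swapPair m, by
    intro s t
    obtain ⟨s, rfl⟩ := (TensorProduct.comm k V W).surjective s
    obtain ⟨t, rfl⟩ := (TensorProduct.comm k V W).surjective t
    have hc : ∀ r, TensorProduct.comm k W V (TensorProduct.comm k V W r) = r :=
      (TensorProduct.comm k V W).symm_apply_apply
    simp only [swapPair, MulOpposite.unop_op, LinearMap.comp_apply, LinearEquiv.coe_coe, hc,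
      tensorProd_comm]
    exact congrArg _ (mul_onMul m s t)⟩
  map_add' m n := by
    refine Subtype.ext (Prod.ext (LinearMap.ext fun t => ?_) (MulOpposite.unop_injective
      (LinearMap.ext fun t => ?_))) <;> simp [swapPair]
  map_smul' r m := by
    refine Subtype.ext (Prod.ext (LinearMap.ext fun t => ?_) (MulOpposite.unop_injective
      (LinearMap.ext fun t => ?_))) <;> simp [swapPair]

theorem swapMultiplier_swapMultiplier (m : multiplierAlgebra (tensorProd μ ν)) :
    swapMultiplier (swapMultiplier m) = m :=
  Subtype.ext (swapPair_swapPair _)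

theorem swapMultiplier_injective :
    Function.Injective (swapMultiplier (k := k) (μ := μ) (ν := ν)) :=
  Function.LeftInverse.injective swapMultiplier_swapMultiplier

theorem swapMultiplier_mul (m n : multiplierAlgebra (tensorProd μ ν)) :
    swapMultiplier (m * n) = swapMultiplier m * swapMultiplier n :=
  Subtype.ext (swapPair_mul _ _)

theorem mul_secondLeg_iff (m : multiplierAlgebra (tensorProd μ ν)) (w : W) (s : V ⊗[k] W) :
    (m : LinPair k (V ⊗[k] W)) * secondLeg V ν w = ofElem (tensorProd μ ν) s ↔
      (swapMultiplier m : LinPair k (W ⊗[k] V)) * firstLeg V ν w =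
        ofElem (tensorProd ν μ) (TensorProduct.comm k V W s) := by
  rw [← swapPair_injective.eq_iff, swapPair_mul, swapPair_secondLeg, swapPair_ofElem]
  rfl

theorem secondLeg_mul_iff (m : multiplierAlgebra (tensorProd μ ν)) (w : W) (s : V ⊗[k] W) :
    secondLeg V ν w * (m : LinPair k (V ⊗[k] W)) = ofElem (tensorProd μ ν) s ↔
      firstLeg V ν w * (swapMultiplier m : LinPair k (W ⊗[k] V)) =
        ofElem (tensorProd ν μ) (TensorProduct.comm k V W s) := by
  rw [← swapPair_injective.eq_iff, swapPair_mul, swapPair_secondLeg, swapPair_ofElem]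
  rfl

end Multipliers

/-! ### Covered comultiplications of a regular multiplier Hopf algebra -/

section Realize

variable {k Q : Type*} [Field k] [NonUnitalRing Q] [Module k Q] [IsScalarTower k Q Q]
  [SMulCommClass k Q Q]

/-- The covered comultiplications `H` are those of `Δ`. -/
structure Realizes (Δ : Q →ₙₐ[k] MTensor k Q) (H : CoverData k Q) : Prop where
  mul : H.mul = LinearMap.mul k Q
  d1 : ∀ x y t, tensorProd H.mul H.mul (H.d1 x y) t = mulOn (Δ x) ((H.mul y).lTensor Q t)
  d2 : ∀ x y t, tensorProd H.mul H.mul (H.d2 x y) t = (H.mul y).rTensor Q (mulOn (Δ x) t)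
  d3 : ∀ x y t, tensorProd H.mul H.mul (H.d3 x y) t = mulOn (Δ x) ((H.mul y).rTensor Q t)
  d4 : ∀ x y t, tensorProd H.mul H.mul (H.d4 x y) t = (H.mul y).lTensor Q (mulOn (Δ x) t)
  bij1 : Function.Bijective (TensorProduct.lift H.d1)
  bij2 : Function.Bijective (TensorProduct.lift H.d2)
  bij3 : Function.Bijective (TensorProduct.lift H.d3)
  bij4 : Function.Bijective (TensorProduct.lift H.d4)
  coassoc12 : ∀ x y z, TensorProduct.assoc k Q Q Q ((H.d2.flip y).rTensor Q (H.d1 x z)) =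
    (H.d1.flip z).lTensor Q (H.d2 x y)
  coassoc34 : ∀ x y z, TensorProduct.assoc k Q Q Q ((H.d3.flip y).rTensor Q (H.d4 x z)) =
    (H.d4.flip z).lTensor Q (H.d3 x y)

namespace Realizes

variable {Δ : Q →ₙₐ[k] MTensor k Q} {H : CoverData k Q}

theorem mul_onMul (hr : Realizes Δ H) (x : Q) (s t : Q ⊗[k] Q) :
    tensorProd H.mul H.mul (onMul (Δ x) s) t = tensorProd H.mul H.mul s (mulOn (Δ x) t) := by
  rw [hr.mul]
  exact TwistedAlg.mul_onMul _ _ _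

theorem mulOn_mul (hr : Realizes Δ H) (hm : IsAlg H.mul) (x : Q) (s t : Q ⊗[k] Q) :
    mulOn (Δ x) (tensorProd H.mul H.mul s t) = tensorProd H.mul H.mul (mulOn (Δ x) s) t := by
  rw [hr.mul] at hm ⊢
  exact TwistedAlg.mulOn_mul (tensorProd_isAlg hm hm) _ _ _

theorem mulOn_map_mul (hr : Realizes Δ H) (x y : Q) (t : Q ⊗[k] Q) :
    mulOn (Δ (H.mul x y)) t = mulOn (Δ x) (mulOn (Δ y) t) := by
  rw [hr.mul, LinearMap.mul_apply', map_mul]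
  rfl

theorem comulR_mul (hr : Realizes Δ H) (hm : IsAlg H.mul) (x : Q) (s t : Q ⊗[k] Q) :
    tensorProd H.mul H.mul (H.comulR x s) t = mulOn (Δ x) (tensorProd H.mul H.mul s t) := by
  induction s with
  | zero => simp
  | add x y hx hy => simp only [map_add, hx, hy, LinearMap.add_apply]
  | tmul p q =>
    rw [CoverData.comulR_tmul, tensorProd_rTensor_middle hm, hr.d1, tensorProd_tmul_left,
      rTensor_lTensor]

theorem comulL_mul (hr : Realizes Δ H) (hm : IsAlg H.mul) (x : Q) (s t : Q ⊗[k] Q) :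
    tensorProd H.mul H.mul (H.comulL x s) t = tensorProd H.mul H.mul s (mulOn (Δ x) t) := by
  induction s with
  | zero => simp
  | add x y hx hy => simp only [map_add, hx, hy, LinearMap.add_apply]
  | tmul p q =>
    rw [CoverData.comulL_tmul, tensorProd_mul_rTensor hm, hr.d4, tensorProd_tmul_left]

theorem mulOn_eq (hr : Realizes Δ H) (hm : IsAlg H.mul) (x : Q) (t : Q ⊗[k] Q) :
    mulOn (Δ x) t = H.comulR x t :=
  tensorProd_nondeg_left hm hm fun s => by rw [hr.comulR_mul hm, hr.mulOn_mul hm]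

theorem onMul_eq (hr : Realizes Δ H) (hm : IsAlg H.mul) (x : Q) (t : Q ⊗[k] Q) :
    onMul (Δ x) t = H.comulL x t :=
  tensorProd_nondeg_left hm hm fun s => by rw [hr.comulL_mul hm, hr.mul_onMul]

/-- Once multiplied on the right by an arbitrary tensor, each pointwise law becomes an identity
about the operators Δ(x), and nondegeneracy removes the tensor. -/
theorem isRegular (hr : Realizes Δ H) (hm : IsAlg H.mul) : H.IsRegular where
  alg := hm
  d1_d3 x y z := tensorProd_nondeg_left hm hm fun t => by
    rw [tensorProd_rTensor_middle hm, tensorProd_lTensor_middle hm, hr.d1, hr.d3, rTensor_lTensor]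
  d4_d2 x y z := tensorProd_nondeg_left hm hm fun t => by
    rw [tensorProd_mul_rTensor hm, tensorProd_mul_lTensor hm, hr.d2, hr.d4, rTensor_lTensor]
  d1_d2 x y z := tensorProd_nondeg_left hm hm fun t => by
    rw [tensorProd_mul_rTensor hm, tensorProd_lTensor_middle hm, hr.d1, hr.d2]
  d3_d4 x y z := tensorProd_nondeg_left hm hm fun t => by
    rw [tensorProd_rTensor_middle hm, tensorProd_mul_lTensor hm, hr.d3, hr.d4]
  d1_mul x y z := tensorProd_nondeg_left hm hm fun t => by
    rw [hr.comulR_mul hm, hr.d1, hr.d1, hr.mulOn_map_mul]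
  d2_mul x y z := tensorProd_nondeg_left hm hm fun t => by
    rw [hr.comulL_mul hm, hr.d2, hr.d2, hr.mulOn_map_mul]
  d3_mul x y z := tensorProd_nondeg_left hm hm fun t => by
    rw [hr.comulR_mul hm, hr.d3, hr.d3, hr.mulOn_map_mul]
  d4_mul x y z := tensorProd_nondeg_left hm hm fun t => by
    rw [hr.comulL_mul hm, hr.d4, hr.d4, hr.mulOn_map_mul]
  bij1 := hr.bij1
  bij2 := hr.bij2
  bij3 := hr.bij3
  bij4 := hr.bij4
  coassoc12 := hr.coassoc12
  coassoc34 := hr.coassoc34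

theorem cop (hr : Realizes Δ H) {Δ' : Q →ₙₐ[k] MTensor k Q} (h : H.cop.IsRegular)
    (hΔ : ∀ x, Δ' x = flipMultiplier (Δ x)) : Realizes Δ' H.cop where
  mul := hr.mul
  d1 x y t := by
    obtain ⟨t, rfl⟩ := (TensorProduct.comm k Q Q).surjective t
    rw [LinearMap.lTensor_comm]
    refine (tensorProd_comm _ _).trans ((congrArg _ (hr.d3 x y t)).trans ?_)
    rw [hΔ]
    exact congrArg (fun s => TensorProduct.comm k Q Q (mulOn (Δ x) s))
      ((TensorProduct.comm k Q Q).symm_apply_apply _).symm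
  d2 x y t := by
    obtain ⟨t, rfl⟩ := (TensorProduct.comm k Q Q).surjective t
    refine (tensorProd_comm _ _).trans ((congrArg _ (hr.d4 x y t)).trans ?_)
    rw [hΔ, ← LinearMap.rTensor_comm]
    exact congrArg (fun s => (H.mul y).rTensor Q (TensorProduct.comm k Q Q (mulOn (Δ x) s)))
      ((TensorProduct.comm k Q Q).symm_apply_apply _).symm
  d3 x y t := by
    obtain ⟨t, rfl⟩ := (TensorProduct.comm k Q Q).surjective t
    change _ = mulOn _ ((H.mul y).rTensor Q _)
    rw [LinearMap.rTensor_comm]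
    refine (tensorProd_comm _ _).trans ((congrArg _ (hr.d1 x y t)).trans ?_)
    rw [hΔ]
    exact congrArg (fun s => TensorProduct.comm k Q Q (mulOn (Δ x) s))
      ((TensorProduct.comm k Q Q).symm_apply_apply _).symm
  d4 x y t := by
    obtain ⟨t, rfl⟩ := (TensorProduct.comm k Q Q).surjective t
    refine (tensorProd_comm _ _).trans ((congrArg _ (hr.d2 x y t)).trans ?_)
    rw [hΔ, ← LinearMap.lTensor_comm]
    exact congrArg (fun s => (H.mul y).lTensor Q (TensorProduct.comm k Q Q (mulOn (Δ x) s)))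
      ((TensorProduct.comm k Q Q).symm_apply_apply _).symm
  bij1 := h.bij1
  bij2 := h.bij2
  bij3 := h.bij3
  bij4 := h.bij4
  coassoc12 := h.coassoc12
  coassoc34 := h.coassoc34

end Realizes

namespace IsComultiplication

variable {Δ : Q →ₙₐ[k] MTensor k Q} {T₁ T₂ : Q ⊗[k] Q →ₗ[k] Q ⊗[k] Q}

theorem mul_left (hΔ : IsComultiplication Δ T₁ T₂) (x y : Q) (t : Q ⊗[k] Q) :
    tensorProd (LinearMap.mul k Q) (LinearMap.mul k Q) (T₁ (x ⊗ₜ y)) t =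
      mulOn (Δ x) ((LinearMap.mul k Q y).lTensor Q t) :=
  LinearMap.congr_fun (congrArg Prod.fst (hΔ.cover₁ x y)) t

theorem mul_right (hΔ : IsComultiplication Δ T₁ T₂) (x y : Q) (t : Q ⊗[k] Q) :
    tensorProd (LinearMap.mul k Q) (LinearMap.mul k Q) (T₂ (x ⊗ₜ y)) t =
      (LinearMap.mul k Q x).rTensor Q (mulOn (Δ y) t) :=
  LinearMap.congr_fun (congrArg Prod.fst (hΔ.cover₂ x y)) t

theorem coassoc_curry (hΔ : IsComultiplication Δ T₁ T₂) (x y z : Q) :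
    TensorProduct.assoc k Q Q Q (((TensorProduct.curry T₂) y).rTensor Q (T₁ (x ⊗ₜ z))) =
      ((TensorProduct.curry T₁).flip z).lTensor Q (T₂ (y ⊗ₜ x)) := by
  have h := congrArg (TensorProduct.assoc k Q Q Q) (hΔ.coassoc y x z)
  rw [LinearEquiv.apply_symm_apply] at h
  convert h using 2
  · induction T₁ (x ⊗ₜ z) with
    | zero => simp
    | add s t hs ht => simp only [map_add, hs, ht, TensorProduct.tmul_add]
    | tmul p q => simp
  · induction T₂ (y ⊗ₜ x) with
    | zero => simp
    | add s t hs ht => simp only [map_add, hs, ht, TensorProduct.add_tmul]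
    | tmul p q => simp

end IsComultiplication

/-- The covers `d1` and `d2` come from the canonical maps of Δ; `d3` and `d4` come from those of the
flipped coproduct, with their legs flipped back. -/
theorem IsRegularMultiplierHopf.exists_realizes {Δ : Q →ₙₐ[k] MTensor k Q}
    (h : IsRegularMultiplierHopf Δ) : ∃ (H : CoverData k Q) (Δ' : Q →ₙₐ[k] MTensor k Q),
      (∀ x, Δ' x = flipMultiplier (Δ x)) ∧ H.IsRegular ∧ Realizes Δ H ∧ Realizes Δ' H.cop := by
  obtain ⟨⟨hm, T₁, T₂, hT, hb₁, hb₂⟩, Δ', hΔ', -, S₁, S₂, hS, hc₁, hc₂⟩ := h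
  let c := (TensorProduct.comm k Q Q).toLinearMap
  have hcc : ∀ d : Q →ₗ[k] Q →ₗ[k] Q ⊗[k] Q, (d.compr₂ c).compr₂ c = d := by
    intro d
    ext x y
    simp [c]
  let H : CoverData k Q := ⟨LinearMap.mul k Q, TensorProduct.curry T₁,
    (TensorProduct.curry T₂).flip, (TensorProduct.curry S₁).compr₂ c,
    (TensorProduct.curry S₂).flip.compr₂ c⟩
  have hcop : H.cop.d1 = TensorProduct.curry S₁ := hcc _
  have hcop' : H.cop.d2 = (TensorProduct.curry S₂).flip := hcc _
  have hflip : ∀ x t, mulOn (Δ' x) t = TensorProduct.comm k Q Q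
      (mulOn (Δ x) (TensorProduct.comm k Q Q t)) := fun x t => by rw [hΔ']; rfl
  have hr : Realizes Δ H :=
    { mul := rfl
      d1 := hT.mul_left
      d2 := fun x y t => hT.mul_right y x t
      d3 := fun x y t => by
        obtain ⟨t, rfl⟩ := (TensorProduct.comm k Q Q).surjective t
        refine (tensorProd_comm _ _).trans ?_
        refine (congrArg (TensorProduct.comm k Q Q) (hS.mul_left x y t)).trans ?_
        rw [hflip, LinearMap.rTensor_comm]
        exact (TensorProduct.comm k Q Q).symm_apply_apply _
      d4 := fun x y t => by
        obtain ⟨t, rfl⟩ := (TensorProduct.comm k Q Q).surjective t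
        refine (tensorProd_comm _ _).trans ?_
        refine (congrArg (TensorProduct.comm k Q Q) (hS.mul_right y x t)).trans ?_
        rw [hflip, LinearMap.rTensor_comm]
        exact (TensorProduct.comm k Q Q).symm_apply_apply _
      bij1 := CoverData.lift_curry_bijective hb₁
      bij2 := CoverData.lift_curry_flip_bijective hb₂
      bij3 := CoverData.lift_compr₂_comm_bijective (CoverData.lift_curry_bijective hc₁)
      bij4 := CoverData.lift_compr₂_comm_bijective (CoverData.lift_curry_flip_bijective hc₂)
      coassoc12 := fun x y z => hT.coassoc_curry x y z
      coassoc34 := fun x y z => by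
        have h := congrArg (CoverData.reverse k Q Q Q) (hS.coassoc_curry x z y)
        rw [CoverData.reverse_assoc, CoverData.reverse_lTensor] at h
        exact h.symm }
  have hreg := hr.isRegular hm
  exact ⟨H, Δ', hΔ', hreg, hr, hr.cop hreg.cop hΔ'⟩

end Realize

section Tensor

variable {k P Q R V W : Type*} [Field k] [AddCommGroup P] [Module k P] [AddCommGroup Q] [Module k Q]
  [AddCommGroup R] [Module k R] [AddCommGroup V] [Module k V] [AddCommGroup W] [Module k W]

theorem lTensor_rTensor_assoc (f : R →ₗ[k] W) (g : P →ₗ[k] Q ⊗[k] R) (t : P ⊗[k] V) :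
    (f.rTensor V).lTensor Q (TensorProduct.assoc k Q R V (g.rTensor V t)) =
      TensorProduct.assoc k Q W V ((f.lTensor Q ∘ₗ g).rTensor V t) := by
  induction t with
  | zero => simp
  | add x y hx hy => simp only [map_add, hx, hy]
  | tmul p v =>
    simp only [LinearMap.rTensor_tmul, LinearMap.comp_apply]
    induction g p with
    | zero => simp
    | add x y hx hy => simp only [map_add, hx, hy, TensorProduct.add_tmul]
    | tmul p q => simp

end Tensor

theorem CoverData.IsRegular.cancel_middle {k Q V W : Type*} [Field k] [AddCommGroup Q] [Module k Q]
    [AddCommGroup V] [Module k V] [AddCommGroup W] [Module k W] {H : CoverData k Q}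
    (h : H.IsRegular) {s t : W ⊗[k] (Q ⊗[k] V)}
    (hst : ∀ w, ((H.mul.flip w).rTensor V).lTensor W s = ((H.mul.flip w).rTensor V).lTensor W t) :
    s = t := by
  rw [← sub_eq_zero]
  refine eq_zero_of_lTensor (fun w => (H.mul.flip w).rTensor V) (fun x hx => ?_) _ fun w => ?_
  · exact h.cancel_flip fun w => by rw [hx, map_zero]
  · rw [map_sub, hst, sub_self]

/-! ### Left comodule algebras in covered form -/

section Covered

variable {k Q A : Type*} [Field k] [AddCommGroup Q] [Module k Q] [AddCommGroup A] [Module k A]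
  {H : CoverData k Q} {μ : A →ₗ[k] A →ₗ[k] A} {gR gL : A →ₗ[k] Q →ₗ[k] Q ⊗[k] A}

theorem coactMul_add (μ : A →ₗ[k] A →ₗ[k] A) (g : A →ₗ[k] Q →ₗ[k] Q ⊗[k] A) (a b : A) :
    coactMul μ g (a + b) = coactMul μ g a + coactMul μ g b :=
  TensorProduct.ext' fun _ _ => by simp

theorem coactMul_smul (μ : A →ₗ[k] A →ₗ[k] A) (g : A →ₗ[k] Q →ₗ[k] Q ⊗[k] A) (r : k) (a : A) :
    coactMul μ g (r • a) = r • coactMul μ g a :=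
  TensorProduct.ext' fun _ _ => by simp

theorem coactMul_lTensor_flip (hμ : IsAlg μ) (a c : A) (t : Q ⊗[k] A) :
    coactMul μ gR a ((μ.flip c).lTensor Q t) = (μ.flip c).lTensor Q (coactMul μ gR a t) := by
  induction t with
  | zero => simp
  | add x y hx hy => simp only [map_add, hx, hy]
  | tmul p d =>
    rw [LinearMap.lTensor_tmul, coactMul_tmul, coactMul_tmul, LinearMap.flip_apply,
      hμ.flip_mul_comp, LinearMap.lTensor_comp_apply]

theorem coactMul_mul (hμ : IsAlg μ) (hg : ∀ a b y, gR (μ a b) y = coactMul μ gR a (gR b y))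
    (a b : A) (t : Q ⊗[k] A) :
    coactMul μ gR (μ a b) t = coactMul μ gR a (coactMul μ gR b t) := by
  induction t with
  | zero => simp
  | add x y hx hy => simp only [map_add, hx, hy]
  | tmul p d => rw [coactMul_tmul, coactMul_tmul, hg, coactMul_lTensor_flip hμ]

theorem coactMul_rTensor (h : H.IsRegular)
    (hg : ∀ a x y, (H.mul x).rTensor A (gR a y) = (H.mul.flip y).rTensor A (gL a x))
    (a : A) (x : Q) (t : Q ⊗[k] A) :
    coactMul μ gR a ((H.mul x).rTensor A t) = tensorProd H.mul μ (gR a x) t := by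
  induction t with
  | zero => simp
  | add x y hx hy => simp only [map_add, hx, hy]
  | tmul p d =>
    rw [LinearMap.rTensor_tmul, coactMul_tmul, right_mul_of_cover hg h, tensorProd_tmul_right,
      rTensor_lTensor]

theorem rTensor_coactMul
    (hg : ∀ a x y, (H.mul x).rTensor A (gR a y) = (H.mul.flip y).rTensor A (gL a x))
    (a : A) (x : Q) (t : Q ⊗[k] A) :
    (H.mul x).rTensor A (coactMul μ gR a t) = tensorProd H.mul μ (gL a x) t := by
  induction t with
  | zero => simp
  | add x y hx hy => simp only [map_add, hx, hy]
  | tmul p d =>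
    rw [coactMul_tmul, rTensor_lTensor, hg, tensorProd_tmul_right, rTensor_lTensor]

theorem coactMul_multiplier (hμ : IsAlg μ)
    (hg : ∀ a x y, (H.mul x).rTensor A (gR a y) = (H.mul.flip y).rTensor A (gL a x))
    (a : A) (s t : Q ⊗[k] A) :
    tensorProd H.mul μ (coactMul μ.flip gL a s) t = tensorProd H.mul μ s (coactMul μ gR a t) := by
  induction s with
  | zero => simp
  | add x y hx hy => simp only [map_add, hx, hy, LinearMap.add_apply]
  | tmul x c =>
    induction t with
    | zero => simp
    | add x y hx hy => simp only [map_add, hx, hy]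
    | tmul y d =>
      rw [tensorProd_tmul_left, tensorProd_tmul_right, coactMul_tmul, coactMul_tmul,
        LinearMap.flip_flip]
      simp only [rTensor_lTensor]
      rw [hg, ← LinearMap.lTensor_comp_apply, ← LinearMap.lTensor_comp_apply, hμ.mul_comp_flip]

theorem tensorProd_rTensor_assoc_symm (m : Q →ₗ[k] Q →ₗ[k] Q) (r w : Q)
    (t : Q ⊗[k] (Q ⊗[k] A)) :
    (tensorProd m m (r ⊗ₜ w)).rTensor A ((TensorProduct.assoc k Q Q A).symm t) =
      (TensorProduct.assoc k Q Q A).symm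
        ((m r).rTensor _ (((m w).rTensor A).lTensor Q t)) := by
  have : (tensorProd m m (r ⊗ₜ w)).rTensor A ∘ₗ (TensorProduct.assoc k Q Q A).symm.toLinearMap =
      (TensorProduct.assoc k Q Q A).symm.toLinearMap ∘ₗ (m r).rTensor _ ∘ₗ
        ((m w).rTensor A).lTensor Q := by
    ext x y z
    simp [tensorProd]
  exact LinearMap.congr_fun this t

/-- `(s ⊗ 1) (id ⊗ Γ)Γ(a) (t ⊗ 1)` computed in two ways. -/
theorem iterateCover_mul
    (hg : ∀ a x y, (H.mul x).rTensor A (gR a y) = (H.mul.flip y).rTensor A (gL a x))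
    (a : A) (s t : Q ⊗[k] Q) :
    ((tensorProd H.mul H.mul).flip t).rTensor A
        ((TensorProduct.assoc k Q Q A).symm (iterateCover gL a s)) =
      (tensorProd H.mul H.mul s).rTensor A
        ((TensorProduct.assoc k Q Q A).symm (iterateCover gR a t)) := by
  induction s with
  | zero => simp
  | add x y hx hy => simp only [map_add, hx, hy, LinearMap.rTensor_add, LinearMap.add_apply]
  | tmul r w =>
    induction t with
    | zero => simp
    | add x y hx hy => simp only [map_add, hx, hy, LinearMap.rTensor_add, LinearMap.add_apply]
    | tmul u v =>
      have h1 : (tensorProd H.mul H.mul).flip (u ⊗ₜ v) =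
          tensorProd H.mul.flip H.mul.flip (u ⊗ₜ v) :=
        LinearMap.ext fun x => (tensorProd_flip _ _).symm
      have h2 : (H.mul.flip v).rTensor A ∘ₗ gL.flip w = (H.mul w).rTensor A ∘ₗ gR.flip v :=
        LinearMap.ext fun c => (hg c w v).symm
      rw [h1, tensorProd_rTensor_assoc_symm, tensorProd_rTensor_assoc_symm, iterateCover_tmul,
        iterateCover_tmul, ← LinearMap.lTensor_comp_apply, ← LinearMap.lTensor_comp_apply,
        rTensor_lTensor, rTensor_lTensor, hg, h2]

theorem iterateCover_rTensor (h : H.IsRegular)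
    (hg : ∀ a x y, (H.mul x).rTensor A (gR a y) = (H.mul.flip y).rTensor A (gL a x))
    (a : A) (u : Q) (t : Q ⊗[k] Q) :
    iterateCover gR a ((H.mul.flip u).rTensor Q t) =
      (H.mul.flip u).rTensor _ (iterateCover gR a t) := by
  induction t with
  | zero => simp
  | add x y hx hy => simp only [map_add, hx, hy]
  | tmul p q =>
    rw [LinearMap.rTensor_tmul, iterateCover_tmul, iterateCover_tmul, LinearMap.flip_apply,
      right_mul_of_cover hg h, rTensor_lTensor]

theorem iterateCover_lTensor (h : H.IsRegular)
    (hg : ∀ a x y, (H.mul x).rTensor A (gR a y) = (H.mul.flip y).rTensor A (gL a x))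
    (a : A) (u : Q) (t : Q ⊗[k] Q) :
    iterateCover gR a ((H.mul.flip u).lTensor Q t) =
      ((H.mul.flip u).rTensor A).lTensor Q (iterateCover gR a t) := by
  induction t with
  | zero => simp
  | add x y hx hy => simp only [map_add, hx, hy]
  | tmul p q =>
    rw [LinearMap.lTensor_tmul, iterateCover_tmul, iterateCover_tmul,
      ← LinearMap.lTensor_comp_apply]
    congr 2
    ext c
    exact right_mul_of_cover hg h c q u

/-- Multiplication by Δ(x)(1 ⊗ y), which span Q ⊗ Q, converts the left cover of the coaction into a
right one, where coassociativity is known. The map `φ` stands for left multiplication by the cover,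
so `d2` and `d4` are treated together. -/
theorem coassoc_left_of_right (h : H.IsRegular)
    (hg : ∀ a x y, (H.mul x).rTensor A (gR a y) = (H.mul.flip y).rTensor A (gL a x))
    (hc : ∀ a q v, TensorProduct.assoc k Q Q A ((H.d1.flip v).rTensor A (gR a q)) =
      iterateCover gR a (H.d1 q v))
    (d : Q →ₗ[k] Q →ₗ[k] Q ⊗[k] Q) (φ : Q → Q ⊗[k] Q →ₗ[k] Q ⊗[k] Q)
    (hd : ∀ p v t, tensorProd H.mul H.mul (d p v) t = φ v (H.comulR p t)) (a : A) (q v : Q) :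
    TensorProduct.assoc k Q Q A ((d.flip v).rTensor A (gL a q)) = iterateCover gL a (d q v) := by
  rw [← LinearEquiv.eq_symm_apply, ← sub_eq_zero]
  refine eq_zero_of_rTensor
    (fun i : Q × Q => (tensorProd H.mul H.mul).flip (H.d1 i.1 i.2)) (fun x hx => ?_) _ fun i => ?_
  · refine (tensorProd_isAlg h.alg h.alg).nondeg_left x fun t => ?_
    obtain ⟨s, rfl⟩ := h.bij1.surjective t
    induction s with
    | zero => simp
    | add x y hx hy => simp only [map_add, hx, hy, add_zero]
    | tmul x y => exact hx (x, y)
  · have h1 : (tensorProd H.mul H.mul).flip (H.d1 i.1 i.2) ∘ₗ d.flip v =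
        (φ v ∘ₗ H.d1.flip i.2) ∘ₗ H.mul.flip i.1 :=
      LinearMap.ext fun p => (hd p v _).trans (congrArg (φ v) (h.d1_mul p i.1 i.2).symm)
    have h2 : tensorProd H.mul H.mul (d q v) ∘ₗ H.d1.flip i.2 =
        (φ v ∘ₗ H.d1.flip i.2) ∘ₗ H.mul q :=
      LinearMap.ext fun p => (hd q v _).trans (congrArg (φ v) (h.d1_mul q p i.2).symm)
    rw [map_sub, iterateCover_mul hg, ← hc, LinearEquiv.symm_apply_apply,
      ← LinearMap.rTensor_comp_apply, ← LinearMap.rTensor_comp_apply, h1, h2,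
      LinearMap.rTensor_comp_apply, LinearMap.rTensor_comp_apply _ (φ v ∘ₗ H.d1.flip i.2), hg,
      sub_self]

/-- It suffices to check coassociativity on one side. -/
theorem isCoveredComodule_of_right (h : H.IsRegular)
    (hg : ∀ a x y, (H.mul x).rTensor A (gR a y) = (H.mul.flip y).rTensor A (gL a x))
    (hi : ∀ a, (∀ y, gR a y = 0) → a = 0)
    (hc : ∀ a q t (f : Q →ₗ[k] Q ⊗[k] Q), (∀ p, f p = H.comulR p t) →
      TensorProduct.assoc k Q Q A (f.rTensor A (gR a q)) = iterateCover gR a (f q)) :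
    IsCoveredComodule H gR gL := by
  have hc1 : ∀ a q v, TensorProduct.assoc k Q Q A ((H.d1.flip v).rTensor A (gR a q)) =
      iterateCover gR a (H.d1 q v) := fun a q v => by
    refine h.cancel_flip fun u => ?_
    rw [rTensor_assoc_rTensor, hc a q (u ⊗ₜ v) _ fun p => rfl, ← iterateCover_rTensor h hg]
    rfl
  refine ⟨hg, hi, fun a ha => hi a fun y => ?_, hc1, ?_, fun a q v => ?_, ?_⟩
  · exact h.cancel_mul fun x => by rw [hg, ha, map_zero, map_zero]
  · refine coassoc_left_of_right h hg hc1 H.d2 (fun v => (H.mul v).rTensor Q) fun p v t => ?_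
    induction t with
    | zero => simp
    | add x y hx hy => simp only [map_add, hx, hy]
    | tmul r s =>
      rw [tensorProd_tmul_right, ← h.d1_d2, CoverData.comulR_tmul, ← LinearMap.rTensor_comp_apply,
        ← LinearMap.rTensor_comp_apply, h.alg.mul_comp_flip]
  · refine h.cancel_middle fun u => ?_
    rw [lTensor_rTensor_assoc, hc a q (v ⊗ₜ u) _ fun p => (h.d1_d3 p v u).symm,
      ← iterateCover_lTensor h hg]
    rfl
  · refine coassoc_left_of_right h hg hc1 H.d4 (fun v => (H.mul v).lTensor Q) fun p v t => ?_
    induction t with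
    | zero => simp
    | add x y hx hy => simp only [map_add, hx, hy]
    | tmul r s =>
      rw [tensorProd_tmul_right, ← h.d1_d4, CoverData.comulR_tmul, rTensor_lTensor]

/-- The Long conditions mention only the right cover; the left one follows by multiplying on the
other side and cancelling. -/
theorem isColinear_of_right (h : H.IsRegular)
    (hg : ∀ a x y, (H.mul x).rTensor A (gR a y) = (H.mul.flip y).rTensor A (gL a x))
    {f : A →ₗ[k] A} (hf : ∀ a y, gR (f a) y = f.lTensor Q (gR a y)) : IsColinear f gR gL := by
  refine ⟨hf, fun a y => h.cancel_flip fun u => ?_⟩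
  rw [← hg, hf, rTensor_lTensor, rTensor_lTensor, hg]

theorem CoactionsCommute.of_right {r : A →ₗ[k] Q →ₗ[k] Q ⊗[k] A} (h : H.IsRegular)
    (hg : ∀ a x y, (H.mul x).rTensor A (gR a y) = (H.mul.flip y).rTensor A (gL a x))
    (hr : CoactionsCommute r gR) : CoactionsCommute r gL := by
  have hcomm : ∀ (f : Q →ₗ[k] Q) (t : Q ⊗[k] (Q ⊗[k] A)), (f.rTensor A).lTensor Q
      (TensorProduct.leftComm k Q Q A t) = TensorProduct.leftComm k Q Q A (f.rTensor _ t) := by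
    intro f t
    have : (f.rTensor A).lTensor Q ∘ₗ (TensorProduct.leftComm k Q Q A).toLinearMap =
        (TensorProduct.leftComm k Q Q A).toLinearMap ∘ₗ f.rTensor _ := by
      ext x y z
      simp
    exact LinearMap.congr_fun this t
  intro a x y
  refine h.cancel_middle fun w => ?_
  have h1 : (H.mul.flip w).rTensor A ∘ₗ gL.flip x = (H.mul x).rTensor A ∘ₗ gR.flip w :=
    LinearMap.ext fun c => (hg c x w).symm
  rw [← LinearMap.lTensor_comp_apply, h1, LinearMap.lTensor_comp_apply, hr, hcomm, hcomm,
    rTensor_lTensor, rTensor_lTensor, hg]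

end Covered

section Span

variable {k Q A : Type*} [Field k] [AddCommGroup Q] [Module k Q] [AddCommGroup A] [Module k A]

theorem liftAct_surjective {act : Q →ₗ[k] A →ₗ[k] A}
    (h : Submodule.span k {b | ∃ x a, b = act x a} = ⊤) :
    Function.Surjective (TensorProduct.lift act) := by
  rw [← LinearMap.range_eq_top, eq_top_iff, ← h, Submodule.span_le]
  rintro _ ⟨x, a, rfl⟩
  exact ⟨x ⊗ₜ a, rfl⟩

end Span

section Swap

variable {k Q A : Type*} [Field k] [NonUnitalRing Q] [Module k Q] [AddCommGroup A] [Module k A]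

/-- A right coaction with its values reordered. -/
def RightCoaction.swap (ρ : RightCoaction k Q A) : LeftCoaction k Q A :=
  ⟨ρ.coverRight.compr₂ (TensorProduct.comm k A Q).toLinearMap,
    ρ.coverLeft.compr₂ (TensorProduct.comm k A Q).toLinearMap⟩

theorem RightCoaction.reverse_iterate (ρ : RightCoaction k Q A) (a : A) (t : Q ⊗[k] Q) :
    CoverData.reverse k A Q Q (TensorProduct.assoc k A Q Q (ρ.iterate a t)) =
      ρ.swap.iterate a (TensorProduct.comm k Q Q t) := by
  induction t with
  | zero => simp
  | add x y hx hy => simp only [map_add, hx, hy]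
  | tmul u v =>
    exact CoverData.reverse_assoc (ρ.coverRight.flip u) (ρ.coverRight a v)

end Swap

section Translate

variable {k Q A : Type*} [Field k] [NonUnitalRing Q] [Module k Q] [IsScalarTower k Q Q]
  [SMulCommClass k Q Q] [AddCommGroup A] [Module k A]
  {Δ Δ' : Q →ₙₐ[k] MTensor k Q} {H : CoverData k Q} {μ ν : A →ₗ[k] A →ₗ[k] A}

/-! ### Module algebras -/

/-- Since Q ▷ A = A, the factor left uncovered may be written as a sum of elements y ▷ a, which
reduces to the fully covered law. -/
theorem IsLeftModuleAlgebra.covered (hr : Realizes Δ H) (h : H.IsRegular)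
    {act : Q →ₗ[k] A →ₗ[k] A} (hA : IsLeftModuleAlgebra Δ μ act) :
    IsCoveredModuleAlgebra H μ act := by
  have hu : IsUnitalAction H.mul act := by
    refine ⟨?_, liftAct_surjective hA.unital⟩
    rw [hr.mul]
    exact hA.mul_act
  refine ⟨hu, fun x z a b => ?_, fun x y a b => ?_⟩
  · obtain ⟨t, rfl⟩ := hu.surj a
    induction t with
    | zero => simp [TensorProduct.map_zero_left]
    | add s t hs ht =>
      simp only [map_add, hs, ht, TensorProduct.map_add_left, LinearMap.add_apply]
    | tmul y a =>
      rw [TensorProduct.lift.tmul, hA.act_mul, hr.mulOn_eq h.alg, CoverData.comulR_tmul]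
      induction H.d1 x z with
      | zero => simp
      | add s t hs ht => simp only [map_add, hs, ht]
      | tmul p q => simp [hr.mul, hA.mul_act]
  · obtain ⟨t, rfl⟩ := hu.surj b
    induction t with
    | zero => simp [TensorProduct.map_zero_right]
    | add s t hs ht =>
      simp only [map_add, hs, ht, TensorProduct.map_add_right, LinearMap.add_apply]
    | tmul z b =>
      rw [TensorProduct.lift.tmul, hA.act_mul, hr.mulOn_eq h.alg, CoverData.comulR_tmul, h.d1_d3]
      induction H.d3 x y with
      | zero => simp
      | add s t hs ht => simp only [map_add, hs, ht]
      | tmul p q => simp [hr.mul, hA.mul_act]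

theorem IsRightModuleAlgebra.covered (hr : Realizes Δ H) (h : H.IsRegular)
    {ract : A →ₗ[k] Q →ₗ[k] A} (hA : IsRightModuleAlgebra Δ μ ract) :
    IsCoveredModuleAlgebra H.cop.op μ.flip ract.flip := by
  have hu : IsUnitalAction H.cop.op.mul ract.flip := by
    refine ⟨fun x y a => ?_, liftAct_surjective ?_⟩
    · change ract a (H.mul y x) = _
      rw [hr.mul]
      exact hA.act_mul a y x
    · rw [← hA.unital]
      congr 1
      ext b
      exact exists_comm
  refine ⟨hu, fun x z a b => ?_, fun x y a b => ?_⟩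
  · obtain ⟨t, rfl⟩ := hu.surj a
    induction t with
    | zero => simp [TensorProduct.map_zero_left]
    | add s t hs ht =>
      simp only [map_add, hs, ht, TensorProduct.map_add_left, LinearMap.add_apply]
    | tmul y a =>
      rw [TensorProduct.lift.tmul, LinearMap.flip_apply, LinearMap.flip_apply,
        LinearMap.flip_apply, LinearMap.flip_apply, hA.mul_act, hr.onMul_eq h.alg,
        CoverData.comulL_tmul, h.d4_d2]
      change _ = TensorProduct.lift μ.flip (TensorProduct.map _ _
        (TensorProduct.comm k Q Q (H.d2 x z)))
      induction H.d2 x z with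
      | zero => simp
      | add s t hs ht => simp only [map_add, hs, ht]
      | tmul p q => simp [hr.mul, hA.act_mul]
  · obtain ⟨t, rfl⟩ := hu.surj b
    induction t with
    | zero => simp [TensorProduct.map_zero_right]
    | add s t hs ht =>
      simp only [map_add, hs, ht, TensorProduct.map_add_right, LinearMap.add_apply]
    | tmul z b =>
      rw [TensorProduct.lift.tmul, LinearMap.flip_apply, LinearMap.flip_apply,
        LinearMap.flip_apply, LinearMap.flip_apply, hA.mul_act, hr.onMul_eq h.alg,
        CoverData.comulL_tmul]
      change _ = TensorProduct.lift μ.flip (TensorProduct.map _ _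
        (TensorProduct.comm k Q Q (H.d4 x y)))
      induction H.d4 x y with
      | zero => simp
      | add s t hs ht => simp only [map_add, hs, ht]
      | tmul p q => simp [hr.mul, hA.act_mul]

theorem isLeftModuleAlgebra_of_covered (hr : Realizes Δ H) (h : H.IsRegular)
    {act : Q →ₗ[k] A →ₗ[k] A} (hA : IsLeftModuleAlgebra Δ μ act)
    (hν : ∀ x z a b, act x (ν a (act z b)) =
      TensorProduct.lift ν (TensorProduct.map (act.flip a) (act.flip b) (H.d1 x z))) :
    IsLeftModuleAlgebra Δ ν act := by
  refine ⟨hA.mul_act, hA.unital, fun x y z a b => ?_⟩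
  rw [hν, hr.mulOn_eq h.alg, CoverData.comulR_tmul]
  induction H.d1 x z with
  | zero => simp
  | add s t hs ht => simp only [map_add, hs, ht]
  | tmul p q => simp [hr.mul, hA.mul_act]

theorem isRightModuleAlgebra_of_covered (hr : Realizes Δ H) (h : H.IsRegular)
    {ract : A →ₗ[k] Q →ₗ[k] A} (hA : IsRightModuleAlgebra Δ μ ract)
    (hν : ∀ x z a b, ract (ν (ract b z) a) x = TensorProduct.lift ν.flip
      (TensorProduct.map (ract a) (ract b) (H.cop.op.d1 x z))) :
    IsRightModuleAlgebra Δ ν ract := by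
  refine ⟨hA.act_mul, hA.unital, fun x y z a b => ?_⟩
  rw [hν, hr.onMul_eq h.alg, CoverData.comulL_tmul, h.d4_d2]
  change TensorProduct.lift ν.flip (TensorProduct.map (ract (ract b z)) (ract a)
    (TensorProduct.comm k Q Q (H.d2 x y))) = _
  induction H.d2 x y with
  | zero => simp
  | add s t hs ht => simp only [map_add, hs, ht]
  | tmul p q => simp [hr.mul, hA.act_mul]

/-! ### Comodule algebras -/

/-- The two operations of the multiplier Γ(a) are recovered from its covered values (`hmul`,
`honMul`); the covered laws then follow from nondegeneracy of the tensor product algebra. -/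
theorem IsLeftComoduleAlgebra.covered (hr : Realizes Δ H) (h : H.IsRegular) (hμ : IsAlg μ)
    {γ : LeftCoaction k Q A} (hγ : IsLeftComoduleAlgebra Δ μ γ) :
    IsCoveredComodule H γ.coverRight γ.coverLeft ∧
      IsCoactionMul μ γ.coverRight γ.coverLeft := by
  obtain ⟨Γ, hΓi, hΓm, hΓr, hΓl⟩ := hγ.exists_hom
  have hm : IsAlg (LinearMap.mul k Q) := hr.mul ▸ h.alg
  have hβ := tensorProd_isAlg hm hμ
  have r1 : ∀ a x t, tensorProd (LinearMap.mul k Q) μ (γ.coverRight a x) t =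
      mulOn (Γ a) ((LinearMap.mul k Q x).rTensor A t) := fun a x t =>
    (LinearMap.congr_fun (congrArg Prod.fst (hΓr a x)) t).symm
  have r2 : ∀ a x t, tensorProd (LinearMap.mul k Q) μ t (γ.coverRight a x) =
      ((LinearMap.mul k Q).flip x).rTensor A (onMul (Γ a) t) := fun a x t =>
    (LinearMap.congr_fun (congrArg (fun p : LinPair k (Q ⊗[k] A) => p.2.unop) (hΓr a x)) t).symm
  have l1 : ∀ a x t, tensorProd (LinearMap.mul k Q) μ (γ.coverLeft a x) t =
      (LinearMap.mul k Q x).rTensor A (mulOn (Γ a) t) := fun a x t =>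
    (LinearMap.congr_fun (congrArg Prod.fst (hΓl a x)) t).symm
  have l2 : ∀ a x t, tensorProd (LinearMap.mul k Q) μ t (γ.coverLeft a x) =
      onMul (Γ a) (((LinearMap.mul k Q).flip x).rTensor A t) := fun a x t =>
    (LinearMap.congr_fun (congrArg (fun p : LinPair k (Q ⊗[k] A) => p.2.unop) (hΓl a x)) t).symm
  have hmul : ∀ a s, mulOn (Γ a) s = coactMul μ γ.coverRight a s := by
    intro a s
    refine tensorProd_nondeg_left hm hμ fun t => ?_
    rw [← mulOn_mul hβ]
    induction s with
    | zero => simp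
    | add x y hx hy => simp only [map_add, hx, hy, LinearMap.add_apply]
    | tmul p c =>
      rw [coactMul_tmul, tensorProd_lTensor_middle hμ, r1, tensorProd_tmul_left]
  have honMul : ∀ a s, onMul (Γ a) s = coactMul μ.flip γ.coverLeft a s := by
    intro a s
    refine tensorProd_nondeg_right hm hμ fun t => ?_
    rw [← onMul_mul hβ]
    induction s with
    | zero => simp
    | add x y hx hy => simp only [map_add, hx, hy]
    | tmul p c =>
      rw [coactMul_tmul, LinearMap.flip_flip, ← tensorProd_lTensor_middle hμ, l2,
        tensorProd_tmul_right]
  refine ⟨isCoveredComodule_of_right h ?_ ?_ ?_, ?_, ?_⟩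
  · intro a x y
    rw [hr.mul]
    refine tensorProd_nondeg_left hm hμ fun t => ?_
    rw [tensorProd_mul_rTensor hm, r1, tensorProd_rTensor_middle hm, l1]
  · intro a ha
    apply hΓi
    have h2 : onMul (Γ a) = 0 := by
      refine LinearMap.ext fun t => ?_
      refine h.cancel_flip fun x => ?_
      rw [hr.mul, ← r2, ha, map_zero, LinearMap.zero_apply, map_zero]
    rw [map_zero]
    exact multiplier_ext ((mulOn_eq_zero_iff hβ _).2 h2) h2
  · intro a q t f hf
    have : f = comulMul Δ t := LinearMap.ext fun p => (hf p).trans (hr.mulOn_eq h.alg p t).symm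
    rw [this]
    exact hγ.coassoc a q t
  · intro a b y
    refine tensorProd_nondeg_left hm hμ fun t => ?_
    rw [← hmul, ← mulOn_mul hβ, r1, r1, hΓm]
    rfl
  · intro a b x
    refine tensorProd_nondeg_right hm hμ fun t => ?_
    rw [← honMul, ← onMul_mul hβ, l2, l2, hΓm]
    rfl

/-- Coassociativity does not involve the product of `A`, so for a new product only multiplicativity
matters. The multipliers are rebuilt from the same covered values. -/
theorem isLeftComoduleAlgebra_of_covered (hr : Realizes Δ H) (h : H.IsRegular) (hμ : IsAlg μ)
    (hν : IsAlg ν) {γ : LeftCoaction k Q A} (hγ : IsLeftComoduleAlgebra Δ μ γ)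
    (hc : IsCoactionMul ν γ.coverRight γ.coverLeft) : IsLeftComoduleAlgebra Δ ν γ := by
  obtain ⟨hγc, -⟩ := hγ.covered hr h hμ
  refine ⟨?_, hγ.coassoc⟩
  rw [← hr.mul]
  let Γ : A →ₗ[k] multiplierAlgebra (tensorProd H.mul ν) :=
    { toFun := fun a => ⟨(coactMul ν γ.coverRight a,
        MulOpposite.op (coactMul ν.flip γ.coverLeft a)), coactMul_multiplier hν hγc.cover a⟩
      map_add' := fun a b => multiplier_ext (coactMul_add _ _ a b) (coactMul_add _ _ a b)
      map_smul' := fun r a => multiplier_ext (coactMul_smul _ _ r a) (coactMul_smul _ _ r a) }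
  have hop : ∀ a x t, coactMul ν.flip γ.coverLeft a ((H.mul.flip x).rTensor A t) =
      tensorProd H.mul ν t (γ.coverLeft a x) := fun a x t => by
    rw [← tensorProd_flip]
    exact coactMul_rTensor h.op hγc.op.cover a x t
  have hop' : ∀ a x t, (H.mul.flip x).rTensor A (coactMul ν.flip γ.coverLeft a t) =
      tensorProd H.mul ν t (γ.coverRight a x) := fun a x t => by
    rw [← tensorProd_flip]
    exact rTensor_coactMul hγc.op.cover a x t
  refine ⟨Γ, ?_, ?_, ?_, ?_⟩
  · rw [injective_iff_map_eq_zero]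
    intro a ha
    have h0 : coactMul ν γ.coverRight a = 0 := congrArg mulOn ha
    refine hγc.inj_right a fun y => ?_
    refine eq_zero_of_lTensor ν.flip (fun x hx => hν.nondeg_left x hx) _ fun c => ?_
    rw [← coactMul_tmul, h0, LinearMap.zero_apply]
  · intro a b
    exact multiplier_ext (LinearMap.ext fun t => coactMul_mul hν hc.right a b t)
      (LinearMap.ext fun t => coactMul_mul hν.flip hc.flip.right b a t)
  · intro a x
    exact Prod.ext (LinearMap.ext fun t => coactMul_rTensor h hγc.cover a x t)
      (MulOpposite.unop_injective (LinearMap.ext fun t => hop' a x t))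
  · intro a x
    exact Prod.ext (LinearMap.ext fun t => rTensor_coactMul hγc.cover a x t)
      (MulOpposite.unop_injective (LinearMap.ext fun t => hop a x t))

theorem comulMul_comm (hΔ : ∀ x, Δ' x = flipMultiplier (Δ x)) (t : Q ⊗[k] Q) :
    comulMul Δ' (TensorProduct.comm k Q Q t) =
      (TensorProduct.comm k Q Q).toLinearMap ∘ₗ comulMul Δ t := by
  refine LinearMap.ext fun p => ?_
  change mulOn (Δ' p) _ = TensorProduct.comm k Q Q (mulOn (Δ p) t)
  rw [hΔ]
  exact congrArg (fun s => TensorProduct.comm k Q Q (mulOn (Δ p) s))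
    ((TensorProduct.comm k Q Q).symm_apply_apply t)

/-- A right coaction over Δ is a left one over the flipped coproduct, so no separate theory of right
comodule algebras is needed. -/
theorem isRightComoduleAlgebra_iff_swap (hΔ : ∀ x, Δ' x = flipMultiplier (Δ x))
    (ρ : RightCoaction k Q A) :
    IsRightComoduleAlgebra Δ μ ρ ↔ IsLeftComoduleAlgebra Δ' μ ρ.swap := by
  have hc : ∀ a q t, (comulMul Δ t).lTensor A (ρ.coverRight a q) =
        TensorProduct.assoc k A Q Q (ρ.iterate a (comulMul Δ t q)) ↔
      TensorProduct.assoc k Q Q A ((comulMul Δ' (TensorProduct.comm k Q Q t)).rTensor A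
        (ρ.swap.coverRight a q)) =
          ρ.swap.iterate a (comulMul Δ' (TensorProduct.comm k Q Q t) q) := by
    intro a q t
    rw [← (CoverData.reverse k A Q Q).injective.eq_iff, CoverData.reverse_lTensor,
      ρ.reverse_iterate, comulMul_comm hΔ]
    rfl
  constructor
  · rintro ⟨⟨Υ, h1, h2, h3, h4⟩, h5⟩
    refine ⟨⟨swapMultiplier ∘ₗ Υ, swapMultiplier_injective.comp h1, fun a b => ?_, fun a x => ?_,
      fun a x => ?_⟩, fun a q t => ?_⟩
    · rw [LinearMap.comp_apply, h2]
      exact swapMultiplier_mul _ _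
    · exact (mul_secondLeg_iff _ _ _).1 (h3 a x)
    · exact (secondLeg_mul_iff _ _ _).1 (h4 a x)
    · obtain ⟨t, rfl⟩ := (TensorProduct.comm k Q Q).surjective t
      exact (hc a q t).1 (h5 a q t)
  · rintro ⟨⟨Γ, h1, h2, h3, h4⟩, h5⟩
    refine ⟨⟨swapMultiplier ∘ₗ Γ, swapMultiplier_injective.comp h1, fun a b => ?_, fun a x => ?_,
      fun a x => ?_⟩, fun a q t => (hc a q t).2 (h5 a q _)⟩
    · rw [LinearMap.comp_apply, h2]
      exact swapMultiplier_mul _ _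
    · refine (mul_secondLeg_iff _ _ _).2 ?_
      rw [LinearMap.comp_apply, swapMultiplier_swapMultiplier]
      exact h3 a x
    · refine (secondLeg_mul_iff _ _ _).2 ?_
      rw [LinearMap.comp_apply, swapMultiplier_swapMultiplier]
      exact h4 a x

end Translate

/-! ### Right and L-R-twisted products in left-handed form -/

section Swap

variable {k Q A : Type*} [Field k] [NonUnitalRing Q] [Module k Q] [AddCommGroup A] [Module k A]
  {μ ν : A →ₗ[k] A →ₗ[k] A} {act : Q →ₗ[k] A →ₗ[k] A} {ract : A →ₗ[k] Q →ₗ[k] A}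
  {γ : LeftCoaction k Q A} {ρ : RightCoaction k Q A}

theorem lTensor_comm_assoc (f : A →ₗ[k] Q ⊗[k] A) (t : A ⊗[k] Q) :
    (TensorProduct.comm k A Q).toLinearMap.lTensor Q
        (TensorProduct.assoc k Q A Q (f.rTensor Q t)) =
      TensorProduct.leftComm k Q Q A (f.lTensor Q (TensorProduct.comm k A Q t)) := by
  induction t with
  | zero => simp
  | add x y hx hy => simp only [map_add, hx, hy]
  | tmul a q =>
    simp only [LinearMap.rTensor_tmul, TensorProduct.comm_tmul, LinearMap.lTensor_tmul]
    induction f a with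
    | zero => simp
    | add x y hx hy => simp only [map_add, hx, hy, TensorProduct.add_tmul, TensorProduct.tmul_add]
    | tmul r s => simp

theorem isRightTwistedProduct_iff : IsRightTwistedProduct μ ract ρ ν ↔
    IsTwist μ.flip ract.flip ρ.swap.coverLeft ν.flip := by
  have key : ∀ b t, evalAct μ.flip ract.flip b (TensorProduct.comm k A Q t) =
      TensorProduct.lift (μ ∘ₗ ract b).flip t := by
    intro b t
    induction t with
    | zero => simp
    | add x y hx hy => simp only [map_add, hx, hy]
    | tmul c p => simp
  constructor
  · intro h a y b
    exact (h b y a).trans (key b _).symm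
  · intro h a y b
    exact (h b y a).trans (key a _)

theorem isLRTwistedProduct_iff : IsLRTwistedProduct μ act ract γ ρ ν ↔
    IsLRTwist μ act ract.flip γ.coverRight ρ.swap.coverLeft ν := by
  have key : ∀ s t, evalLR μ act ract.flip s (TensorProduct.comm k A Q t) =
      lrEval μ act ract (s ⊗ₜ t) := by
    intro s t
    induction s with
    | zero => simp
    | add x y hx hy => simp only [map_add, hx, hy, LinearMap.add_apply, TensorProduct.add_tmul]
    | tmul q a =>
      induction t with
      | zero => simp
      | add x y hx hy => simp only [map_add, hx, hy, TensorProduct.tmul_add]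
      | tmul b p => simp [lrEval]
  exact forall₄_congr fun a y z b => by rw [← key]; rfl

end Swap

/-! ### Four-sided Long module algebras in covered form -/

section Main

variable {k Q A : Type*} [Field k] [NonUnitalRing Q] [Module k Q] [IsScalarTower k Q Q]
  [SMulCommClass k Q Q] [AddCommGroup A] [Module k A]
  {Δ Δ' : Q →ₙₐ[k] MTensor k Q} {H : CoverData k Q} {μ ν : A →ₗ[k] A →ₗ[k] A}
  {act : Q →ₗ[k] A →ₗ[k] A} {ract : A →ₗ[k] Q →ₗ[k] A} {γ : LeftCoaction k Q A}
  {ρ : RightCoaction k Q A}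

theorem IsRightComoduleAlgebra.covered (hr : Realizes Δ' H.cop) (h : H.IsRegular)
    (hΔ : ∀ x, Δ' x = flipMultiplier (Δ x)) (hμ : IsAlg μ) (hρ : IsRightComoduleAlgebra Δ μ ρ) :
    IsCoveredComodule H.cop ρ.swap.coverRight ρ.swap.coverLeft ∧
      IsCoactionMul μ ρ.swap.coverRight ρ.swap.coverLeft :=
  ((isRightComoduleAlgebra_iff_swap hΔ ρ).1 hρ).covered hr h.cop hμ

theorem isRightComoduleAlgebra_of_covered (hr : Realizes Δ' H.cop) (h : H.IsRegular)
    (hΔ : ∀ x, Δ' x = flipMultiplier (Δ x)) (hμ : IsAlg μ) (hν : IsAlg ν)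
    (hρ : IsRightComoduleAlgebra Δ μ ρ)
    (hc : IsCoactionMul ν ρ.swap.coverRight ρ.swap.coverLeft) : IsRightComoduleAlgebra Δ ν ρ :=
  (isRightComoduleAlgebra_iff_swap hΔ ρ).2 (isLeftComoduleAlgebra_of_covered hr h.cop hμ hν
    ((isRightComoduleAlgebra_iff_swap hΔ ρ).1 hρ) hc)

theorem swap_isColinear (hr : Realizes Δ' H.cop) (h : H.IsRegular)
    (hΔ : ∀ x, Δ' x = flipMultiplier (Δ x)) (hμ : IsAlg μ) (hρ : IsRightComoduleAlgebra Δ μ ρ)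
    {f : A →ₗ[k] A} (hf : ∀ a y, ρ.coverRight (f a) y = f.rTensor Q (ρ.coverRight a y)) :
    IsColinear f ρ.swap.coverRight ρ.swap.coverLeft :=
  isColinear_of_right h.cop (hρ.covered hr h hΔ hμ).1.cover fun a y =>
    (congrArg _ (hf a y)).trans (LinearMap.lTensor_comm _ _).symm

theorem IsFourSidedLong.covered (hr : Realizes Δ H) (hr' : Realizes Δ' H.cop) (h : H.IsRegular)
    (hΔ : ∀ x, Δ' x = flipMultiplier (Δ x)) (hA : IsFourSidedLong Δ μ act ract γ ρ) :
    IsCoveredFourSided H μ act ract.flip γ.coverRight γ.coverLeft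
      ρ.swap.coverRight ρ.swap.coverLeft := by
  have hμ := hA.leftLeft.alg
  obtain ⟨hγ, hγm⟩ := hA.leftLeft.comoduleAlgebra.covered hr h hμ
  have hρΔ := hA.rightRight.comoduleAlgebra
  obtain ⟨hρ, hρm⟩ := hρΔ.covered hr' h hΔ hμ
  have hcomm : CoactionsCommute γ.coverRight ρ.swap.coverLeft := fun a x y => by
    have := congrArg ((TensorProduct.comm k A Q).toLinearMap.lTensor Q) (hA.bicomodule x a y)
    rw [lTensor_comm_assoc, ← LinearMap.lTensor_comp_apply] at this
    exact this
  exact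
    { left := ⟨hμ, hA.leftLeft.moduleAlgebra.covered hr h, hγ, hγm, fun x =>
        isColinear_of_right h hγ.cover (hA.leftLeft.long x)⟩
      right := ⟨hμ.flip, hA.rightRight.moduleAlgebra.covered hr h, hρ.op, hρm.flip, fun x =>
        (swap_isColinear hr' h hΔ hμ hρΔ (hA.rightRight.long x)).flip⟩
      act_colinear := fun x => swap_isColinear hr' h hΔ hμ hρΔ (hA.leftRight.long x)
      ract_colinear := fun x => isColinear_of_right h hγ.cover (hA.rightLeft.long x)
      bimodule := fun x y a => hA.bimodule x a y
      -- The bicomodule axiom gives one choice of covers; the other two needed choices follow by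
      -- changing the side of a cover.
      commute_right_right := hcomm.of_right h.cop.op hρ.op.cover
      commute_right_left := hcomm
      commute_left_left := (hcomm.symm.of_right h hγ.cover).symm }

end Main

/-! ### Existence and uniqueness of the L-R-twisted product -/

section Products

variable {k Q A : Type*} [Field k] [AddCommGroup Q] [Module k Q] [AddCommGroup A] [Module k A]
  {H : CoverData k Q} {μ ν lr : A →ₗ[k] A →ₗ[k] A} {act ract : Q →ₗ[k] A →ₗ[k] A}
  {gR gL rR rL : A →ₗ[k] Q →ₗ[k] Q ⊗[k] A}

namespace IsCoveredFourSided

/-- Twist twice: first form •, then its right twisted product. -/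
theorem exists_isLRTwist (h : H.IsRegular)
    (hA : IsCoveredFourSided H μ act ract gR gL rR rL) : ∃ lr, IsLRTwist μ act ract gR rL lr := by
  obtain ⟨ν, hν⟩ := exists_isTwist h hA.left.modAlg.toIsUnitalAction hA.left.comod μ
  obtain ⟨lr, hlr⟩ := exists_isTwist h.cop.op hA.right.modAlg.toIsUnitalAction hA.right.comod ν.flip
  exact ⟨lr.flip, (hA.isLRTwist_iff hν _).2 hlr⟩

theorem isTwist_flip_iff (hA : IsCoveredFourSided H μ act ract gR gL rR rL)
    (hν : IsTwist μ act gR ν) (hlr : IsLRTwist μ act ract gR rL lr) (κ : A →ₗ[k] A →ₗ[k] A) :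
    IsTwist ν.flip ract rL κ.flip ↔ κ = lr := by
  have hlr' := (hA.isLRTwist_iff hν lr).1 hlr
  constructor
  · intro h
    exact congrArg LinearMap.flip (h.unique hA.right.modAlg.toIsUnitalAction hlr')
  · rintro rfl
    exact hlr'

end IsCoveredFourSided
end Products

end TwistedAlg
end

/-- For a four-sided Long module algebra `A` over a regular multiplier Hopf algebra `Q`: the left
twisted product `•`, the right twisted product `∗` and the L-R-twisted product `⊛` are well defined;
`(A, •)` is a right-right Long module algebra whose right twisted product is `⊛`; and `(A, ∗)` is a
left-left Long module algebra whose left twisted product is `⊛`. -/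
theorem proposition4p4 {k Q A : Type*} [Field k]
    [NonUnitalRing Q] [Module k Q] [IsScalarTower k Q Q] [SMulCommClass k Q Q]
    [NonUnitalRing A] [Module k A] [IsScalarTower k A A] [SMulCommClass k A A]
    (Δ : Q →ₙₐ[k] TwistedAlg.MTensor k Q) (hQ : TwistedAlg.IsRegularMultiplierHopf Δ)
    (act : Q →ₗ[k] A →ₗ[k] A) (ract : A →ₗ[k] Q →ₗ[k] A)
    (γ : TwistedAlg.LeftCoaction k Q A) (ρ : TwistedAlg.RightCoaction k Q A)
    (hA : TwistedAlg.IsFourSidedLong Δ (LinearMap.mul k A) act ract γ ρ) :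
    (∃! lt, TwistedAlg.IsLeftTwistedProduct (LinearMap.mul k A) act γ lt) ∧
    (∃! rt, TwistedAlg.IsRightTwistedProduct (LinearMap.mul k A) ract ρ rt) ∧
    (∃! lr, TwistedAlg.IsLRTwistedProduct (LinearMap.mul k A) act ract γ ρ lr) ∧
    ∀ lt rt lr : A →ₗ[k] A →ₗ[k] A,
      TwistedAlg.IsLeftTwistedProduct (LinearMap.mul k A) act γ lt →
      TwistedAlg.IsRightTwistedProduct (LinearMap.mul k A) ract ρ rt →
      TwistedAlg.IsLRTwistedProduct (LinearMap.mul k A) act ract γ ρ lr →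
      (TwistedAlg.IsRightRightLong Δ lt ract ρ ∧
        ∀ ν, TwistedAlg.IsRightTwistedProduct lt ract ρ ν ↔ ν = lr) ∧
      (TwistedAlg.IsLeftLeftLong Δ rt act γ ∧
        ∀ ν, TwistedAlg.IsLeftTwistedProduct rt act γ ν ↔ ν = lr) := by
  obtain ⟨H, Δ', hΔ, h, hr, hr'⟩ := hQ.exists_realizes
  have hC := hA.covered hr hr' h hΔ
  have hμ := hA.leftLeft.alg
  have hu := hC.left.modAlg.toIsUnitalAction
  have hu' := hC.right.modAlg.toIsUnitalAction
  have hlt := TwistedAlg.exists_isTwist h hu hC.left.comod (LinearMap.mul k A)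
  refine ⟨?_, ?_, ?_, fun lt rt lr hl hr₁ hlr => ?_⟩
  · exact existsUnique_of_exists_of_unique hlt fun _ _ h₁ h₂ => TwistedAlg.IsTwist.unique hu h₁ h₂
  · obtain ⟨rt, hrt⟩ := TwistedAlg.exists_isTwist h.cop.op hu' hC.right.comod
      (LinearMap.mul k A).flip
    refine existsUnique_of_exists_of_unique
      ⟨rt.flip, TwistedAlg.isRightTwistedProduct_iff.2 hrt⟩ fun _ _ h₁ h₂ => ?_
    exact congrArg LinearMap.flip (TwistedAlg.IsTwist.unique hu'
      (TwistedAlg.isRightTwistedProduct_iff.1 h₁) (TwistedAlg.isRightTwistedProduct_iff.1 h₂))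
  · simp only [TwistedAlg.isLRTwistedProduct_iff]
    obtain ⟨lt, hlt⟩ := hlt
    -- Two L-R-twisted products are both right twisted products of the same •, and those are unique.
    exact existsUnique_of_exists_of_unique (hC.exists_isLRTwist h) fun lr _ h₁ h₂ =>
      (hC.isTwist_flip_iff hlt h₂ lr).1 ((hC.isLRTwist_iff hlt lr).1 h₁)
  · rw [TwistedAlg.isLRTwistedProduct_iff] at hlr
    rw [TwistedAlg.isRightTwistedProduct_iff] at hr₁
    have hlt : TwistedAlg.IsTwist _ _ _ lt := hl
    have hM := hC.mirror
    have halg := hC.left.twist_isAlg h hlt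
    have halg' := (hC.right.twist_isAlg h.cop.op hr₁).flip
    refine ⟨⟨⟨halg, ?_, ?_, hA.rightRight.long⟩, fun ν => ?_⟩,
      ⟨⟨halg', ?_, ?_, hA.leftLeft.long⟩, fun ν => ?_⟩⟩
    · exact TwistedAlg.isRightModuleAlgebra_of_covered hr h hA.rightRight.moduleAlgebra
        fun x z a b => hC.ract_twist hlt x z a b
    · exact TwistedAlg.isRightComoduleAlgebra_of_covered hr' h hΔ hμ halg
        hA.rightRight.comoduleAlgebra (hC.coactionMul_twist hlt)
    · rw [TwistedAlg.isRightTwistedProduct_iff]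
      exact hC.isTwist_flip_iff hlt hlr ν
    · refine TwistedAlg.isLeftModuleAlgebra_of_covered hr h hA.leftLeft.moduleAlgebra
        fun x z a b => ?_
      have := hM.ract_twist hr₁ x z a b
      rw [TwistedAlg.CoverData.cop_op_cop_op] at this
      exact this
    · exact TwistedAlg.isLeftComoduleAlgebra_of_covered hr h hμ halg'
        hA.leftLeft.comoduleAlgebra (hM.coactionMul_twist hr₁).flip
    · have := hM.isTwist_flip_iff hr₁ hlr.flip ν.flip
      exact this.trans ⟨fun h => congrArg LinearMap.flip h, fun h => congrArg LinearMap.flip h⟩
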